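/- Let $f,g:[t_-,t_+]\to\mathbb R$ be smooth with $f'^2+g'^2=1$ and $t\mapsto(f(t),g(t))$ injective, and let $M\subset\mathbb R^3$ be the embedded surface of revolution $$M=\{(f(t)\cos\phi,\ f(t)\sin\phi,\ g(t)) : t\in[t_-,t_+],\ \phi\in[0,2\pi]\},$$ with the induced metric $dt^2+f(t)^2d\phi^2$. Assume that $f>0$ on $(t_-,t_+)$, that $f(t_\pm)=0$, and that the metric is smooth at the two poles, i.e. $f'(t_-)=1$, $f'(t_+)=-1$ and all derivatives of $f$ of even order vanish at $t_\pm$. Assume further that $f'$ vanishes at exactly one point $t_0\in[t_-,t_+]$, and that $f''(t_0)\ne0$; the circle $\{t=t_0\}$ is called the equator. Let $\Phi_t$ be the Hamiltonian flow of $p_1(x,\xi)=|\xi|_g$ on $T^*M\setminus 0$ (the geodesic flow), and for $x\in M$ let $S^*_xM=\{\xi\in T^*_xM:|\xi|_g=1\}$. The recurrent set $\mathcal R_x\subset S^*_xM$ is the set of all $\xi\in S_x^*M$ with $$\xi\in\bigcap_{T>0}\overline{\{\zeta\in S^*_xM:\exists\,t>T,\ \Phi_t(x,\xi)=(x,\zeta)\}}\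 \cap\ \bigcap_{T>0}\overline{\{\zeta\in S^*_xM:\exists\,t>T,\ \Phi_{-t}(x,\xi)=(x,\zeta)\}},$$ closures being taken in $S^*_xM$. The metric is called Zoll if all its geodesics are closed and have the same length, i.e. all orbits of $\Phi_t$ on the unit cosphere bundle are periodic with a common least period. Suppose that $f$ is real-analytic on $[t_-,t_+]$ and that the metric of $M$ is not Zoll, and let $x\in M$ lie on the equator. Then $\mathcal R_x$ is dense in $S^*_xM$, and $\mu(\mathcal R_x)=0$, where $\mu$ is the induced Liouville measure on $S^*_xM$ (the arc-length measure of the unit circle of $(T_x^*M,|\cdot|_g)$). -/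

import Mathlib

open Set MeasureTheory
open scoped ContDiff

/-- Euclidean three-space. -/
abbrev E3 : Type := EuclideanSpace ℝ (Fin 3)

/-- A surface of revolution embedded in `ℝ³`, with unit-speed profile curve `t ↦ (f t, g t)`,
`t ∈ [tmin, tmax]`, closing up smoothly at two poles and having exactly one equator `t = t₀`.
Smooth functions on the closed interval are given as restrictions of smooth functions on `ℝ`;
the values outside `[tmin, tmax]` play no role. -/
structure SurfaceOfRevolution where
  tmin : ℝ
  tmax : ℝ
  tmin_lt_tmax : tmin < tmax
  /-- distance to the axis of rotation (the profile function) -/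
  f : ℝ → ℝ
  /-- height -/
  g : ℝ → ℝ
  f_smooth : ContDiff ℝ ∞ f
  g_smooth : ContDiff ℝ ∞ g
  /-- the profile curve is parametrized by arc length, so the metric is `dt² + f(t)² dφ²` -/
  unit_speed : ∀ t ∈ Icc tmin tmax, deriv f t ^ 2 + deriv g t ^ 2 = 1
  /-- the profile curve is simple -/
  profile_injOn : InjOn (fun t => (f t, g t)) (Icc tmin tmax)
  f_pos : ∀ t ∈ Ioo tmin tmax, 0 < f t
  f_tmin : f tmin = 0
  f_tmax : f tmax = 0
  /-- smoothness of the metric `dt² + f(t)² dφ²` at the two poles: the slope is `±1` and all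
  derivatives of even order vanish -/
  deriv_f_tmin : deriv f tmin = 1
  deriv_f_tmax : deriv f tmax = -1
  even_deriv_f_tmin : ∀ k : ℕ, iteratedDeriv (2 * k) f tmin = 0
  even_deriv_f_tmax : ∀ k : ℕ, iteratedDeriv (2 * k) f tmax = 0
  /-- the only critical point of `f`, and it is nondegenerate -/
  t₀ : ℝ
  t₀_mem : t₀ ∈ Icc tmin tmax
  deriv_f_t₀ : deriv f t₀ = 0
  deriv2_f_t₀ : iteratedDeriv 2 f t₀ ≠ 0
  eq_t₀ : ∀ t ∈ Icc tmin tmax, deriv f t = 0 → t = t₀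

namespace SurfaceOfRevolution

noncomputable section

variable (M : SurfaceOfRevolution)

/-- The parametrization `(t, φ) ↦ (f(t) cos φ, f(t) sin φ, g(t))`. -/
def param (t φ : ℝ) : E3 := !₂[M.f t * Real.cos φ, M.f t * Real.sin φ, M.g t]

/-- The surface as a subset of `ℝ³`. -/
def carrier : Set E3 := {p | ∃ t ∈ Icc M.tmin M.tmax, ∃ φ : ℝ, p = M.param t φ}

/-- The equator `t = t₀`. -/
def equator : Set E3 := {p | ∃ φ : ℝ, p = M.param M.t₀ φ}

/-- The tangent plane at `p`: velocities at `p` of curves in the surface. -/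
def tangentPlane (p : E3) : Set E3 :=
  {v | ∃ c : ℝ → E3, (∀ τ, c τ ∈ M.carrier) ∧ c 0 = p ∧ HasDerivAt c v 0}

/-- The cotangent bundle `T*M`, as a subset of `T*ℝ³ = ℝ³ × ℝ³`. A covector at `p` is represented
by the vector of the tangent plane dual to it under the induced metric; equivalently, it is
extended to `ℝ³` by zero on the normal line. -/
def cotangentBundle : Set (E3 × E3) := {z | z.1 ∈ M.carrier ∧ z.2 ∈ M.tangentPlane z.1}

/-- The Hamiltonian `p₁(x, ξ) = |ξ|_g`. -/
def p₁ (z : E3 × E3) : ℝ := ‖z.2‖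

/-- The canonical symplectic form `∑ dxᵢ ∧ dξᵢ` of `T*ℝ³`. Its restriction to tangent vectors of
`T*M` is the canonical symplectic form of `T*M` (the tautological one-form `ξ · dx` restricts to
the tautological one-form). -/
def symplecticForm (a b : E3 × E3) : ℝ := inner ℝ a.1 b.2 - inner ℝ a.2 b.1

/-- Integral curves (defined for all time) in `T*M ∖ 0` of the Hamiltonian vector field `X` of `p₁`,
given by `ω(X, w) = dp₁(w)` for every vector `w` tangent to `T*M`; the tangent vectors `w` are the
velocities of curves `b` in `T*M`. -/
def IsHamiltonianCurve (z : ℝ → E3 × E3) : Prop :=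
  (∀ s, z s ∈ M.cotangentBundle ∧ (z s).2 ≠ 0) ∧
  ∀ s, DifferentiableAt ℝ z s ∧
    ∀ (b : ℝ → E3 × E3) (w : E3 × E3), (∀ τ, b τ ∈ M.cotangentBundle) → b 0 = z s →
      HasDerivAt b w 0 → HasDerivAt (fun τ => p₁ (b τ)) (symplecticForm (deriv z s) w) 0

/-- The graph of the Hamiltonian flow: `Φ_t(a) = b`, where `t` may be negative. -/
def FlowsTo (t : ℝ) (a b : E3 × E3) : Prop :=
  ∃ z : ℝ → E3 × E3, M.IsHamiltonianCurve z ∧ z 0 = a ∧ z t = b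

/-- The metric is Zoll: all geodesics are closed and have the same length, that is, all orbits of
the geodesic flow on the unit cosphere bundle are periodic with a common least period. -/
def IsZoll : Prop :=
  ∃ ℓ : ℝ, 0 < ℓ ∧ ∀ z : ℝ → E3 × E3, M.IsHamiltonianCurve z → p₁ (z 0) = 1 →
    Function.Periodic z ℓ ∧ ∀ ℓ' : ℝ, 0 < ℓ' → ℓ' < ℓ → ¬ Function.Periodic z ℓ'

/-- The unit cosphere `S*_x M`. -/
def cosphere (x : E3) : Set E3 := {ξ | (x, ξ) ∈ M.cotangentBundle ∧ p₁ (x, ξ) = 1}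

/-- The recurrent set `R_x ⊆ S*_x M`: the covectors `ξ` that lie in both the forward and the
backward limit set of the returns to `S*_x M` of the orbit through `(x, ξ)`. -/
def recurrentSet (x : E3) : Set (M.cosphere x) :=
  {ξ | (ξ ∈ ⋂ T ∈ Ioi (0 : ℝ),
          closure {ζ : M.cosphere x | ∃ t > T, M.FlowsTo t (x, ξ) (x, ζ)}) ∧
       (ξ ∈ ⋂ T ∈ Ioi (0 : ℝ),
          closure {ζ : M.cosphere x | ∃ t > T, M.FlowsTo (-t) (x, ξ) (x, ζ)})}

/-- The Liouville measure induced on `S*_x M`: arc length on the unit circle of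
`(T*_x M, |·|_g)`. -/
def liouville (x : E3) : Measure (M.cosphere x) := Measure.hausdorffMeasure 1

end

end SurfaceOfRevolution

open Filter Topology

/-! The geodesic flow is integrated by Clairaut's constant `c`. Let `m` be the radius of the equator
and let `u` be the analytic function on the profile with `u² + f² = m²` and `u` increasing through
`0` at `t₀`; put `f' = -u k`. Along a unit-speed geodesic the pair `(u, f t')` turns about the
origin with angular speed `k > 0`, so `u = a sin ψ` and `f t' = a cos ψ` with `a² + c² = m²` and `ψ'
= k`. With `F = 1/k` as a function of `u`, time is `∫ F(a sin x) dx` and, for `c ≠ 0`, longitude is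
`c ∫ F(a sin x) / (m² - a² sin² x) dx`. The advance in longitude per oscillation is thus, up to the
sign of `c`, the function `rotation a = √(m² - a²) ∫₀^{2π} F(a sin x) / (m² - a² sin² x) dx`,
analytic on `(-m, m)`.

If `rotation` is constant, the metric is Zoll (`isZoll_of_forall_rotationIntegral_eq`). As `a → m`
the kernel concentrates where `F` is close to `F(±m) = m`, which forces the constant to be `2π`.
Subtracting the case `F = m`, the even part of `(F - m)/(m² - w²)` integrates to zero along every `a
sin x`, hence vanishes by analyticity. So `F(w) + F(-w) = 2m`, and every geodesic has least period
`2πm`.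

In the non-Zoll case `rotation` is therefore a nonconstant analytic function, and it takes values in
`2πℚ` on a countable set of amplitudes that meets every interval. A covector on the equator at angle
`θ` to the meridian has `a = m cos θ` and `c = m sin θ`. If `sin θ ≠ 0` and `rotation a ∈ 2πℚ`, its
orbit closes up, so it is recurrent (`mem_recurrentSet_of_rational`): this gives density. If `sin θ`
and `cos θ` are nonzero and the value is not in `2πℚ`, the orbit returns over `x` only finitely
often, so it is not recurrent (`rational_of_mem_recurrentSet`). Hence the recurrent set is
countable, and countable sets are null for arc length. -/

/-! ### Analytic dependence of integrals on a parameter -/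

/-- A real-analytic germ extends to a complex-analytic germ. -/
theorem AnalyticAt.exists_complex_extension {f : ℝ → ℝ} {x : ℝ} (hf : AnalyticAt ℝ f x) :
    ∃ F : ℂ → ℂ, AnalyticAt ℂ F x ∧ ∀ᶠ t : ℝ in 𝓝 x, F t = f t := by
  obtain ⟨p, hp⟩ := hf
  set q : FormalMultilinearSeries ℂ ℂ ℂ :=
    FormalMultilinearSeries.ofScalars ℂ (fun n => (p.coeff n : ℂ)) with hq
  have hnorm : ∀ n, ‖q n‖ = ‖p n‖ := by
    intro n
    rw [FormalMultilinearSeries.norm_apply_eq_norm_coef,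
      FormalMultilinearSeries.norm_apply_eq_norm_coef]
    simp [hq, FormalMultilinearSeries.coeff_ofScalars]
  have hrad : 0 < q.radius := by
    obtain ⟨r, hr0, hr⟩ := ENNReal.lt_iff_exists_nnreal_btwn.1 hp.radius_pos
    obtain ⟨C, -, hC⟩ := p.norm_mul_pow_le_of_lt_radius hr
    refine lt_of_lt_of_le hr0 (q.le_radius_of_bound C fun n => ?_)
    rw [hnorm]
    exact hC n
  have hqs := q.hasFPowerSeriesOnBall hrad
  refine ⟨fun z => q.sum (z - x), ?_, ?_⟩
  · have := hqs.comp_sub (x : ℂ)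
    rw [zero_add] at this
    exact this.analyticAt
  · have h1 : ∀ᶠ t : ℝ in 𝓝 x, HasSum (fun n => (t - x) ^ n • p.coeff n) (f t) :=
      hasFPowerSeriesAt_iff'.1 hp
    have h2 : ∀ᶠ t : ℝ in 𝓝 x, ((t : ℂ) - x) ∈ Metric.eball (0 : ℂ) q.radius := by
      have hc : Continuous (fun t : ℝ => (t : ℂ) - x) := by fun_prop
      have : Tendsto (fun t : ℝ => (t : ℂ) - x) (𝓝 x) (𝓝 0) := by simpa using hc.tendsto x
      exact this.eventually (Metric.eball_mem_nhds _ hrad)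
    filter_upwards [h1, h2] with t ht1 ht2
    have h3 := hqs.hasSum ht2
    rw [zero_add] at h3
    have h4 : HasSum (fun n => (((t - x) ^ n • p.coeff n : ℝ) : ℂ)) (f t : ℂ) :=
      Complex.hasSum_ofReal.2 ht1
    have h5 : (fun n => q n fun _ => (t : ℂ) - x) =
        fun n => (((t - x) ^ n • p.coeff n : ℝ) : ℂ) := by
      funext n
      simp [hq, FormalMultilinearSeries.ofScalars, mul_comm]
    rw [h5] at h3
    exact h3.unique h4

/-- The holomorphic extension of `G` lives near the single point `a₀ * sin y₀`, so only a short
interval of integration keeps `a * sin x` in its disc for complex `a` near `a₀`. There one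
differentiates under the integral sign in `a`; on the real axis the real part is the given integral.
-/
theorem exists_analyticAt_integral_comp_mul_sin_local {G : ℝ → ℝ} {a₀ y₀ : ℝ}
    (hG : AnalyticAt ℝ G (a₀ * Real.sin y₀)) :
    ∀ᶠ y in 𝓝 y₀, AnalyticAt ℝ (fun a => ∫ x in y₀..y, G (a * Real.sin x)) a₀ := by
  obtain ⟨F, hF, hFG⟩ := hG.exists_complex_extension
  obtain ⟨ε, hε, hball⟩ := Metric.eventually_nhds_iff_ball.1
    (hF.eventually_analyticAt)
  obtain ⟨ε', hε', hball'⟩ := Metric.eventually_nhds_iff_ball.1 hFG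
  set η := min (ε / 2) ε' with hη
  have hη0 : 0 < η := by positivity
  have hcont : Continuous (fun z : ℂ × ℝ => z.1 * (Real.sin z.2 : ℂ)) := by fun_prop
  have hev := hcont.continuousAt (x := ((a₀ : ℂ), y₀)) |>.eventually_mem
    (s := Metric.ball ((a₀ * Real.sin y₀ : ℝ) : ℂ) η)
    (by simpa using Metric.ball_mem_nhds ((a₀ : ℂ) * Complex.sin y₀) hη0)
  obtain ⟨δ, hδ, hδb⟩ := Metric.eventually_nhds_iff_ball.1 hev
  have hmem : ∀ a ∈ Metric.ball (a₀ : ℂ) δ, ∀ y ∈ Metric.ball y₀ δ,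
      a * (Real.sin y : ℂ) ∈ Metric.ball ((a₀ * Real.sin y₀ : ℝ) : ℂ) η := by
    intro a ha y hy
    refine hδb (a, y) ?_
    rw [← ball_prod_same]
    exact ⟨ha, hy⟩
  have hdF : ContinuousOn (deriv F) (Metric.closedBall ((a₀ * Real.sin y₀ : ℝ) : ℂ) (ε / 2)) := by
    intro z hz
    exact (hball z (Metric.closedBall_subset_ball (by linarith) hz)).deriv.continuousAt.continuousWithinAt
  obtain ⟨C, hC⟩ := (isCompact_closedBall _ _).exists_bound_of_continuousOn hdF
  filter_upwards [Metric.ball_mem_nhds y₀ hδ] with y hy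
  have hsub : uIoc y₀ y ⊆ Metric.ball y₀ δ := by
    intro t ht
    have := (convex_ball y₀ δ).ordConnected.uIcc_subset (Metric.mem_ball_self hδ) hy
    exact this (uIoc_subset_uIcc ht)
  have hsub' : uIcc y₀ y ⊆ Metric.ball y₀ δ :=
    (convex_ball y₀ δ).ordConnected.uIcc_subset (Metric.mem_ball_self hδ) hy
  have hsubε : ∀ z ∈ Metric.ball ((a₀ * Real.sin y₀ : ℝ) : ℂ) η, AnalyticAt ℂ F z := by
    intro z hz
    refine hball z (Metric.ball_subset_ball ?_ hz)
    have := min_le_left (ε / 2) ε'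
    linarith
  have hcF : ∀ a ∈ Metric.ball (a₀ : ℂ) δ,
      ContinuousOn (fun x : ℝ => F (a * (Real.sin x : ℂ))) (uIcc y₀ y) := by
    intro a ha x hx
    refine ContinuousAt.continuousWithinAt ?_
    exact ContinuousAt.comp (g := F) (f := fun x : ℝ => a * (Real.sin x : ℂ))
      (hsubε _ (hmem a ha x (hsub' hx))).continuousAt (by fun_prop)
  have hcF' : ∀ a ∈ Metric.ball (a₀ : ℂ) δ,
      ContinuousOn (fun x : ℝ => deriv F (a * (Real.sin x : ℂ)) * (Real.sin x : ℂ)) (uIcc y₀ y) := by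
    intro a ha x hx
    refine ContinuousAt.continuousWithinAt (ContinuousAt.mul ?_ (by fun_prop))
    exact ContinuousAt.comp (g := deriv F) (f := fun x : ℝ => a * (Real.sin x : ℂ))
      (hsubε _ (hmem a ha x (hsub' hx))).deriv.continuousAt (by fun_prop)
  have hdiff : DifferentiableOn ℂ (fun a : ℂ => ∫ x in y₀..y, F (a * (Real.sin x : ℂ)))
      (Metric.ball (a₀ : ℂ) δ) := by
    intro a ha
    refine DifferentiableAt.differentiableWithinAt ?_
    refine (intervalIntegral.hasDerivAt_integral_of_dominated_loc_of_deriv_le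
      (F' := fun a x => deriv F (a * (Real.sin x : ℂ)) * (Real.sin x : ℂ))
      (bound := fun _ => C) (Metric.isOpen_ball.mem_nhds ha) ?_ ?_ ?_ ?_ ?_ ?_).2.differentiableAt
    · filter_upwards [Metric.isOpen_ball.mem_nhds ha] with b hb
      exact ((hcF b hb).mono uIoc_subset_uIcc).aestronglyMeasurable measurableSet_uIoc
    · exact (hcF a ha).intervalIntegrable
    · exact ((hcF' a ha).mono uIoc_subset_uIcc).aestronglyMeasurable measurableSet_uIoc
    · refine ae_of_all _ fun x hx b hb => ?_
      have h1 := hmem b hb x (hsub hx)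
      have h2 := hC _ (Metric.ball_subset_closedBall
        (Metric.ball_subset_ball (min_le_left (ε / 2) ε') h1))
      have h3 : ‖(Real.sin x : ℂ)‖ ≤ 1 := by
        rw [Complex.norm_real]; exact Real.abs_sin_le_one x
      rw [norm_mul]
      calc _ ≤ C * 1 := mul_le_mul h2 h3 (norm_nonneg _) ((norm_nonneg _).trans h2)
        _ = C := mul_one _
    · simp
    · refine ae_of_all _ fun x hx b hb => ?_
      have h1 := (hsubε _ (hmem b hb x (hsub hx))).differentiableAt.hasDerivAt
      have h2 : HasDerivAt (fun b : ℂ => b * (Real.sin x : ℂ)) (Real.sin x : ℂ) b := by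
        simpa using (hasDerivAt_id b).mul_const (Real.sin x : ℂ)
      exact h1.comp b h2
  have han : AnalyticAt ℂ (fun a : ℂ => ∫ x in y₀..y, F (a * (Real.sin x : ℂ))) (a₀ : ℂ) :=
    hdiff.analyticAt (Metric.ball_mem_nhds _ hδ)
  refine han.re_ofReal.congr ?_
  have hcr : Continuous (fun a : ℝ => (a : ℂ)) := by fun_prop
  filter_upwards [hcr.continuousAt.eventually_mem (Metric.ball_mem_nhds (a₀ : ℂ) hδ)] with a ha
  have : ∀ x ∈ uIcc y₀ y, F ((a : ℂ) * (Real.sin x : ℂ)) = ((G (a * Real.sin x) : ℝ) : ℂ) := by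
    intro x hx
    have h1 := hmem a ha x (hsub' hx)
    rw [← Complex.ofReal_mul] at h1 ⊢
    refine hball' _ ?_
    rw [Metric.mem_ball] at h1 ⊢
    have h2 : dist (a * Real.sin x) (a₀ * Real.sin y₀) < η := by
      simpa only [Complex.dist_eq, ← Complex.ofReal_sub, Complex.norm_real, Real.dist_eq,
        Real.norm_eq_abs] using h1
    exact h2.trans_le (min_le_right _ _)
  rw [intervalIntegral.integral_congr this, intervalIntegral.integral_ofReal, Complex.ofReal_re]

theorem mul_sin_mem_Ioo {a m : ℝ} (ha : a ∈ Ioo (-m) m) (x : ℝ) : a * Real.sin x ∈ Ioo (-m) m := by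
  have h : |a * Real.sin x| < m := by
    rw [abs_mul]
    exact (mul_le_of_le_one_right (abs_nonneg a) (Real.abs_sin_le_one x)).trans_lt
      (abs_lt.2 ha)
  exact abs_lt.1 h

theorem analyticOnNhd_integral_comp_mul_sin {G : ℝ → ℝ} {m : ℝ}
    (hG : AnalyticOnNhd ℝ G (Ioo (-m) m)) (y z : ℝ) :
    AnalyticOnNhd ℝ (fun a => ∫ x in y..z, G (a * Real.sin x)) (Ioo (-m) m) := by
  intro a₀ ha₀
  have hint : ∀ a ∈ Ioo (-m) m, ∀ u v,
      IntervalIntegrable (fun x => G (a * Real.sin x)) volume u v := by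
    intro a ha u v
    refine Continuous.intervalIntegrable ?_ u v
    refine continuous_iff_continuousAt.2 fun x => ?_
    exact ContinuousAt.comp (g := G) (f := fun x => a * Real.sin x)
      (hG _ (mul_sin_mem_Ioo ha x)).continuousAt (by fun_prop)
  have hnb : Ioo (-m) m ∈ 𝓝 a₀ := isOpen_Ioo.mem_nhds ha₀
  -- Analyticity at `a₀` of the integral from `y` to `z` is a relation between `y` and `z` that
  -- holds for nearby points and is transitive and symmetric; connectedness of the line extends it
  -- to all pairs.
  refine isPreconnected_univ.induction₂
    (fun y z => AnalyticAt ℝ (fun a => ∫ x in y..z, G (a * Real.sin x)) a₀) ?_ ?_ ?_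
    (mem_univ y) (mem_univ z)
  · intro x _
    rw [nhdsWithin_univ]
    exact exists_analyticAt_integral_comp_mul_sin_local (hG _ (mul_sin_mem_Ioo ha₀ x))
  · intro u v w _ _ _ h1 h2
    refine (h1.add h2).congr ?_
    filter_upwards [hnb] with a ha
    exact intervalIntegral.integral_add_adjacent_intervals (hint a ha _ _) (hint a ha _ _)
  · intro u v _ _ h
    refine h.neg.congr (Eventually.of_forall fun a => ?_)
    exact (intervalIntegral.integral_symm _ _).symm

theorem Real.analyticAt_sqrt {x : ℝ} (hx : x ≠ 0) : AnalyticAt ℝ Real.sqrt x :=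
  (Real.contDiffAt_sqrt (n := ω) hx).analyticAt

/-! ### The rotation integral, and what its constancy forces on `F` -/

/-- The advance in longitude per unit of angular momentum along one period of a geodesic, as an
integral over the phase of the oscillation in latitude. -/
noncomputable def rotationIntegral (F : ℝ → ℝ) (m a : ℝ) : ℝ :=
  ∫ x in 0..2 * Real.pi, F (a * Real.sin x) / (m ^ 2 - (a * Real.sin x) ^ 2)

theorem sq_sub_sq_pos_of_mem_Ioo {m w : ℝ} (hw : w ∈ Ioo (-m) m) : 0 < m ^ 2 - w ^ 2 := by
  nlinarith [hw.1, hw.2]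

theorem continuous_div_sq_sub_sq {F : ℝ → ℝ} (hF : Continuous F) {m a : ℝ}
    (ha : a ∈ Ioo (-m) m) :
    Continuous fun x => F (a * Real.sin x) / (m ^ 2 - (a * Real.sin x) ^ 2) := by
  refine Continuous.div (by fun_prop) (by fun_prop) fun x => ?_
  exact (sq_sub_sq_pos_of_mem_Ioo (mul_sin_mem_Ioo ha x)).ne'

theorem analyticOnNhd_rotationIntegral {F : ℝ → ℝ} {m : ℝ}
    (hF : AnalyticOnNhd ℝ F (Ioo (-m) m)) :
    AnalyticOnNhd ℝ (rotationIntegral F m) (Ioo (-m) m) := by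
  refine analyticOnNhd_integral_comp_mul_sin (G := fun w => F w / (m ^ 2 - w ^ 2)) ?_ _ _
  intro w hw
  exact (hF w hw).div (by fun_prop) (sq_sub_sq_pos_of_mem_Ioo hw).ne'

/-- This is the rotation on the round sphere, where `F = m`. The natural antiderivative is `arctan
((c/m) tan x)`; by the subtraction formula for the tangent its continuous branch is `x` minus the
arctangent of a function smooth on the whole line, and that correction vanishes at both ends. -/
theorem integral_mul_div_sq_sub_sq {m a c : ℝ} (hm : 0 < m) (hc : 0 < c)
    (hac : a ^ 2 + c ^ 2 = m ^ 2) :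
    ∫ x in 0..2 * Real.pi, c * m / (m ^ 2 - (a * Real.sin x) ^ 2) = 2 * Real.pi := by
  have hden : ∀ x, 0 < m * Real.cos x ^ 2 + c * Real.sin x ^ 2 := by
    intro x
    have h := Real.sin_sq_add_cos_sq x
    rcases (sq_nonneg (Real.sin x)).eq_or_lt with h0 | h0
    · rw [← h0, zero_add] at h
      rw [← h0, h]; simpa using hm
    · have := mul_pos hc h0
      have := mul_nonneg hm.le (sq_nonneg (Real.cos x))
      linarith
  have ham : a ∈ Ioo (-m) m := by
    exact abs_lt.1 (abs_lt_of_sq_lt_sq (by nlinarith) hm.le)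
  have hden' : ∀ x, 0 < m ^ 2 - (a * Real.sin x) ^ 2 := fun x =>
    sq_sub_sq_pos_of_mem_Ioo (mul_sin_mem_Ioo ham x)
  have hderiv : ∀ x, HasDerivAt (fun x => x - Real.arctan
      ((m - c) * (Real.sin x * Real.cos x) / (m * Real.cos x ^ 2 + c * Real.sin x ^ 2)))
      (c * m / (m ^ 2 - (a * Real.sin x) ^ 2)) x := by
    intro x
    have hs := Real.hasDerivAt_sin x
    have hk := Real.hasDerivAt_cos x
    have hN := (hs.mul hk).const_mul (m - c)
    have hD := ((hk.pow 2).const_mul m).add ((hs.pow 2).const_mul c)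
    have h1 := (hasDerivAt_id x).sub ((hN.div hD (hden x).ne').arctan)
    refine h1.congr_deriv ?_
    have e := Real.sin_sq_add_cos_sq x
    set s := Real.sin x
    set k := Real.cos x
    have hd := hden x
    have hd' := hden' x
    have e1 : (m * k ^ 2 + c * s ^ 2) ^ 2 + ((m - c) * (s * k)) ^ 2 = m ^ 2 - (a * s) ^ 2 := by
      linear_combination (m ^ 2 * k ^ 2 + c ^ 2 * s ^ 2 + m ^ 2) * e + s ^ 2 * hac
    have e2 : 1 + ((m - c) * (s * k) / (m * k ^ 2 + c * s ^ 2)) ^ 2 =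
        (m ^ 2 - (a * s) ^ 2) / (m * k ^ 2 + c * s ^ 2) ^ 2 := by
      rw [← e1, div_pow, add_div, div_self (pow_pos hd 2).ne']
    have e3 : m ^ 2 - (a * s) ^ 2 - ((m - c) * (k * k + s * -s) * (m * k ^ 2 + c * s ^ 2) -
        (m - c) * (s * k) * (m * (2 * k * -s) + c * (2 * s * k))) = c * m := by
      linear_combination (-(m - c) * (m * k ^ 2 - c * s ^ 2) - m ^ 2 + m * c) * e - s ^ 2 * hac
    have e4 : 1 - 1 / (1 + ((m - c) * (s * k) / (m * k ^ 2 + c * s ^ 2)) ^ 2) *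
        (((m - c) * (k * k + s * -s) * (m * k ^ 2 + c * s ^ 2) -
        (m - c) * (s * k) * (m * (2 * k * -s) + c * (2 * s * k))) / (m * k ^ 2 + c * s ^ 2) ^ 2) =
        c * m / (m ^ 2 - (a * s) ^ 2) := by
      rw [e2, ← e3]
      generalize (m - c) * (k * k + s * -s) * (m * k ^ 2 + c * s ^ 2) -
        (m - c) * (s * k) * (m * (2 * k * -s) + c * (2 * s * k)) = P
      generalize m ^ 2 - (a * s) ^ 2 = Q at hd'
      generalize m * k ^ 2 + c * s ^ 2 = R at hd
      field_simp
    rw [← e4]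
    simp [s, k]
  have hcont : Continuous fun x => c * m / (m ^ 2 - (a * Real.sin x) ^ 2) :=
    continuous_const.div (by fun_prop) fun x => (hden' x).ne'
  rw [intervalIntegral.integral_eq_sub_of_hasDerivAt (fun x _ => hderiv x)
    (hcont.intervalIntegrable _ _)]
  simp

/-- The part of `[-m, m]` where `|F - m| ≥ ε` is compact and avoids `±m`, so `m² - w²` has a
positive lower bound on it. -/
theorem exists_abs_sub_le_add_mul_sq_sub_sq {F : ℝ → ℝ} (hF : Continuous F) {m : ℝ}
    (hFm : F m = m) (hFm' : F (-m) = m) {ε : ℝ} (hε : 0 < ε) :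
    ∃ K, 0 ≤ K ∧ ∀ w ∈ Icc (-m) m, |F w - m| ≤ ε + K * (m ^ 2 - w ^ 2) := by
  have hS : IsCompact (Icc (-m) m ∩ {w | ε ≤ |F w - m|}) :=
    isCompact_Icc.inter_right (isClosed_le continuous_const (by fun_prop))
  have hpos : ∀ w ∈ Icc (-m) m ∩ {w | ε ≤ |F w - m|}, 0 < m ^ 2 - w ^ 2 := by
    rintro w ⟨hw, hw'⟩
    refine sq_sub_sq_pos_of_mem_Ioo ⟨lt_of_le_of_ne hw.1 ?_, lt_of_le_of_ne hw.2 ?_⟩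
    · rintro rfl
      rw [mem_ofPred_eq, hFm', sub_self, abs_zero] at hw'; linarith
    · rintro rfl
      rw [mem_ofPred_eq, hFm, sub_self, abs_zero] at hw'; linarith
  have hc : ContinuousOn (fun w => |F w - m| / (m ^ 2 - w ^ 2))
      (Icc (-m) m ∩ {w | ε ≤ |F w - m|}) :=
    ContinuousOn.div (by fun_prop) (by fun_prop) fun w hw => (hpos w hw).ne'
  obtain ⟨K, hK⟩ := hS.exists_bound_of_continuousOn hc
  refine ⟨max K 0, le_max_right _ _, fun w hw => ?_⟩
  have h0 : 0 ≤ m ^ 2 - w ^ 2 := by nlinarith [hw.1, hw.2]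
  by_cases h : ε ≤ |F w - m|
  · have h1 := hK w ⟨hw, h⟩
    have h2 := hpos w ⟨hw, h⟩
    rw [Real.norm_eq_abs] at h1
    have h3 := (le_abs_self _).trans h1
    rw [div_le_iff₀ h2] at h3
    have := mul_le_mul_of_nonneg_right (le_max_left K 0) h0
    linarith
  · have := mul_nonneg (le_max_right K 0) h0
    linarith

/-- With `c = √(m² - a²)`, the kernel `c m / (m² - w²)` at `w = a sin x` always has mass `2π`. In
the bound `|F - m| ≤ ε + K (m² - w²)` the first term contributes a multiple of `ε`, while the second
cancels the denominator and contributes `O(c)`, which disappears as `c → 0`. -/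
theorem eq_two_pi_of_forall_rotationIntegral_eq {F : ℝ → ℝ} (hF : Continuous F) {m C : ℝ}
    (hm : 0 < m) (hFm : F m = m) (hFm' : F (-m) = m)
    (hC : ∀ a ∈ Ioo (-m) m, √(m ^ 2 - a ^ 2) * rotationIntegral F m a = C) :
    C = 2 * Real.pi := by
  have key : ∀ ε > 0, ∃ K, 0 ≤ K ∧ ∀ c ∈ Ioo 0 m,
      |C - 2 * Real.pi| ≤ ε * (2 * Real.pi / m) + 2 * Real.pi * c * K := by
    intro ε hε
    obtain ⟨K, hK0, hK⟩ := exists_abs_sub_le_add_mul_sq_sub_sq hF hFm hFm' hε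
    refine ⟨K, hK0, fun c hc => ?_⟩
    set a := √(m ^ 2 - c ^ 2) with ha
    have hac : a ^ 2 + c ^ 2 = m ^ 2 := by
      rw [ha, Real.sq_sqrt (by nlinarith [hc.1, hc.2])]; ring
    have ham : a ∈ Ioo (-m) m := by
      exact abs_lt.1 (abs_lt_of_sq_lt_sq (by nlinarith [hc.1]) hm.le)
    have hca : √(m ^ 2 - a ^ 2) = c := by
      rw [← hac, add_sub_cancel_left, Real.sqrt_sq hc.1.le]
    have h1 := hC a ham
    rw [hca, rotationIntegral] at h1
    have hker := integral_mul_div_sq_sub_sq hm hc.1 hac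
    have hcont1 := continuous_div_sq_sub_sq hF ham
    have hcont2 : Continuous fun x => c * m / (m ^ 2 - (a * Real.sin x) ^ 2) :=
      continuous_div_sq_sub_sq (F := fun _ => c * m) continuous_const ham
    have h2 : C - 2 * Real.pi = ∫ x in 0..2 * Real.pi,
        (c * (F (a * Real.sin x) / (m ^ 2 - (a * Real.sin x) ^ 2)) -
          c * m / (m ^ 2 - (a * Real.sin x) ^ 2)) := by
      rw [intervalIntegral.integral_sub ((hcont1.intervalIntegrable _ _).const_mul c)
        (hcont2.intervalIntegrable _ _), hker, intervalIntegral.integral_const_mul, h1]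
    have h3 : ∫ x in 0..2 * Real.pi, (ε / m * (c * m / (m ^ 2 - (a * Real.sin x) ^ 2)) + c * K) =
        ε * (2 * Real.pi / m) + 2 * Real.pi * c * K := by
      rw [intervalIntegral.integral_add ((hcont2.intervalIntegrable _ _).const_mul (ε / m))
        (continuous_const.intervalIntegrable _ _), intervalIntegral.integral_const_mul, hker]
      simp only [intervalIntegral.integral_const, smul_eq_mul]
      ring
    rw [h2, ← h3, ← Real.norm_eq_abs]
    refine intervalIntegral.norm_integral_le_of_norm_le (by positivity) ?_
      (((continuous_const.mul hcont2).add continuous_const).intervalIntegrable _ _)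
    refine ae_of_all _ fun x _ => ?_
    have hx := mul_sin_mem_Ioo ham x
    have hd := sq_sub_sq_pos_of_mem_Ioo hx
    have h4 := hK _ (Ioo_subset_Icc_self hx)
    set d := m ^ 2 - (a * Real.sin x) ^ 2
    have hc0 := hc.1
    have h5 : c * (F (a * Real.sin x) / d) - c * m / d = c / d * (F (a * Real.sin x) - m) := by
      ring
    rw [h5, Real.norm_eq_abs, abs_mul, abs_of_pos (div_pos hc0 hd)]
    calc c / d * |F (a * Real.sin x) - m| ≤ c / d * (ε + K * d) :=
          mul_le_mul_of_nonneg_left h4 (div_pos hc0 hd).le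
      _ = ε / m * (c * m / d) + c * K := by field_simp
  by_contra hne
  have hΔ : 0 < |C - 2 * Real.pi| := abs_pos.2 (sub_ne_zero.2 hne)
  set Δ := |C - 2 * Real.pi|
  have hpi := Real.pi_pos
  -- The choices of `ε` here and of `c` next make each of the two error terms at most `Δ / 4`.
  obtain ⟨K, hK0, hK⟩ := key (Δ * m / (8 * Real.pi)) (by positivity)
  have h1 := hK (min (m / 2) (Δ / (8 * Real.pi * (K + 1))))
    ⟨by positivity, (min_le_left _ _).trans_lt (by linarith)⟩
  have h2 : Δ * m / (8 * Real.pi) * (2 * Real.pi / m) = Δ / 4 := by field_simp; norm_num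
  have h3 : 2 * Real.pi * (min (m / 2) (Δ / (8 * Real.pi * (K + 1)))) * K ≤ Δ / 4 := by
    calc _ ≤ 2 * Real.pi * (Δ / (8 * Real.pi * (K + 1))) * K := by
          gcongr; exact min_le_right _ _
      _ = Δ / 4 * (K / (K + 1)) := by field_simp; ring
      _ ≤ Δ / 4 * 1 := by
          gcongr
          rw [div_le_one (by linarith)]; linarith
      _ = Δ / 4 := mul_one _
  linarith

/-- An even function of `a sin x` whose integrals over `[0, π]` all vanish is zero. -/
theorem eqOn_zero_of_integral_comp_mul_sin_eq_zero {E : ℝ → ℝ} {m : ℝ} (hm : 0 < m)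
    (hE : AnalyticOnNhd ℝ E (Ioo (-m) m))
    (hint : ∀ a ∈ Ioo (-m) m, ∫ x in 0..Real.pi, E (a * Real.sin x) = 0) :
    EqOn E 0 (Ioo (-m) m) := by
  have h0 : (0 : ℝ) ∈ Ioo (-m) m := ⟨by linarith, hm⟩
  rcases (hE 0 h0).eventually_eq_zero_or_eventually_ne_zero with h | h
  · exact hE.eqOn_zero_of_preconnected_of_eventuallyEq_zero isPreconnected_Ioo h0 h
  exfalso
  rw [eventually_nhdsWithin_iff] at h
  -- If `0` is at worst an isolated zero of `E`, then for small `a > 0` the points `a * sin x` with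
  -- `0 < x < π` avoid the zeros. The integrand has constant sign there and its integral cannot
  -- vanish.
  obtain ⟨ε, hε, hball⟩ := Metric.eventually_nhds_iff_ball.1 h
  set a := min ε m / 2 with ha
  have ha0 : 0 < a := by positivity
  have haε : a < ε := by have := min_le_left ε m; rw [ha]; linarith
  have ham : a ∈ Ioo (-m) m := ⟨by linarith, by have := min_le_right ε m; rw [ha]; linarith⟩
  have hcont : Continuous fun x => E (a * Real.sin x) := by
    refine continuous_iff_continuousAt.2 fun x => ?_
    exact ContinuousAt.comp (g := E) (f := fun x => a * Real.sin x)
      (hE _ (mul_sin_mem_Ioo ham x)).continuousAt (by fun_prop)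
  have hne : ∀ x ∈ Ioo 0 Real.pi, E (a * Real.sin x) ≠ 0 := by
    intro x hx
    have hs := Real.sin_pos_of_mem_Ioo hx
    have hpos : 0 < a * Real.sin x := by positivity
    refine hball _ ?_ hpos.ne'
    rw [Metric.mem_ball, dist_zero_right, Real.norm_eq_abs, abs_of_pos hpos]
    nlinarith [Real.sin_le_one x]
  have hsign : (∀ x ∈ Ioo 0 Real.pi, 0 < E (a * Real.sin x)) ∨
      (∀ x ∈ Ioo 0 Real.pi, 0 < -E (a * Real.sin x)) := by
    by_contra! hcon
    obtain ⟨⟨x, hx, hx'⟩, y, hy, hy'⟩ := hcon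
    obtain ⟨z, hz, hz'⟩ := isPreconnected_Ioo.intermediate_value hx hy hcont.continuousOn
      ⟨hx', show (0 : ℝ) ≤ _ by linarith⟩
    exact hne z hz hz'
  rcases hsign with h | h
  · exact (intervalIntegral.intervalIntegral_pos_of_pos_on (hcont.intervalIntegrable _ _) h
      Real.pi_pos).ne' (hint a ham)
  · have := intervalIntegral.intervalIntegral_pos_of_pos_on (hcont.neg.intervalIntegrable _ _) h
      Real.pi_pos
    have h2 := intervalIntegral.integral_neg (f := fun x => E (a * Real.sin x)) (μ := volume)
      (a := 0) (b := Real.pi)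
    rw [hint a ham, neg_zero] at h2
    exact this.ne' h2

theorem integral_comp_mul_sin_eq_half {G : ℝ → ℝ} {a : ℝ}
    (hG : Continuous fun x => G (a * Real.sin x)) :
    ∫ x in 0..2 * Real.pi, G (a * Real.sin x) =
      ∫ x in 0..Real.pi, (G (a * Real.sin x) + G (-(a * Real.sin x))) := by
  have hG' : Continuous fun x => G (-(a * Real.sin x)) := by
    have : (fun x => G (-(a * Real.sin x))) = (fun x => G (a * Real.sin x)) ∘ fun x => x + Real.pi := by
      funext x; simp [Real.sin_add_pi]
    rw [this]; exact hG.comp (by fun_prop)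
  rw [intervalIntegral.integral_add (hG.intervalIntegrable _ _) (hG'.intervalIntegrable _ _),
    ← intervalIntegral.integral_add_adjacent_intervals (b := Real.pi) (hG.intervalIntegrable _ _)
      (hG.intervalIntegrable _ _)]
  congr 1
  have := intervalIntegral.integral_comp_add_right (a := 0) (b := Real.pi)
    (fun x => G (a * Real.sin x)) Real.pi
  rw [zero_add, ← two_mul] at this
  rw [← this]
  simp [Real.sin_add_pi]

/-- Once the constant is known to be `2π`, subtracting the kernel of mass `2π` says that `D = (F -
m)/(m² - w²)` has zero integral along `a sin x`. Over a full period only the even part of `D`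
contributes, so that part is zero. Nothing is learnt about the odd part, in keeping with the
existence of Zoll surfaces that are not round. -/
theorem add_comp_neg_eq_of_forall_rotationIntegral_eq {F : ℝ → ℝ} (hF : Continuous F) {m C : ℝ}
    (hm : 0 < m) (hFan : AnalyticOnNhd ℝ F (Ioo (-m) m)) (hFm : F m = m) (hFm' : F (-m) = m)
    (hC : ∀ a ∈ Ioo (-m) m, √(m ^ 2 - a ^ 2) * rotationIntegral F m a = C) :
    ∀ w ∈ Icc (-m) m, F w + F (-w) = 2 * m := by
  obtain rfl := eq_two_pi_of_forall_rotationIntegral_eq hF hm hFm hFm' hC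
  set D : ℝ → ℝ := fun w => (F w - m) / (m ^ 2 - w ^ 2) with hD
  have hDan : AnalyticOnNhd ℝ D (Ioo (-m) m) := fun w hw =>
    ((hFan w hw).sub analyticAt_const).div (by fun_prop) (sq_sub_sq_pos_of_mem_Ioo hw).ne'
  have hEan : AnalyticOnNhd ℝ (fun w => D w + D (-w)) (Ioo (-m) m) := by
    intro w hw
    refine (hDan w hw).add ((hDan (-w) ⟨by linarith [hw.2], by linarith [hw.1]⟩).comp ?_)
    fun_prop
  have hz := eqOn_zero_of_integral_comp_mul_sin_eq_zero hm hEan ?_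
  · have hIoo : ∀ w ∈ Ioo (-m) m, F w + F (-w) = 2 * m := by
      intro w hw
      have h1 := hz hw
      have h2 := sq_sub_sq_pos_of_mem_Ioo hw
      simp only [hD, Pi.zero_apply, neg_sq] at h1
      field_simp at h1
      linarith
    intro w hw
    rcases eq_or_lt_of_le hw.1 with rfl | h1
    · rw [neg_neg, hFm, hFm']; ring
    rcases eq_or_lt_of_le hw.2 with rfl | h2
    · rw [hFm, hFm']; ring
    exact hIoo w ⟨h1, h2⟩
  · intro a ha
    have hcontD : Continuous fun x => D (a * Real.sin x) :=
      continuous_div_sq_sub_sq (F := fun w => F w - m) (by fun_prop) ha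
    rw [← integral_comp_mul_sin_eq_half hcontD]
    have hpos := sq_sub_sq_pos_of_mem_Ioo ha
    set c := √(m ^ 2 - a ^ 2) with hc
    have hc0 : 0 < c := Real.sqrt_pos.2 hpos
    have hac : a ^ 2 + c ^ 2 = m ^ 2 := by rw [hc, Real.sq_sqrt hpos.le]; ring
    have h1 := hC a ha
    have h2 := integral_mul_div_sq_sub_sq hm hc0 hac
    have h3 : c * ∫ x in 0..2 * Real.pi, D (a * Real.sin x) = 0 := by
      rw [rotationIntegral, ← intervalIntegral.integral_const_mul] at h1
      rw [← intervalIntegral.integral_const_mul]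
      have h4 : ∀ x, c * D (a * Real.sin x) =
          c * (F (a * Real.sin x) / (m ^ 2 - (a * Real.sin x) ^ 2)) -
          c * m / (m ^ 2 - (a * Real.sin x) ^ 2) := by
        intro x; simp only [hD]; ring
      simp only [h4]
      rw [intervalIntegral.integral_sub
        (((continuous_div_sq_sub_sq hF ha).intervalIntegrable _ _).const_mul c)
        ((continuous_div_sq_sub_sq (F := fun _ => c * m) continuous_const ha).intervalIntegrable _ _),
        h2, h1, sub_self]
    exact (mul_eq_zero.1 h3).resolve_left hc0.ne'

/-- The integral is the period of the oscillation in latitude; the symmetry makes it independent of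
the amplitude. -/
theorem integral_comp_mul_sin_of_add_comp_neg_eq {F : ℝ → ℝ} (hF : Continuous F) {m : ℝ}
    (h : ∀ w ∈ Icc (-m) m, F w + F (-w) = 2 * m) {a : ℝ} (ha : |a| ≤ m) :
    ∫ x in 0..2 * Real.pi, F (a * Real.sin x) = 2 * Real.pi * m := by
  rw [integral_comp_mul_sin_eq_half (by fun_prop)]
  have : ∀ x, F (a * Real.sin x) + F (-(a * Real.sin x)) = 2 * m := by
    intro x
    refine h _ (abs_le.1 ?_)
    rw [abs_mul]
    exact (mul_le_of_le_one_right (abs_nonneg a) (Real.abs_sin_le_one x)).trans ha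
  simp only [this, intervalIntegral.integral_const, smul_eq_mul]
  ring

/-! ### Rational values and level sets of nonconstant analytic functions -/

/-- If `B (m cos θ)` avoided `2πℚ` near some `θ₁`, the intermediate value theorem would make it
constant there, and the identity theorem would make `B` constant. -/
theorem exists_rat_two_pi_mul_eq_of_not_const {B : ℝ → ℝ} {m : ℝ} (hm : 0 < m)
    (hB : AnalyticOnNhd ℝ B (Ioo (-m) m)) (hne : ¬ ∃ C, ∀ a ∈ Ioo (-m) m, B a = C)
    {J : Set ℝ} (hJ : IsOpen J) (hJne : J.Nonempty) :
    ∃ θ ∈ J, Real.cos θ ≠ 0 ∧ Real.sin θ ≠ 0 ∧ ∃ q : ℚ, B (m * Real.cos θ) = 2 * Real.pi * q := by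
  -- Away from the multiples of `π / 2` both `sin` and `cos` are nonzero. The condition on `sin`
  -- also makes `θ ↦ m cos θ` have nonzero derivative, which lets coincidences accumulate at `m cos
  -- θ₁`.
  have hcount : (range fun k : ℤ => (k : ℝ) * Real.pi / 2).Countable := countable_range _
  obtain ⟨θ₁, hθ₁J, hθ₁⟩ := (hcount.dense_compl ℝ).inter_open_nonempty J hJ hJne
  have hθ₁' : Real.sin (2 * θ₁) ≠ 0 := by
    intro h
    obtain ⟨n, hn⟩ := Real.sin_eq_zero_iff.1 h
    exact hθ₁ ⟨n, by simp only; linarith⟩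
  obtain ⟨δ, hδ, hball⟩ := Metric.isOpen_iff.1
    (hJ.inter (isOpen_ne_fun (f := fun θ => Real.sin (2 * θ)) (by fun_prop) continuous_const))
    θ₁ ⟨hθ₁J, hθ₁'⟩
  have hsc : ∀ θ ∈ Metric.ball θ₁ δ, Real.sin θ ≠ 0 ∧ Real.cos θ ≠ 0 := by
    intro θ hθ
    have h : Real.sin (2 * θ) ≠ 0 := (hball hθ).2
    rw [Real.sin_two_mul] at h
    constructor
    · intro h0; simp [h0] at h
    · intro h0; simp [h0] at h
  have hmem : ∀ θ ∈ Metric.ball θ₁ δ, m * Real.cos θ ∈ Ioo (-m) m := by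
    intro θ hθ
    have h1 : |Real.cos θ| < 1 := by
      refine lt_of_le_of_ne (Real.abs_cos_le_one θ) fun h => (hsc θ hθ).1 ?_
      have h2 := Real.sin_sq_add_cos_sq θ
      rw [← sq_abs (Real.cos θ), h] at h2
      exact pow_eq_zero_iff two_ne_zero |>.1 (by linarith)
    refine abs_lt.1 ?_
    rw [abs_mul, abs_of_pos hm]
    nlinarith
  by_contra! hcon
  have hcont : ContinuousOn (fun θ => B (m * Real.cos θ)) (Metric.ball θ₁ δ) := fun θ hθ =>
    (ContinuousAt.comp (g := B) (f := fun θ => m * Real.cos θ)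
      (hB _ (hmem θ hθ)).continuousAt (by fun_prop)).continuousWithinAt
  have hle : ∀ x ∈ Metric.ball θ₁ δ, ∀ y ∈ Metric.ball θ₁ δ,
      B (m * Real.cos x) ≤ B (m * Real.cos y) := by
    intro x hx y hy
    by_contra! hlt
    have hpi : 0 < 2 * Real.pi := Real.two_pi_pos
    obtain ⟨q, hq1, hq2⟩ := exists_rat_btwn (div_lt_div_of_pos_right hlt hpi)
    rw [div_lt_iff₀ hpi] at hq1
    rw [lt_div_iff₀ hpi] at hq2
    obtain ⟨z, hz, hz'⟩ := (convex_ball θ₁ δ).isPreconnected.intermediate_value hy hx hcont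
      (show 2 * Real.pi * q ∈ _ from ⟨by linarith, by linarith⟩)
    exact hcon z (hball hz).1 (hsc z hz).2 (hsc z hz).1 q hz'
  have h1 := Metric.mem_ball_self (x := θ₁) hδ
  refine hne ⟨B (m * Real.cos θ₁), fun a ha => ?_⟩
  refine hB.eqOn_of_preconnected_of_frequently_eq (g := fun _ => B (m * Real.cos θ₁))
    (fun _ _ => analyticAt_const) isPreconnected_Ioo (hmem θ₁ h1) ?_ ha
  have htend : Tendsto (fun θ => m * Real.cos θ) (𝓝[≠] θ₁) (𝓝[≠] (m * Real.cos θ₁)) := by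
    refine HasDerivAt.tendsto_nhdsNE ((Real.hasDerivAt_cos θ₁).const_mul m) ?_
    simpa using ⟨hm.ne', (hsc θ₁ h1).1⟩
  refine htend.frequently (Eventually.frequently ?_)
  filter_upwards [nhdsWithin_le_nhds (Metric.ball_mem_nhds θ₁ hδ)] with θ hθ
  exact le_antisymm (hle _ hθ _ h1) (hle _ h1 _ hθ)

/-- Level sets are discrete by the principle of isolated zeros, and a discrete subset of the line is
countable by second countability. -/
theorem AnalyticOnNhd.countable_setOf_eq {B : ℝ → ℝ} {s : Set ℝ} (hs : IsPreconnected s)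
    (hB : AnalyticOnNhd ℝ B s) (hne : ¬ ∃ C, ∀ a ∈ s, B a = C) (C : ℝ) :
    {a ∈ s | B a = C}.Countable := by
  have hdisc : DiscreteTopology {a ∈ s | B a = C} := by
    rw [discreteTopology_subtype_iff]
    intro x hx
    rcases ((hB x hx.1).sub (analyticAt_const (v := C))).eventually_eq_zero_or_eventually_ne_zero
      with h | h
    · refine absurd ⟨C, fun a ha => ?_⟩ hne
      exact hB.eqOn_of_preconnected_of_eventuallyEq (fun _ _ => analyticAt_const) hs hx.1
        (h.mono fun y hy => sub_eq_zero.1 hy) ha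
    · rw [← disjoint_iff, Filter.disjoint_principal_right]
      filter_upwards [h] with y hy hy'
      exact hy (sub_eq_zero.2 hy'.2)
  exact countable_coe_iff.1 (TopologicalSpace.separableSpace_iff_countable.1 inferInstance)

theorem countable_setOf_exists_rat_two_pi_mul_eq {B : ℝ → ℝ} {s : Set ℝ} (hs : IsPreconnected s)
    (hB : AnalyticOnNhd ℝ B s) (hne : ¬ ∃ C, ∀ a ∈ s, B a = C) :
    {a ∈ s | ∃ q : ℚ, B a = 2 * Real.pi * q}.Countable := by
  have : {a ∈ s | ∃ q : ℚ, B a = 2 * Real.pi * q} =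
      ⋃ q : ℚ, {a ∈ s | B a = 2 * Real.pi * q} := by
    ext a; simp
  rw [this]
  exact countable_iUnion fun q => hB.countable_setOf_eq hs hne _

theorem AnalyticAt.dslope {f : ℝ → ℝ} {a x : ℝ} (hx : AnalyticAt ℝ f x) (ha : AnalyticAt ℝ f a) :
    AnalyticAt ℝ (dslope f a) x := by
  rcases eq_or_ne x a with rfl | h
  · obtain ⟨p, hp⟩ := hx
    exact hp.has_fpower_series_dslope_fslope.analyticAt
  · refine AnalyticAt.congr ?_ (dslope_eventuallyEq_slope_of_ne f h).symm
    have : slope f a = fun b => (b - a)⁻¹ * (f b - f a) := by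
      funext b; rw [slope_def_module, smul_eq_mul]
    rw [this]
    exact ((analyticAt_id.sub analyticAt_const).inv (sub_ne_zero.2 h)).mul
      (hx.sub analyticAt_const)

/-! ### The profile curve and its analytic latitude -/

namespace SurfaceOfRevolution

variable (M : SurfaceOfRevolution)

theorem hasDerivAt_f (t : ℝ) : HasDerivAt M.f (deriv M.f t) t :=
  (M.f_smooth.differentiable (by simp) t).hasDerivAt

theorem hasDerivAt_g (t : ℝ) : HasDerivAt M.g (deriv M.g t) t :=
  (M.g_smooth.differentiable (by simp) t).hasDerivAt

theorem contDiff_deriv_f : ContDiff ℝ ∞ (deriv M.f) :=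
  (contDiff_infty_iff_deriv.1 M.f_smooth).2

theorem contDiff_deriv_g : ContDiff ℝ ∞ (deriv M.g) :=
  (contDiff_infty_iff_deriv.1 M.g_smooth).2

theorem hasDerivAt_deriv_f (t : ℝ) : HasDerivAt (deriv M.f) (deriv (deriv M.f) t) t :=
  (M.contDiff_deriv_f.differentiable (by simp) t).hasDerivAt

theorem hasDerivAt_deriv_g (t : ℝ) : HasDerivAt (deriv M.g) (deriv (deriv M.g) t) t :=
  (M.contDiff_deriv_g.differentiable (by simp) t).hasDerivAt

theorem tmin_mem : M.tmin ∈ Icc M.tmin M.tmax := left_mem_Icc.2 M.tmin_lt_tmax.le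

theorem tmax_mem : M.tmax ∈ Icc M.tmin M.tmax := right_mem_Icc.2 M.tmin_lt_tmax.le

theorem t₀_mem_Ioo : M.t₀ ∈ Ioo M.tmin M.tmax := by
  refine ⟨lt_of_le_of_ne M.t₀_mem.1 ?_, lt_of_le_of_ne M.t₀_mem.2 ?_⟩
  · intro h
    have := M.deriv_f_tmin
    rw [h, M.deriv_f_t₀] at this
    norm_num at this
  · intro h
    have := M.deriv_f_tmax
    rw [← h, M.deriv_f_t₀] at this
    norm_num at this

/-- The radius of the equator. -/
noncomputable def radius : ℝ := M.f M.t₀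

theorem radius_pos : 0 < M.radius := M.f_pos _ M.t₀_mem_Ioo

theorem f_nonneg {t : ℝ} (ht : t ∈ Icc M.tmin M.tmax) : 0 ≤ M.f t := by
  rcases eq_or_lt_of_le ht.1 with h | h
  · rw [← h, M.f_tmin]
  rcases eq_or_lt_of_le ht.2 with h' | h'
  · rw [h', M.f_tmax]
  exact (M.f_pos t ⟨h, h'⟩).le

theorem deriv_f_pos {t : ℝ} (ht : t ∈ Ico M.tmin M.t₀) : 0 < deriv M.f t := by
  by_contra! h
  obtain ⟨s, hs, hs'⟩ := intermediate_value_Icc' ht.1 M.contDiff_deriv_f.continuous.continuousOn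
    (show (0 : ℝ) ∈ _ from ⟨h, by rw [M.deriv_f_tmin]; norm_num⟩)
  have := M.eq_t₀ s ⟨hs.1, hs.2.trans (ht.2.le.trans M.t₀_mem.2)⟩ hs'
  linarith [hs.2, ht.2]

theorem deriv_f_neg {t : ℝ} (ht : t ∈ Ioc M.t₀ M.tmax) : deriv M.f t < 0 := by
  by_contra! h
  obtain ⟨s, hs, hs'⟩ := intermediate_value_Icc' ht.2 M.contDiff_deriv_f.continuous.continuousOn
    (show (0 : ℝ) ∈ _ from ⟨by rw [M.deriv_f_tmax]; norm_num, h⟩)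
  have := M.eq_t₀ s ⟨M.t₀_mem.1.trans (ht.1.le.trans hs.1), hs.2⟩ hs'
  linarith [hs.1, ht.1]

theorem f_lt_radius {t : ℝ} (ht : t ∈ Icc M.tmin M.tmax) (hne : t ≠ M.t₀) : M.f t < M.radius := by
  have hc := M.f_smooth.continuous
  rcases hne.lt_or_gt with h | h
  · have hmono : StrictMonoOn M.f (Icc M.tmin M.t₀) := by
      refine strictMonoOn_of_deriv_pos (convex_Icc _ _) hc.continuousOn fun x hx => ?_
      rw [interior_Icc] at hx
      exact M.deriv_f_pos ⟨hx.1.le, hx.2⟩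
    exact hmono ⟨ht.1, h.le⟩ ⟨M.t₀_mem.1, le_rfl⟩ h
  · have hanti : StrictAntiOn M.f (Icc M.t₀ M.tmax) := by
      refine strictAntiOn_of_deriv_neg (convex_Icc _ _) hc.continuousOn fun x hx => ?_
      rw [interior_Icc] at hx
      exact M.deriv_f_neg ⟨hx.1, hx.2.le⟩
    exact hanti ⟨le_rfl, M.t₀_mem.2⟩ ⟨h.le, ht.2⟩ h

theorem deriv_deriv_f_t₀_neg : deriv (deriv M.f) M.t₀ < 0 := by
  have h1 := M.deriv2_f_t₀
  rw [iteratedDeriv_succ, iteratedDeriv_one] at h1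
  refine lt_of_le_of_ne ?_ h1
  have h2 := hasDerivAt_iff_tendsto_slope.1 (M.hasDerivAt_deriv_f M.t₀)
  refine le_of_tendsto h2 ?_
  filter_upwards [self_mem_nhdsWithin, nhdsWithin_le_nhds (isOpen_Ioo.mem_nhds M.t₀_mem_Ioo)]
    with t hne ht
  rw [slope_def_field, M.deriv_f_t₀, sub_zero]
  rcases (show t ≠ M.t₀ from hne).lt_or_gt with h | h
  · exact (div_neg_of_pos_of_neg (M.deriv_f_pos ⟨ht.1.le, h⟩) (by linarith)).le
  · exact (div_neg_of_neg_of_pos (M.deriv_f_neg ⟨h, ht.2.le⟩) (by linarith)).le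

/-- An analytic latitude coordinate `u` with `u² + f² = m²`, increasing along the profile, and the
angular speed `k` of the phase: `f' = - u k` and `u' = f k`. -/
theorem exists_latitude (hf : AnalyticOnNhd ℝ M.f (Icc M.tmin M.tmax)) :
    ∃ u k : ℝ → ℝ, AnalyticOnNhd ℝ u (Icc M.tmin M.tmax) ∧ AnalyticOnNhd ℝ k (Icc M.tmin M.tmax) ∧
      (∀ t ∈ Icc M.tmin M.tmax, u t ^ 2 + M.f t ^ 2 = M.radius ^ 2) ∧
      (∀ t ∈ Icc M.tmin M.tmax, deriv M.f t = -(u t * k t)) ∧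
      (∀ t ∈ Icc M.tmin M.tmax, HasDerivAt u (M.f t * k t) t) ∧
      (∀ t ∈ Icc M.tmin M.tmax, 0 < k t) ∧
      u M.tmin = -M.radius ∧ u M.tmax = M.radius ∧ u M.t₀ = 0 := by
  set m := M.radius with hm
  -- `m² - f²` has a double zero at `t₀` and `f'` a simple one. Dividing them out leaves analytic
  -- factors `N₂ > 0` and `e < 0`, so `u = (t - t₀) √N₂` is an analytic signed root and `k = -e /
  -- √N₂` is positive.
  set N : ℝ → ℝ := fun t => m ^ 2 - M.f t ^ 2 with hN
  set N₂ : ℝ → ℝ := dslope (dslope N M.t₀) M.t₀ with hN₂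
  set e : ℝ → ℝ := dslope (deriv M.f) M.t₀ with he
  have hNan : AnalyticOnNhd ℝ N (Icc M.tmin M.tmax) := fun t ht =>
    analyticAt_const.sub ((hf t ht).pow 2)
  have hN₂an : AnalyticOnNhd ℝ N₂ (Icc M.tmin M.tmax) := fun t ht =>
    ((hNan t ht).dslope (hNan _ M.t₀_mem)).dslope ((hNan _ M.t₀_mem).dslope (hNan _ M.t₀_mem))
  have hean : AnalyticOnNhd ℝ e (Icc M.tmin M.tmax) := fun t ht =>
    (hf t ht).deriv.dslope (hf _ M.t₀_mem).deriv
  have hNd : ∀ t, HasDerivAt N (-(2 * M.f t * deriv M.f t)) t := by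
    intro t
    have := ((M.hasDerivAt_f t).pow 2).const_sub (m ^ 2)
    refine this.congr_deriv ?_
    push_cast; ring
  have hNt₀ : N M.t₀ = 0 := by simp [hN, hm, radius]
  have hN1 : ∀ t, N t = (t - M.t₀) ^ 2 * N₂ t := by
    intro t
    have h1 := sub_smul_dslope N M.t₀ t
    have h2 := sub_smul_dslope (dslope N M.t₀) M.t₀ t
    rw [dslope_same, (hNd M.t₀).deriv, M.deriv_f_t₀, smul_eq_mul] at h2
    rw [hNt₀, smul_eq_mul] at h1
    rw [sq, mul_assoc, h2, mul_zero, neg_zero, sub_zero, h1, sub_zero]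
  have hfe : ∀ t, deriv M.f t = (t - M.t₀) * e t := by
    intro t
    have h1 := sub_smul_dslope (deriv M.f) M.t₀ t
    rw [M.deriv_f_t₀, sub_zero, smul_eq_mul] at h1
    exact h1.symm
  have heneg : ∀ t ∈ Icc M.tmin M.tmax, e t < 0 := by
    intro t ht
    rcases lt_trichotomy t M.t₀ with h | h | h
    · have := M.deriv_f_pos ⟨ht.1, h⟩
      rw [hfe t] at this
      exact neg_of_mul_pos_right this (by linarith)
    · rw [h, he, dslope_same]
      exact M.deriv_deriv_f_t₀_neg
    · have := M.deriv_f_neg ⟨h, ht.2⟩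
      rw [hfe t] at this
      exact neg_of_mul_neg_right this (by linarith)
  -- Derivative of `N = (t - t₀)² N₂` divided by `t - t₀`; the value at `t₀` follows by continuity.
  -- The identity gives both `N₂ t₀ > 0`, through the nondegeneracy of the critical point, and `u' =
  -- f k`.
  have hident' : ∀ t ∈ Icc M.tmin M.tmax, t ≠ M.t₀ →
      -(2 * M.f t * e t) = 2 * N₂ t + (t - M.t₀) * deriv N₂ t := by
    intro t ht hne
    have h1 := (hN₂an t ht).differentiableAt.hasDerivAt
    have h2 := (((hasDerivAt_id t).sub_const M.t₀).pow 2).mul h1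
    have h3 : N = (fun t => (t - M.t₀) ^ 2 * N₂ t) := funext hN1
    have h4 := hNd t
    rw [h3] at h4
    have h5 := h4.unique h2
    rw [hfe t] at h5
    have h6 : t - M.t₀ ≠ 0 := sub_ne_zero.2 hne
    simp at h5
    have h7 : (t - M.t₀) * (-(2 * M.f t * e t)) =
        (t - M.t₀) * (2 * N₂ t + (t - M.t₀) * deriv N₂ t) := by linear_combination h5
    exact mul_left_cancel₀ h6 h7
  have hident : ∀ t ∈ Icc M.tmin M.tmax,
      -(2 * M.f t * e t) = 2 * N₂ t + (t - M.t₀) * deriv N₂ t := by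
    intro t ht
    rcases ne_or_eq t M.t₀ with h | rfl
    · exact hident' t ht h
    have hc1 : ContinuousAt (fun t => -(2 * M.f t * e t)) M.t₀ := by
      have := (hean _ M.t₀_mem).continuousAt
      have := M.f_smooth.continuous
      fun_prop
    have hc2 : ContinuousAt (fun t => 2 * N₂ t + (t - M.t₀) * deriv N₂ t) M.t₀ := by
      have := (hN₂an _ M.t₀_mem).continuousAt
      have := (hN₂an _ M.t₀_mem).deriv.continuousAt
      fun_prop
    refine tendsto_nhds_unique_of_eventuallyEq
      (hc1.tendsto.mono_left (nhdsWithin_le_nhds (s := {M.t₀}ᶜ)))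
      (hc2.tendsto.mono_left nhdsWithin_le_nhds) ?_
    filter_upwards [self_mem_nhdsWithin, nhdsWithin_le_nhds (isOpen_Ioo.mem_nhds M.t₀_mem_Ioo)]
      with t hne ht
    exact hident' t (Ioo_subset_Icc_self ht) hne
  have hN₂pos : ∀ t ∈ Icc M.tmin M.tmax, 0 < N₂ t := by
    intro t ht
    rcases ne_or_eq t M.t₀ with h | rfl
    · have h1 := M.f_lt_radius ht h
      have h2 := M.f_nonneg ht
      have h3 : 0 < N t := by
        have : M.f t ^ 2 < m ^ 2 := pow_lt_pow_left₀ h1 h2 two_ne_zero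
        simp only [hN]; linarith
      rw [hN1 t] at h3
      exact pos_of_mul_pos_right h3 (sq_nonneg _)
    · have h1 := hident _ ht
      have h2 := mul_neg_of_pos_of_neg M.radius_pos (heneg _ ht)
      rw [radius] at h2
      linarith
  have hsq : ∀ t ∈ Icc M.tmin M.tmax, 0 < √(N₂ t) := fun t ht => Real.sqrt_pos.2 (hN₂pos t ht)
  have hsqan : AnalyticOnNhd ℝ (fun t => √(N₂ t)) (Icc M.tmin M.tmax) := fun t ht =>
    (Real.analyticAt_sqrt (hN₂pos t ht).ne').comp (hN₂an t ht)
  have husq : ∀ t ∈ Icc M.tmin M.tmax, ((t - M.t₀) * √(N₂ t)) ^ 2 + M.f t ^ 2 = m ^ 2 := by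
    intro t ht
    rw [mul_pow, Real.sq_sqrt (hN₂pos t ht).le, ← hN1]
    simp [hN]
  refine ⟨fun t => (t - M.t₀) * √(N₂ t), fun t => -e t / √(N₂ t), ?_, ?_, husq, ?_, ?_, ?_, ?_, ?_, ?_⟩
  · exact fun t ht => (analyticAt_id.sub analyticAt_const).mul (hsqan t ht)
  · exact fun t ht => (hean t ht).neg.div (hsqan t ht) (hsq t ht).ne'
  · intro t ht
    have := hsq t ht
    rw [hfe t]
    field_simp
  · intro t ht
    have h0 := hsq t ht
    have h1 := ((hN₂an t ht).differentiableAt.hasDerivAt).sqrt (hN₂pos t ht).ne'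
    have h2 := ((hasDerivAt_id t).sub_const M.t₀).mul h1
    refine h2.congr_deriv ?_
    have h3 := hident t ht
    have h4 := Real.sq_sqrt (hN₂pos t ht).le
    simp only [id]
    field_simp
    rw [h4]
    linear_combination -h3
  · intro t ht
    exact div_pos (by linarith [heneg t ht]) (hsq t ht)
  · have h := husq _ M.tmin_mem
    rw [M.f_tmin] at h
    have h1 := M.t₀_mem_Ioo.1
    have h2 := hsq _ M.tmin_mem
    have h3 : (M.tmin - M.t₀) * √(N₂ M.tmin) ≤ 0 :=
      mul_nonpos_of_nonpos_of_nonneg (by linarith) h2.le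
    have h4 := M.radius_pos
    nlinarith
  · have h := husq _ M.tmax_mem
    rw [M.f_tmax] at h
    have h1 := M.t₀_mem_Ioo.2
    have h2 := hsq _ M.tmax_mem
    have h3 : 0 ≤ (M.tmax - M.t₀) * √(N₂ M.tmax) := mul_nonneg (by linarith) h2.le
    have h4 := M.radius_pos
    nlinarith
  · simp

end SurfaceOfRevolution

/-! ### Latitude as a coordinate on the profile -/

namespace SurfaceOfRevolution

/-- A latitude coordinate `u` along the profile curve with `u² + f² = m²`, together with the
angular speed `k` of the phase of the oscillation in latitude. -/
structure Latitude (M : SurfaceOfRevolution) where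
  u : ℝ → ℝ
  k : ℝ → ℝ
  u_an : AnalyticOnNhd ℝ u (Icc M.tmin M.tmax)
  k_an : AnalyticOnNhd ℝ k (Icc M.tmin M.tmax)
  sq_add_sq : ∀ t ∈ Icc M.tmin M.tmax, u t ^ 2 + M.f t ^ 2 = M.radius ^ 2
  deriv_f : ∀ t ∈ Icc M.tmin M.tmax, deriv M.f t = -(u t * k t)
  hasDerivAt_u : ∀ t ∈ Icc M.tmin M.tmax, HasDerivAt u (M.f t * k t) t
  k_pos : ∀ t ∈ Icc M.tmin M.tmax, 0 < k t
  u_tmin : u M.tmin = -M.radius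
  u_tmax : u M.tmax = M.radius
  u_t₀ : u M.t₀ = 0

theorem nonempty_latitude (M : SurfaceOfRevolution)
    (hf : AnalyticOnNhd ℝ M.f (Icc M.tmin M.tmax)) : Nonempty M.Latitude := by
  obtain ⟨u, k, h1, h2, h3, h4, h5, h6, h7, h8, h9⟩ := M.exists_latitude hf
  exact ⟨⟨u, k, h1, h2, h3, h4, h5, h6, h7, h8, h9⟩⟩

namespace Latitude

variable {M : SurfaceOfRevolution} (L : M.Latitude)

theorem strictMonoOn_u : StrictMonoOn L.u (Icc M.tmin M.tmax) := by
  refine strictMonoOn_of_deriv_pos (convex_Icc _ _) L.u_an.continuousOn fun x hx => ?_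
  rw [interior_Icc] at hx
  have hx' := Ioo_subset_Icc_self hx
  rw [(L.hasDerivAt_u x hx').deriv]
  exact mul_pos (M.f_pos x hx) (L.k_pos x hx')

theorem neg_radius_le_radius : -M.radius ≤ M.radius := by linarith [M.radius_pos]

theorem u_mem {t : ℝ} (ht : t ∈ Icc M.tmin M.tmax) : L.u t ∈ Icc (-M.radius) M.radius :=
  abs_le.1 (abs_le_of_sq_le_sq (by nlinarith [L.sq_add_sq t ht, sq_nonneg (M.f t)]) M.radius_pos.le)

/-- The inverse of the latitude coordinate (constant outside `[-m, m]`). -/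
noncomputable def inv (w : ℝ) : ℝ :=
  Function.invFunOn L.u (Icc M.tmin M.tmax) (projIcc (-M.radius) M.radius neg_radius_le_radius w)

theorem exists_u_eq (w : ℝ) : ∃ t ∈ Icc M.tmin M.tmax,
    L.u t = projIcc (-M.radius) M.radius neg_radius_le_radius w := by
  have h := intermediate_value_Icc M.tmin_lt_tmax.le L.u_an.continuousOn
  rw [L.u_tmin, L.u_tmax] at h
  exact h (projIcc (-M.radius) M.radius neg_radius_le_radius w).2

theorem inv_mem (w : ℝ) : L.inv w ∈ Icc M.tmin M.tmax :=
  Function.invFunOn_mem (L.exists_u_eq w)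

theorem u_inv' (w : ℝ) :
    L.u (L.inv w) = projIcc (-M.radius) M.radius neg_radius_le_radius w :=
  Function.invFunOn_eq (L.exists_u_eq w)

theorem u_inv {w : ℝ} (hw : w ∈ Icc (-M.radius) M.radius) : L.u (L.inv w) = w := by
  rw [L.u_inv', projIcc_of_mem _ hw]

theorem inv_u {t : ℝ} (ht : t ∈ Icc M.tmin M.tmax) : L.inv (L.u t) = t :=
  L.strictMonoOn_u.injOn (L.inv_mem _) ht (L.u_inv (L.u_mem ht))

theorem continuous_inv : Continuous L.inv := by
  have h1 : Topology.IsClosedEmbedding ((Icc M.tmin M.tmax).domRestrict L.u) :=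
    Continuous.isClosedEmbedding (continuousOn_iff_continuous_domRestrict.1 L.u_an.continuousOn)
      (injOn_iff_injective.1 L.strictMonoOn_u.injOn)
  have h2 : Continuous fun w => (⟨L.inv w, L.inv_mem w⟩ : Icc M.tmin M.tmax) := by
    rw [h1.isInducing.continuous_iff]
    have : (Icc M.tmin M.tmax).domRestrict L.u ∘ (fun w => ⟨L.inv w, L.inv_mem w⟩) =
        fun w => (projIcc (-M.radius) M.radius neg_radius_le_radius w : ℝ) := by
      funext w
      exact L.u_inv' w
    rw [this]
    exact continuous_subtype_val.comp continuous_projIcc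
  exact continuous_subtype_val.comp h2

theorem inv_mem_Ioo {w : ℝ} (hw : w ∈ Ioo (-M.radius) M.radius) :
    L.inv w ∈ Ioo M.tmin M.tmax := by
  have h := L.u_inv (Ioo_subset_Icc_self hw)
  refine ⟨lt_of_le_of_ne (L.inv_mem w).1 fun h' => ?_, lt_of_le_of_ne (L.inv_mem w).2 fun h' => ?_⟩
  · rw [← h', L.u_tmin] at h
    exact hw.1.ne h
  · rw [h', L.u_tmax] at h
    exact hw.2.ne h.symm

theorem inv_zero : L.inv 0 = M.t₀ := by
  rw [← L.u_t₀, L.inv_u M.t₀_mem]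

theorem eventually_u_inv {w : ℝ} (hw : w ∈ Ioo (-M.radius) M.radius) :
    ∀ᶠ y in 𝓝 w, L.u (L.inv y) = y := by
  filter_upwards [isOpen_Ioo.mem_nhds hw] with y hy
  exact L.u_inv (Ioo_subset_Icc_self hy)

theorem hasDerivAt_inv {w : ℝ} (hw : w ∈ Ioo (-M.radius) M.radius) :
    HasDerivAt L.inv (M.f (L.inv w) * L.k (L.inv w))⁻¹ w := by
  have ht := L.inv_mem_Ioo hw
  exact (L.hasDerivAt_u _ (L.inv_mem w)).of_local_left_inverse L.continuous_inv.continuousAt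
    (mul_pos (M.f_pos _ ht) (L.k_pos _ (L.inv_mem w))).ne' (L.eventually_u_inv hw)

/-- The interval is open because `u' = f k` vanishes at the poles; at `±m` only continuity of the
inverse is available. -/
theorem analyticOnNhd_inv : AnalyticOnNhd ℝ L.inv (Ioo (-M.radius) M.radius) := by
  intro w hw
  have ht := L.inv_mem_Ioo hw
  have hne : M.f (L.inv w) * L.k (L.inv w) ≠ 0 :=
    (mul_pos (M.f_pos _ ht) (L.k_pos _ (L.inv_mem w))).ne'
  have hu : ContDiffAt ℝ ω L.u (L.inv w) := (L.u_an _ (L.inv_mem w)).contDiffAt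
  have hfd : HasFDerivAt L.u ((ContinuousLinearEquiv.unitsEquivAut ℝ (Units.mk0 _ hne) :
      ℝ ≃L[ℝ] ℝ) : ℝ →L[ℝ] ℝ) (L.inv w) := by
    have := (L.hasDerivAt_u _ (L.inv_mem w)).hasFDerivAt
    refine this.congr_fderiv ?_
    ext
    simp
  have h1 := hu.to_localInverse hfd (by simp)
  rw [L.u_inv (Ioo_subset_Icc_self hw)] at h1
  refine h1.analyticAt.congr ?_
  have h2 := (hu.hasStrictFDerivAt' hfd (by simp)).eventually_left_inverse
  filter_upwards [L.eventually_u_inv hw, L.continuous_inv.continuousAt.eventually h2] with y hy1 hy2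
  rw [hy1] at hy2
  exact hy2

/-- The reciprocal of the phase speed as a function of latitude. -/
noncomputable def F (w : ℝ) : ℝ := (L.k (L.inv w))⁻¹

theorem F_pos (w : ℝ) : 0 < L.F w := inv_pos.2 (L.k_pos _ (L.inv_mem w))

theorem F_u {t : ℝ} (ht : t ∈ Icc M.tmin M.tmax) : L.F (L.u t) = (L.k t)⁻¹ := by
  rw [F, L.inv_u ht]

theorem continuous_F : Continuous L.F := by
  refine Continuous.inv₀ ?_ fun w => (L.k_pos _ (L.inv_mem w)).ne'
  exact L.k_an.continuousOn.comp_continuous L.continuous_inv L.inv_mem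

theorem analyticOnNhd_F : AnalyticOnNhd ℝ L.F (Ioo (-M.radius) M.radius) := fun w hw =>
  ((L.k_an _ (L.inv_mem w)).comp (L.analyticOnNhd_inv w hw)).inv (L.k_pos _ (L.inv_mem w)).ne'

/-- The slope `-1` of `f` at the pole fixes `k = 1/m` there. Together with `F_neg_radius`, this is
how smooth closing at the poles enters the limit of the rotation. -/
theorem F_radius : L.F M.radius = M.radius := by
  have h := L.deriv_f _ M.tmax_mem
  rw [M.deriv_f_tmax, L.u_tmax] at h
  rw [← L.u_tmax, L.F_u M.tmax_mem, L.u_tmax]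
  exact inv_eq_of_mul_eq_one_right (by linarith)

theorem F_neg_radius : L.F (-M.radius) = M.radius := by
  have h := L.deriv_f _ M.tmin_mem
  rw [M.deriv_f_tmin, L.u_tmin] at h
  rw [← L.u_tmin, L.F_u M.tmin_mem]
  exact inv_eq_of_mul_eq_one_right (by linarith)

end Latitude

end SurfaceOfRevolution

/-! ### Primitives of positive periodic functions -/

section PeriodicPrimitive

variable {P : ℝ → ℝ} {T : ℝ}

theorem hasDerivAt_primitive (hP : Continuous P) (y : ℝ) :
    HasDerivAt (fun y => ∫ x in 0..y, P x) (P y) y :=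
  intervalIntegral.integral_hasDerivAt_right (hP.intervalIntegrable _ _)
    hP.stronglyMeasurable.stronglyMeasurableAtFilter hP.continuousAt

theorem primitive_add_int_mul_period (hP : Continuous P) (hper : Function.Periodic P T) (y : ℝ)
    (n : ℤ) : ∫ x in 0..(y + n * T), P x = (∫ x in 0..y, P x) + n * ∫ x in 0..T, P x := by
  have hint : ∀ u v, IntervalIntegrable P volume u v := fun u v => hP.intervalIntegrable _ _
  have h := hper.intervalIntegral_add_zsmul_eq n y hint
  rw [zsmul_eq_mul, zsmul_eq_mul, hper.intervalIntegral_add_eq y 0, zero_add] at h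
  rw [← h, intervalIntegral.integral_add_adjacent_intervals (hint _ _) (hint _ _)]

theorem strictMono_primitive (hP : Continuous P) (hpos : ∀ x, 0 < P x) :
    StrictMono fun y => ∫ x in 0..y, P x := by
  refine strictMono_of_deriv_pos fun y => ?_
  rw [(hasDerivAt_primitive hP y).deriv]
  exact hpos y

theorem surjective_primitive (hP : Continuous P) (hper : Function.Periodic P T) (hT : 0 < T)
    (hpos : ∀ x, 0 < P x) : Function.Surjective fun y => ∫ x in 0..y, P x := by
  have hI : 0 < ∫ x in 0..T, P x := intervalIntegral.intervalIntegral_pos_of_pos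
    (hP.intervalIntegrable _ _) hpos hT
  have hval : ∀ n : ℤ, ∫ x in 0..(n * T), P x = n * ∫ x in 0..T, P x := by
    intro n
    have := primitive_add_int_mul_period hP hper 0 n
    simpa using this
  have hc : Continuous fun y => ∫ x in 0..y, P x :=
    continuous_iff_continuousAt.2 fun y => (hasDerivAt_primitive hP y).continuousAt
  intro s
  obtain ⟨n, hn⟩ := exists_int_gt (s / ∫ x in 0..T, P x)
  obtain ⟨n', hn'⟩ := exists_int_lt (s / ∫ x in 0..T, P x)
  rw [div_lt_iff₀ hI] at hn
  rw [lt_div_iff₀ hI] at hn'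
  refine mem_range_of_exists_le_of_exists_ge hc ⟨n' * T, ?_⟩ ⟨n * T, ?_⟩
  · simp only [hval]; exact hn'.le
  · simp only [hval]; exact hn.le

end PeriodicPrimitive

/-! ### Coordinates on the surface and its tangent planes -/

theorem exists_eq_mul_cos_sin {x y r : ℝ} (hr : 0 ≤ r) (h : x ^ 2 + y ^ 2 = r ^ 2) :
    ∃ θ, x = r * Real.cos θ ∧ y = r * Real.sin θ := by
  have h1 := Complex.norm_mul_cos_arg ⟨x, y⟩
  have h2 := Complex.norm_mul_sin_arg ⟨x, y⟩
  have h3 : ‖(⟨x, y⟩ : ℂ)‖ = r := by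
    rw [← sq_eq_sq₀ (norm_nonneg _) hr, ← h, Complex.sq_norm, Complex.normSq_mk]; ring
  rw [h3] at h1 h2
  exact ⟨_, h1.symm, h2.symm⟩

theorem hasDerivAt_E3 {c : ℝ → E3} {v : E3} {s : ℝ} :
    HasDerivAt c v s ↔ ∀ i, HasDerivAt (fun τ => c τ i) (v i) s := by
  constructor
  · intro hc i
    exact ((EuclideanSpace.proj (𝕜 := ℝ) i).hasFDerivAt.comp_hasDerivAt s hc)
  · intro hc
    have h1 : HasDerivAt (fun τ => (EuclideanSpace.equiv (Fin 3) ℝ) (c τ))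
        ((EuclideanSpace.equiv (Fin 3) ℝ) v) s := hasDerivAt_pi.2 hc
    have h2 := ((EuclideanSpace.equiv (Fin 3) ℝ).symm : (Fin 3 → ℝ) →L[ℝ] E3).hasFDerivAt.comp_hasDerivAt
      s h1
    simpa [Function.comp_def] using h2

theorem inner_E3 (v w : E3) : inner ℝ v w = v 0 * w 0 + v 1 * w 1 + v 2 * w 2 := by
  simp [PiLp.inner_apply, Fin.sum_univ_three, mul_comm]

theorem norm_sq_E3 (v : E3) : ‖v‖ ^ 2 = v 0 ^ 2 + v 1 ^ 2 + v 2 ^ 2 := by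
  rw [← real_inner_self_eq_norm_sq, inner_E3]; ring

namespace SurfaceOfRevolution

variable (M : SurfaceOfRevolution)

@[simp] theorem param_zero (t φ : ℝ) : M.param t φ 0 = M.f t * Real.cos φ := by simp [param]

@[simp] theorem param_one (t φ : ℝ) : M.param t φ 1 = M.f t * Real.sin φ := by simp [param]

@[simp] theorem param_two (t φ : ℝ) : M.param t φ 2 = M.g t := by simp [param]

theorem exists_eq_param {p : E3} {t : ℝ} (ht : t ∈ Icc M.tmin M.tmax)
    (h : p 0 ^ 2 + p 1 ^ 2 = M.f t ^ 2) (h' : p 2 = M.g t) : ∃ φ, p = M.param t φ := by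
  obtain ⟨φ, h1, h2⟩ := exists_eq_mul_cos_sin (M.f_nonneg ht) h
  refine ⟨φ, ?_⟩
  ext i
  fin_cases i
  · simpa using h1
  · simpa using h2
  · simpa using h'

theorem mem_carrier_iff {p : E3} : p ∈ M.carrier ↔
    ∃ t ∈ Icc M.tmin M.tmax, p 0 ^ 2 + p 1 ^ 2 = M.f t ^ 2 ∧ p 2 = M.g t := by
  constructor
  · rintro ⟨t, ht, φ, rfl⟩
    refine ⟨t, ht, ?_, by simp⟩
    simp only [param_zero, param_one]
    linear_combination M.f t ^ 2 * Real.sin_sq_add_cos_sq φ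
  · rintro ⟨t, ht, h1, h2⟩
    obtain ⟨φ, hφ⟩ := M.exists_eq_param ht h1 h2
    exact ⟨t, ht, φ, hφ⟩

open Classical in
/-- The parameter on the profile curve of a point of the surface. -/
noncomputable def profileTime (p : E3) : ℝ :=
  if h : p ∈ M.carrier then (M.mem_carrier_iff.1 h).choose else M.t₀

variable {M}

theorem profileTime_mem {p : E3} (hp : p ∈ M.carrier) : M.profileTime p ∈ Icc M.tmin M.tmax := by
  rw [profileTime, dif_pos hp]
  exact (M.mem_carrier_iff.1 hp).choose_spec.1

theorem sq_add_sq_eq {p : E3} (hp : p ∈ M.carrier) :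
    p 0 ^ 2 + p 1 ^ 2 = M.f (M.profileTime p) ^ 2 := by
  rw [profileTime, dif_pos hp]
  exact (M.mem_carrier_iff.1 hp).choose_spec.2.1

theorem two_eq {p : E3} (hp : p ∈ M.carrier) : p 2 = M.g (M.profileTime p) := by
  rw [profileTime, dif_pos hp]
  exact (M.mem_carrier_iff.1 hp).choose_spec.2.2

theorem profileTime_eq {p : E3} {t : ℝ} (ht : t ∈ Icc M.tmin M.tmax)
    (h : p 0 ^ 2 + p 1 ^ 2 = M.f t ^ 2) (h' : p 2 = M.g t) : M.profileTime p = t := by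
  have hp : p ∈ M.carrier := M.mem_carrier_iff.2 ⟨t, ht, h, h'⟩
  refine M.profile_injOn (profileTime_mem hp) ht (Prod.ext ?_ ?_)
  · refine (pow_left_inj₀ (M.f_nonneg (profileTime_mem hp)) (M.f_nonneg ht) two_ne_zero).1 ?_
    rw [← sq_add_sq_eq hp, h]
  · change M.g _ = M.g t
    rw [← two_eq hp, h']

theorem param_mem_carrier {t : ℝ} (ht : t ∈ Icc M.tmin M.tmax) (φ : ℝ) :
    M.param t φ ∈ M.carrier := ⟨t, ht, φ, rfl⟩

theorem profileTime_param {t : ℝ} (ht : t ∈ Icc M.tmin M.tmax) (φ : ℝ) :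
    M.profileTime (M.param t φ) = t := by
  refine profileTime_eq ht ?_ (by simp)
  simp only [param_zero, param_one]
  linear_combination M.f t ^ 2 * Real.sin_sq_add_cos_sq φ

theorem sqrt_eq {p : E3} (hp : p ∈ M.carrier) :
    √(p 0 ^ 2 + p 1 ^ 2) = M.f (M.profileTime p) := by
  rw [sq_add_sq_eq hp, Real.sqrt_sq (M.f_nonneg (profileTime_mem hp))]

/-- A simple profile on a compact interval is a closed embedding into the half-plane, and `(f, g)`
at a point is read off as `(√(x² + y²), z)`. -/
theorem continuousOn_profileTime : ContinuousOn M.profileTime M.carrier := by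
  have hγ : Continuous fun t : Icc M.tmin M.tmax => (M.f t, M.g t) :=
    (M.f_smooth.continuous.comp continuous_subtype_val).prodMk
      (M.g_smooth.continuous.comp continuous_subtype_val)
  have h1 := hγ.isClosedEmbedding (injOn_iff_injective.1 M.profile_injOn)
  have h2 : Continuous fun p : M.carrier =>
      (⟨M.profileTime p, profileTime_mem p.2⟩ : Icc M.tmin M.tmax) := by
    rw [h1.isInducing.continuous_iff]
    have : (fun t : Icc M.tmin M.tmax => (M.f t, M.g t)) ∘ (fun p : M.carrier =>
        (⟨M.profileTime p, profileTime_mem p.2⟩ : Icc M.tmin M.tmax)) =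
        fun p : M.carrier => (√((p : E3) 0 ^ 2 + (p : E3) 1 ^ 2), (p : E3) 2) := by
      funext p
      simp only [Function.comp_apply, sqrt_eq p.2, two_eq p.2]
    rw [this]
    fun_prop
  exact continuousOn_iff_continuous_domRestrict.2 (continuous_subtype_val.comp h2)

theorem continuousAt_profileTime {c : ℝ → E3} (hc : ∀ τ, c τ ∈ M.carrier) {s : ℝ}
    (h : ContinuousAt c s) : ContinuousAt (fun τ => M.profileTime (c τ)) s :=
  (continuousOn_profileTime (c s) (hc s)).tendsto.comp
    (tendsto_nhdsWithin_iff.2 ⟨h, Eventually.of_forall hc⟩)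

theorem hasDerivAt_sq_add_sq {c : ℝ → E3} {v : E3} {s : ℝ} (h : HasDerivAt c v s) :
    HasDerivAt (fun τ => c τ 0 ^ 2 + c τ 1 ^ 2) (2 * (c s 0 * v 0 + c s 1 * v 1)) s := by
  refine (((hasDerivAt_E3.1 h 0).pow 2).add ((hasDerivAt_E3.1 h 1).pow 2)).congr_deriv ?_
  push_cast; ring

/-- By unit speed, the projection `κ` of the profile onto its tangent at `t` has derivative `1`
there, so a local inverse recovers the parameter from `κ`. Off the axis `κ` is a differentiable
function of the point. -/
theorem exists_hasDerivAt_profileTime {c : ℝ → E3} (hc : ∀ τ, c τ ∈ M.carrier) {v : E3} {s : ℝ}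
    (h : HasDerivAt c v s) (hs : M.profileTime (c s) ∈ Ioo M.tmin M.tmax) :
    ∃ α, HasDerivAt (fun τ => M.profileTime (c τ)) α s ∧
      c s 0 * v 0 + c s 1 * v 1 =
        M.f (M.profileTime (c s)) * deriv M.f (M.profileTime (c s)) * α ∧
      v 2 = deriv M.g (M.profileTime (c s)) * α := by
  set t := M.profileTime (c s) with ht
  have hfpos : 0 < M.f t := M.f_pos t hs
  have hsq := hasDerivAt_sq_add_sq h
  have hsq0 : c s 0 ^ 2 + c s 1 ^ 2 = M.f t ^ 2 := sq_add_sq_eq (hc s)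
  have hcont : ContinuousAt (fun τ => M.profileTime (c τ)) s :=
    continuousAt_profileTime hc h.continuousAt
  set κ : ℝ → ℝ := fun x => deriv M.f t * M.f x + deriv M.g t * M.g x with hκ
  have hκ' : HasStrictDerivAt κ 1 t := by
    have h1 : HasStrictDerivAt M.f (deriv M.f t) t :=
      M.f_smooth.contDiffAt.hasStrictDerivAt (by simp)
    have h2 : HasStrictDerivAt M.g (deriv M.g t) t :=
      M.g_smooth.contDiffAt.hasStrictDerivAt (by simp)
    refine ((h1.const_mul _).add (h2.const_mul _)).congr_deriv ?_
    rw [← M.unit_speed t (Ioo_subset_Icc_self hs)]; ring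
  have hκc : ∃ β, HasDerivAt (fun τ => κ (M.profileTime (c τ))) β s := by
    have h1 := hsq.sqrt (by rw [hsq0]; positivity)
    have h2 := (h1.const_mul (deriv M.f t)).add ((hasDerivAt_E3.1 h 2).const_mul (deriv M.g t))
    refine ⟨_, h2.congr_of_eventuallyEq (Eventually.of_forall fun τ => ?_)⟩
    simp only [hκ, Pi.add_apply, sqrt_eq (hc τ), two_eq (hc τ)]
  obtain ⟨β, hβ⟩ := hκc
  have hinv := (hκ'.to_localInverse one_ne_zero).hasDerivAt
  have hα := hinv.comp s hβ
  have hα' : HasDerivAt (fun τ => M.profileTime (c τ)) (1⁻¹ * β) s := by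
    refine hα.congr_of_eventuallyEq ?_
    filter_upwards [hcont.eventually (hκ'.eventually_left_inverse one_ne_zero)] with τ hτ
    exact hτ.symm
  refine ⟨_, hα', ?_, ?_⟩
  · have h1 := ((M.hasDerivAt_f t).comp s hα').pow 2
    have h2 : (fun τ => c τ 0 ^ 2 + c τ 1 ^ 2) = (M.f ∘ fun τ => M.profileTime (c τ)) ^ 2 := by
      funext τ; simp [sq_add_sq_eq (hc τ)]
    rw [h2] at hsq
    have h3 := hsq.unique h1
    simp only [Function.comp_apply, ← ht] at h3
    push_cast at h3
    linarith
  · have h1 := (M.hasDerivAt_g t).comp s hα'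
    have h2 : (fun τ => c τ 2) = M.g ∘ fun τ => M.profileTime (c τ) := by
      funext τ; simp [two_eq (hc τ)]
    have h3 := hasDerivAt_E3.1 h 2
    rw [h2] at h3
    exact h3.unique h1

theorem pole_cases {t : ℝ} (ht : t ∈ Icc M.tmin M.tmax) (h : M.f t = 0) :
    (t = M.tmin ∧ deriv M.f t = 1) ∨ (t = M.tmax ∧ deriv M.f t = -1) := by
  rcases eq_or_lt_of_le ht.1 with h1 | h1
  · left; exact ⟨h1.symm, h1 ▸ M.deriv_f_tmin⟩
  rcases eq_or_lt_of_le ht.2 with h2 | h2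
  · right; exact ⟨h2, h2 ▸ M.deriv_f_tmax⟩
  exact absurd h (M.f_pos t ⟨h1, h2⟩).ne'

theorem deriv_f_sq_of_pole {t : ℝ} (ht : t ∈ Icc M.tmin M.tmax) (h : M.f t = 0) :
    deriv M.f t ^ 2 = 1 := by
  rcases pole_cases ht h with ⟨-, h⟩ | ⟨-, h⟩ <;> rw [h] <;> norm_num

theorem deriv_g_of_pole {t : ℝ} (ht : t ∈ Icc M.tmin M.tmax) (h : M.f t = 0) :
    deriv M.g t = 0 := by
  have h1 := M.unit_speed t ht
  rw [deriv_f_sq_of_pole ht h] at h1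
  exact pow_eq_zero_iff two_ne_zero |>.1 (by linarith)

theorem mem_Ioo_of_f_ne_zero {t : ℝ} (ht : t ∈ Icc M.tmin M.tmax) (h : M.f t ≠ 0) :
    t ∈ Ioo M.tmin M.tmax := by
  refine ⟨lt_of_le_of_ne ht.1 ?_, lt_of_le_of_ne ht.2 ?_⟩
  · rintro rfl; exact h M.f_tmin
  · rintro rfl; exact h M.f_tmax

/-- Near a pole the height is `g ∘ f⁻¹` of the distance to the axis, with derivative zero because
`g' = 0` there. Along a differentiable curve through the pole this distance is `O(τ - s)`, so the
height changes by `o(τ - s)`. -/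
theorem hasDerivAt_two_of_pole {c : ℝ → E3} (hc : ∀ τ, c τ ∈ M.carrier) {v : E3} {s : ℝ}
    (h : HasDerivAt c v s) (hs : M.f (M.profileTime (c s)) = 0) : v 2 = 0 := by
  set t := M.profileTime (c s) with ht
  have hmem : t ∈ Icc M.tmin M.tmax := profileTime_mem (hc s)
  have hne : deriv M.f t ≠ 0 := by
    intro h0
    have := deriv_f_sq_of_pole hmem hs
    rw [h0] at this; norm_num at this
  have hf : HasStrictDerivAt M.f (deriv M.f t) t :=
    M.f_smooth.contDiffAt.hasStrictDerivAt (by simp)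
  have hcont : ContinuousAt (fun τ => M.profileTime (c τ)) s :=
    continuousAt_profileTime hc h.continuousAt
  set i := hf.localInverse M.f (deriv M.f t) t hne with hi
  have hi' : HasDerivAt i (deriv M.f t)⁻¹ 0 := by
    have := (hf.to_localInverse hne).hasDerivAt
    rwa [hs] at this
  have hleft := hf.eventually_left_inverse hne
  have hi0 : i 0 = t := by
    have := hleft.self_of_nhds
    rwa [hs] at this
  have hG : HasDerivAt (M.g ∘ i) 0 0 := by
    have h1 := M.hasDerivAt_g t
    rw [deriv_g_of_pole hmem hs, ← hi0] at h1
    simpa using h1.comp 0 hi'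
  have hzero : c s 0 ^ 2 + c s 1 ^ 2 = 0 := by rw [sq_add_sq_eq (hc s), ← ht, hs]; simp
  have hc0 : c s 0 = 0 := by nlinarith [sq_nonneg (c s 0), sq_nonneg (c s 1)]
  have hc1 : c s 1 = 0 := by nlinarith [sq_nonneg (c s 0), sq_nonneg (c s 1)]
  have hfO : (fun τ => M.f (M.profileTime (c τ))) =O[𝓝 s] fun τ => τ - s := by
    have h0 := (hasDerivAt_E3.1 h 0).isBigO_sub
    have h1 := (hasDerivAt_E3.1 h 1).isBigO_sub
    simp only [hc0, hc1, sub_zero] at h0 h1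
    refine Asymptotics.IsBigO.trans ?_ (h0.norm_left.add h1.norm_left)
    refine Asymptotics.isBigO_of_le _ fun τ => ?_
    have h2 := sq_add_sq_eq (hc τ)
    rw [Real.norm_eq_abs, Real.norm_eq_abs, Real.norm_eq_abs, Real.norm_eq_abs,
      abs_of_nonneg (by positivity : 0 ≤ |c τ 0| + |c τ 1|)]
    refine abs_le_of_sq_le_sq ?_ (by positivity)
    rw [← h2, ← sq_abs (c τ 0), ← sq_abs (c τ 1)]
    nlinarith [abs_nonneg (c τ 0), abs_nonneg (c τ 1)]
  have htend : Tendsto (fun τ => M.f (M.profileTime (c τ))) (𝓝 s) (𝓝 0) := by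
    have := (M.f_smooth.continuous.continuousAt (x := t)).comp_of_eq hcont ht.symm
    have h2 := this.tendsto
    simpa only [Function.comp_def, ← ht, hs] using h2
  have hlo := (hasDerivAt_iff_isLittleO.1 hG).comp_tendsto htend
  have h2 : HasDerivAt (fun τ => c τ 2) 0 s := by
    rw [hasDerivAt_iff_isLittleO]
    refine Asymptotics.IsLittleO.trans_isBigO (g := fun τ => M.f (M.profileTime (c τ))) ?_ hfO
    refine hlo.congr' ?_ (Eventually.of_forall fun τ => by simp)
    filter_upwards [hcont.eventually hleft] with τ hτ
    simp only [Function.comp_apply, smul_zero, sub_zero, hi0]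
    rw [two_eq (hc τ), two_eq (hc s), ← ht]
    have : i (M.f (M.profileTime (c τ))) = M.profileTime (c τ) := hτ
    rw [this]
  exact (hasDerivAt_E3.1 h 2).unique h2

theorem exists_of_mem_tangentPlane {p v : E3} (hv : v ∈ M.tangentPlane p) :
    ∃ α, p 0 * v 0 + p 1 * v 1 = M.f (M.profileTime p) * deriv M.f (M.profileTime p) * α ∧
      v 2 = deriv M.g (M.profileTime p) * α := by
  obtain ⟨c, hc, rfl, h⟩ := hv
  have hmem := profileTime_mem (hc 0)
  by_cases hf : M.f (M.profileTime (c 0)) = 0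
  · have hzero : c 0 0 ^ 2 + c 0 1 ^ 2 = 0 := by rw [sq_add_sq_eq (hc 0), hf]; simp
    have hc0 : c 0 0 = 0 := by nlinarith [sq_nonneg (c 0 0), sq_nonneg (c 0 1)]
    have hc1 : c 0 1 = 0 := by nlinarith [sq_nonneg (c 0 0), sq_nonneg (c 0 1)]
    refine ⟨0, by simp [hc0, hc1], ?_⟩
    rw [hasDerivAt_two_of_pole hc h hf, mul_zero]
  · obtain ⟨α, -, h1, h2⟩ := exists_hasDerivAt_profileTime hc h (mem_Ioo_of_f_ne_zero hmem hf)
    exact ⟨α, h1, h2⟩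

end SurfaceOfRevolution

namespace SurfaceOfRevolution

variable {M : SurfaceOfRevolution}

theorem hasDerivAt_param {T Φ : ℝ → ℝ} {α β s : ℝ} (hT : HasDerivAt T α s)
    (hΦ : HasDerivAt Φ β s) :
    HasDerivAt (fun τ => M.param (T τ) (Φ τ))
      !₂[deriv M.f (T s) * α * Real.cos (Φ s) - M.f (T s) * Real.sin (Φ s) * β,
        deriv M.f (T s) * α * Real.sin (Φ s) + M.f (T s) * Real.cos (Φ s) * β,
        deriv M.g (T s) * α] s := by
  have hf := (M.hasDerivAt_f (T s)).comp s hT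
  have hg := (M.hasDerivAt_g (T s)).comp s hT
  rw [hasDerivAt_E3]
  intro i
  fin_cases i
  · have := hf.mul hΦ.cos
    simp only [Fin.zero_eta, param_zero]
    refine this.congr_deriv ?_
    simp; ring
  · have := hf.mul hΦ.sin
    simp only [Fin.mk_one, param_one]
    refine this.congr_deriv ?_
    simp; ring
  · simpa [Function.comp_def] using hg

/-- A curve of profile parameters with prescribed velocity that stays inside the interval. -/
theorem exists_add_mul_sin_mem_Ioo {t : ℝ} (ht : t ∈ Ioo M.tmin M.tmax) :
    ∃ ε > 0, ∀ x, t + ε * Real.sin x ∈ Ioo M.tmin M.tmax := by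
  obtain ⟨ε, hε, hball⟩ := Metric.isOpen_iff.1 isOpen_Ioo t ht
  refine ⟨ε / 2, by positivity, fun x => hball ?_⟩
  rw [Metric.mem_ball, Real.dist_eq, add_sub_cancel_left, abs_mul, abs_of_pos (by positivity)]
  nlinarith [Real.abs_sin_le_one x]

theorem hasDerivAt_add_mul_sin {ε : ℝ} (hε : 0 < ε) (t α : ℝ) :
    HasDerivAt (fun τ => t + ε * Real.sin (α / ε * τ)) α 0 := by
  have h1 := (((hasDerivAt_id (0 : ℝ)).const_mul (α / ε)).sin.const_mul ε).const_add t
  refine h1.congr_deriv ?_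
  simp; field_simp

theorem mem_tangentPlane_of_interior {p v : E3} (hp : p ∈ M.carrier) {α : ℝ}
    (hpole : M.f (M.profileTime p) ≠ 0)
    (h1 : p 0 * v 0 + p 1 * v 1 = M.f (M.profileTime p) * deriv M.f (M.profileTime p) * α)
    (h2 : v 2 = deriv M.g (M.profileTime p) * α) : v ∈ M.tangentPlane p := by
  have hmem := profileTime_mem hp
  have hIoo := mem_Ioo_of_f_ne_zero hmem hpole
  obtain ⟨φ, hφ⟩ := M.exists_eq_param hmem (sq_add_sq_eq hp) (two_eq hp)
  set t := M.profileTime p with ht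
  obtain ⟨ε, hε, hεI⟩ := exists_add_mul_sin_mem_Ioo hIoo
  set β := (p 0 * v 1 - p 1 * v 0) / M.f t ^ 2 with hβ
  -- Test curves must stay in the surface for all times; the sine keeps the parameter in the
  -- interval while giving it velocity `α` at `0`.
  refine ⟨fun τ => M.param (t + ε * Real.sin (α / ε * τ)) (φ + β * τ), fun τ =>
    param_mem_carrier (Ioo_subset_Icc_self (hεI _)) _, by simp [hφ], ?_⟩
  have hΦ : HasDerivAt (fun τ => φ + β * τ) β 0 := by
    simpa using ((hasDerivAt_id (0 : ℝ)).const_mul β).const_add φ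
  have h := hasDerivAt_param (M := M) (hasDerivAt_add_mul_sin hε t α) hΦ
  convert h using 1
  have hp0 : p 0 = M.f t * Real.cos φ := by rw [hφ]; simp
  have hp1 : p 1 = M.f t * Real.sin φ := by rw [hφ]; simp
  rw [hp0, hp1] at h1 hβ
  have e := Real.sin_sq_add_cos_sq φ
  have h1' : Real.cos φ * v 0 + Real.sin φ * v 1 = deriv M.f t * α := by
    refine mul_left_cancel₀ hpole ?_
    linear_combination h1
  have hβ' : M.f t * β = Real.cos φ * v 1 - Real.sin φ * v 0 := by
    rw [hβ]; field_simp
  ext i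
  fin_cases i
  · simp
    linear_combination (-(v 0)) * e + Real.cos φ * h1' + Real.sin φ * hβ'
  · simp
    linear_combination (-(v 1)) * e + Real.sin φ * h1' - Real.cos φ * hβ'
  · simpa using h2

/-- The curve is a meridian run through the pole and out along the opposite one. -/
theorem mem_tangentPlane_of_pole {p v : E3} (hp : p ∈ M.carrier)
    (hpole : M.f (M.profileTime p) = 0) (hv : v 2 = 0) : v ∈ M.tangentPlane p := by
  have hmem := profileTime_mem hp
  have hsq := sq_add_sq_eq hp
  have h2 := two_eq hp
  set t := M.profileTime p with ht
  set σ := deriv M.f t with hσ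
  have hσσ : σ * σ = 1 := by rw [← sq]; exact deriv_f_sq_of_pole hmem hpole
  have hσabs : |σ| = 1 := by
    rcases pole_cases hmem hpole with ⟨-, h⟩ | ⟨-, h⟩ <;> rw [hσ, h] <;> simp
  have hin : ∀ r ∈ Icc 0 (M.tmax - M.tmin), t + σ * r ∈ Icc M.tmin M.tmax := by
    intro r hr
    rcases pole_cases hmem hpole with ⟨h, h'⟩ | ⟨h, h'⟩ <;> rw [hσ, h'] <;> constructor <;>
      linarith [hr.1, hr.2]
  obtain ⟨φ, hφ0, hφ1⟩ := exists_eq_mul_cos_sin (Real.sqrt_nonneg (v 0 ^ 2 + v 1 ^ 2))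
    (Real.sq_sqrt (by positivity : 0 ≤ v 0 ^ 2 + v 1 ^ 2)).symm
  set r := √(v 0 ^ 2 + v 1 ^ 2) with hr
  set δ := M.tmax - M.tmin with hδ
  have hδ0 : 0 < δ := sub_pos.2 M.tmin_lt_tmax
  rw [hpole, zero_pow two_ne_zero] at hsq
  have hp0 : p 0 = 0 := by nlinarith [sq_nonneg (p 0), sq_nonneg (p 1)]
  have hp1 : p 1 = 0 := by nlinarith [sq_nonneg (p 0), sq_nonneg (p 1)]
  -- `σ = ±1` points into the profile interval. The signed distance `S` to the axis is extended
  -- oddly and has slope `σ² = 1`; the height `G` is extended evenly and has slope `0`.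
  set S : ℝ → ℝ := fun q => SignType.sign q * M.f (t + σ * |q|) with hS
  set G : ℝ → ℝ := fun q => M.g (t + σ * |q|) with hG
  have htend : Tendsto (fun q : ℝ => t + σ * |q|) (𝓝 0) (𝓝 t) := by
    have : Continuous fun q : ℝ => t + σ * |q| := by fun_prop
    simpa using this.tendsto 0
  have hO : ∀ q : ℝ, ‖t + σ * |q| - t‖ = ‖q - 0‖ := by
    intro q
    rw [add_sub_cancel_left, norm_mul, Real.norm_eq_abs, hσabs, Real.norm_eq_abs, abs_abs, one_mul,
      sub_zero, Real.norm_eq_abs]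
  have hS' : HasDerivAt S 1 0 := by
    rw [hasDerivAt_iff_isLittleO]
    have h := (hasDerivAt_iff_isLittleO.1 (M.hasDerivAt_f t)).comp_tendsto htend
    rw [← Asymptotics.isLittleO_norm_norm] at h ⊢
    refine h.congr (fun q => ?_) fun q => hO q
    simp only [Function.comp_apply, smul_eq_mul, hpole, ← hσ, hS]
    have e : (t + σ * |q| - t) * σ = |q| := by linear_combination |q| * hσσ
    rw [e]
    rcases lt_trichotomy q 0 with h | h | h
    · simp only [sign_neg h, abs_of_neg h]
      simp
      rw [← abs_neg]; congr 1; ring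
    · simp [h, hpole]
    · simp [sign_pos h, abs_of_pos h]
  have hG' : HasDerivAt G 0 0 := by
    rw [hasDerivAt_iff_isLittleO]
    have h0 := M.hasDerivAt_g t
    rw [deriv_g_of_pole hmem hpole] at h0
    have h := (hasDerivAt_iff_isLittleO.1 h0).comp_tendsto htend
    rw [← Asymptotics.isLittleO_norm_norm] at h ⊢
    refine h.congr (fun q => ?_) fun q => hO q
    simp [hG]
  have hq : HasDerivAt (fun τ => 0 + δ * Real.sin (r / δ * τ)) r 0 :=
    hasDerivAt_add_mul_sin hδ0 0 r
  simp only [zero_add] at hq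
  have hSq : HasDerivAt (fun τ => S (δ * Real.sin (r / δ * τ))) r 0 := by
    have := HasDerivAt.comp_of_eq (x := (0 : ℝ)) (y := 0) hS' hq (by simp)
    simpa [Function.comp_def] using this
  have hGq : HasDerivAt (fun τ => G (δ * Real.sin (r / δ * τ))) 0 0 := by
    have := HasDerivAt.comp_of_eq (x := (0 : ℝ)) (y := 0) hG' hq (by simp)
    simpa [Function.comp_def] using this
  refine ⟨fun τ => !₂[S (δ * Real.sin (r / δ * τ)) * Real.cos φ,
    S (δ * Real.sin (r / δ * τ)) * Real.sin φ, G (δ * Real.sin (r / δ * τ))], ?_, ?_, ?_⟩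
  · intro τ
    set q := δ * Real.sin (r / δ * τ) with hqdef
    have hqδ : |q| ≤ δ := by
      rw [hqdef, abs_mul, abs_of_pos hδ0]
      nlinarith [Real.abs_sin_le_one (r / δ * τ)]
    refine M.mem_carrier_iff.2 ⟨t + σ * |q|, hin _ ⟨abs_nonneg _, hqδ⟩, ?_, by simp [hG, hqdef, abs_mul]⟩
    have e := Real.sin_sq_add_cos_sq φ
    have hs : S q ^ 2 = M.f (t + σ * |q|) ^ 2 := by
      simp only [hS]
      rcases lt_trichotomy q 0 with h | h | h
      · simp [sign_neg h]
      · simp [h, hpole]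
      · simp [sign_pos h]
    simp
    linear_combination S q ^ 2 * e + hs
  · ext i
    fin_cases i
    · simp [hS, hp0]
    · simp [hS, hp1]
    · simp [hG, h2]
  · rw [hasDerivAt_E3]
    intro i
    fin_cases i
    · simpa [hφ0] using hSq.mul_const (Real.cos φ)
    · simpa [hφ1] using hSq.mul_const (Real.sin φ)
    · simpa [hv] using hGq

theorem mem_tangentPlane_iff {p v : E3} (hp : p ∈ M.carrier) : v ∈ M.tangentPlane p ↔
    ∃ α, p 0 * v 0 + p 1 * v 1 = M.f (M.profileTime p) * deriv M.f (M.profileTime p) * α ∧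
      v 2 = deriv M.g (M.profileTime p) * α := by
  refine ⟨exists_of_mem_tangentPlane, ?_⟩
  rintro ⟨α, h1, h2⟩
  by_cases hpole : M.f (M.profileTime p) = 0
  · refine mem_tangentPlane_of_pole hp hpole ?_
    rw [h2, deriv_g_of_pole (profileTime_mem hp) hpole, zero_mul]
  · exact mem_tangentPlane_of_interior hp hpole h1 h2

theorem add_mem_tangentPlane {p v w : E3} (hp : p ∈ M.carrier) (hv : v ∈ M.tangentPlane p)
    (hw : w ∈ M.tangentPlane p) : v + w ∈ M.tangentPlane p := by
  rw [mem_tangentPlane_iff hp] at *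
  obtain ⟨α, h1, h2⟩ := hv
  obtain ⟨β, h3, h4⟩ := hw
  exact ⟨α + β, by simp only [PiLp.add_apply]; linear_combination h1 + h3,
    by simp only [PiLp.add_apply]; linear_combination h2 + h4⟩

theorem smul_mem_tangentPlane {p v : E3} (hp : p ∈ M.carrier) (hv : v ∈ M.tangentPlane p) (r : ℝ) :
    r • v ∈ M.tangentPlane p := by
  rw [mem_tangentPlane_iff hp] at *
  obtain ⟨α, h1, h2⟩ := hv
  exact ⟨r * α, by simp only [PiLp.smul_apply, smul_eq_mul]; linear_combination r * h1,
    by simp only [PiLp.smul_apply, smul_eq_mul]; linear_combination r * h2⟩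

end SurfaceOfRevolution

theorem norm_mul_eq_inner_of_hasDerivAt {E : Type*} [NormedAddCommGroup E] [InnerProductSpace ℝ E]
    {b : ℝ → E} {w : E} {D s : ℝ} (hb : HasDerivAt b w s)
    (hD : HasDerivAt (fun τ => ‖b τ‖) D s) : ‖b s‖ * D = inner ℝ (b s) w := by
  have h1 := hb.norm_sq
  have h2 := hD.pow 2
  have h3 := h1.unique h2
  push_cast at h3
  linarith

/-! ### Hamiltonian curves as geodesics -/

namespace SurfaceOfRevolution

variable {M : SurfaceOfRevolution}

theorem mem_tangentPlane_of_hasDerivAt {c : ℝ → E3} (hc : ∀ τ, c τ ∈ M.carrier) {v : E3} {s : ℝ}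
    (h : HasDerivAt c v s) : v ∈ M.tangentPlane (c s) := by
  refine ⟨fun τ => c (s + τ), fun τ => hc _, by simp, ?_⟩
  exact HasDerivAt.comp_const_add (a := s) (x := 0) (f := c) (by simpa using h)

/-- Curves in the unit cosphere bundle that are lifts of geodesics: the velocity of the base curve
is the covector, and the acceleration annihilates the velocities of all base curves of curves in
the cotangent bundle. -/
structure IsGeodesicLift (M : SurfaceOfRevolution) (z z' : ℝ → E3 × E3) : Prop where
  mem : ∀ s, z s ∈ M.cotangentBundle
  norm_eq : ∀ s, ‖(z s).2‖ = 1
  hasDerivAt_fst : ∀ s, HasDerivAt (fun τ => (z τ).1) (z s).2 s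
  hasDerivAt_snd : ∀ s, HasDerivAt (fun τ => (z τ).2) (z' s).2 s
  inner_eq_zero : ∀ s, ∀ (b : ℝ → E3 × E3) (w : E3 × E3), (∀ τ, b τ ∈ M.cotangentBundle) →
    b 0 = z s → HasDerivAt b w 0 → inner ℝ (z' s).2 w.1 = 0

/-- Three choices of `w` in Hamilton's equation `ω(X, w) = dp₁(w)` suffice. The velocity `w = X`
gives a constant norm since `ω(X, X) = 0`; vertical `w` identifies the base velocity with the
covector; for general `w` the remaining terms say that the acceleration is normal to the surface. -/
theorem IsHamiltonianCurve.isGeodesicLift {z : ℝ → E3 × E3} (hz : M.IsHamiltonianCurve z)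
    (h0 : p₁ (z 0) = 1) : M.IsGeodesicLift z (deriv z) := by
  have hd : ∀ s, HasDerivAt z (deriv z s) s := fun s => (hz.2 s).1.hasDerivAt
  have hd1 : ∀ s, HasDerivAt (fun τ => (z τ).1) (deriv z s).1 s := fun s =>
    (ContinuousLinearMap.fst ℝ E3 E3).hasFDerivAt.comp_hasDerivAt s (hd s)
  have hd2 : ∀ s, HasDerivAt (fun τ => (z τ).2) (deriv z s).2 s := fun s =>
    (ContinuousLinearMap.snd ℝ E3 E3).hasFDerivAt.comp_hasDerivAt s (hd s)
  have hA : ∀ s (b : ℝ → E3 × E3) (w : E3 × E3), (∀ τ, b τ ∈ M.cotangentBundle) → b 0 = z s →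
      HasDerivAt b w 0 → ‖(z s).2‖ * symplecticForm (deriv z s) w = inner ℝ (z s).2 w.2 := by
    intro s b w hb hb0 hw
    have hw2 : HasDerivAt (fun τ => (b τ).2) w.2 0 :=
      (ContinuousLinearMap.snd ℝ E3 E3).hasFDerivAt.comp_hasDerivAt 0 hw
    have h := norm_mul_eq_inner_of_hasDerivAt hw2 ((hz.2 s).2 b w hb hb0 hw)
    rwa [hb0] at h
  have hnorm : ∀ s, ‖(z s).2‖ = 1 := by
    have hder : ∀ s, HasDerivAt (fun τ => ‖(z τ).2‖) 0 s := by
      intro s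
      have h1 : HasDerivAt (fun τ => z (s + τ)) (deriv z s) 0 :=
        HasDerivAt.comp_const_add (a := s) (x := 0) (f := z) (by simpa using hd s)
      have h2 := (hz.2 s).2 _ _ (fun τ => (hz.1 (s + τ)).1) (by simp) h1
      have h3 : symplecticForm (deriv z s) (deriv z s) = 0 := by
        rw [symplecticForm, real_inner_comm, sub_self]
      rw [h3] at h2
      have h4 := HasDerivAt.comp_add_const (x := s) (a := -s) (f := fun τ => p₁ (z (s + τ)))
        (by simpa using h2)
      simpa [p₁] using h4
    intro s
    have := is_const_of_deriv_eq_zero (fun s => (hder s).differentiableAt)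
      (fun s => (hder s).deriv) s 0
    rw [this]; exact h0
  have hv : ∀ s, (deriv z s).1 = (z s).2 := by
    intro s
    have hmem : (deriv z s).1 ∈ M.tangentPlane (z s).1 :=
      mem_tangentPlane_of_hasDerivAt (fun τ => (hz.1 τ).1.1) (hd1 s)
    have hcar := (hz.1 s).1.1
    set η := (deriv z s).1 + (-1 : ℝ) • (z s).2 with hη
    have hηm : η ∈ M.tangentPlane (z s).1 :=
      add_mem_tangentPlane hcar hmem (smul_mem_tangentPlane hcar (hz.1 s).1.2 _)
    have hb : HasDerivAt (fun τ : ℝ => ((z s).1, (z s).2 + τ • η)) ((0 : E3), η) 0 := by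
      refine (hasDerivAt_const _ _).prodMk ?_
      simpa using ((hasDerivAt_id (0 : ℝ)).smul_const η).const_add (z s).2
    have h1 := hA s (fun τ : ℝ => ((z s).1, (z s).2 + τ • η)) _ (fun τ => ⟨hcar, add_mem_tangentPlane hcar (hz.1 s).1.2
      (smul_mem_tangentPlane hcar hηm τ)⟩) (by simp) hb
    rw [hnorm, one_mul, symplecticForm] at h1
    simp only [inner_zero_right, sub_zero] at h1
    have h2 : inner ℝ η η = 0 := by
      have h3 : inner ℝ η η = inner ℝ ((deriv z s).1 + (-1 : ℝ) • (z s).2) η := rfl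
      rw [h3, inner_add_left, inner_smul_left, h1]
      simp
    have h3 := inner_self_eq_zero.1 h2
    rw [hη] at h3
    have : (deriv z s).1 - (z s).2 = 0 := by rw [← h3]; simp [sub_eq_add_neg]
    exact sub_eq_zero.1 this
  refine ⟨fun s => (hz.1 s).1, hnorm, fun s => hv s ▸ hd1 s, hd2, fun s b w hb hb0 hw => ?_⟩
  have h1 := hA s b w hb hb0 hw
  rw [hnorm, one_mul, symplecticForm, hv] at h1
  linarith

theorem isHamiltonianCurve_of_geodesic {z z' : ℝ → E3 × E3}
    (hmem : ∀ s, z s ∈ M.cotangentBundle) (hnorm : ∀ s, ‖(z s).2‖ = 1)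
    (h1 : ∀ s, HasDerivAt (fun τ => (z τ).1) (z s).2 s)
    (h2 : ∀ s, HasDerivAt (fun τ => (z τ).2) (z' s).2 s)
    (horth : ∀ s, ∀ w ∈ M.tangentPlane (z s).1, inner ℝ (z' s).2 w = 0) :
    M.IsHamiltonianCurve z := by
  refine ⟨fun s => ⟨hmem s, ?_⟩, fun s => ?_⟩
  · rw [← norm_ne_zero_iff, hnorm]; exact one_ne_zero
  have hd : HasDerivAt z ((z s).2, (z' s).2) s := (h1 s).prodMk (h2 s)
  refine ⟨hd.differentiableAt, fun b w hb hb0 hw => ?_⟩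
  have hw1 : HasDerivAt (fun τ => (b τ).1) w.1 0 :=
    (ContinuousLinearMap.fst ℝ E3 E3).hasFDerivAt.comp_hasDerivAt 0 hw
  have hw2 : HasDerivAt (fun τ => (b τ).2) w.2 0 :=
    (ContinuousLinearMap.snd ℝ E3 E3).hasFDerivAt.comp_hasDerivAt 0 hw
  have ht : w.1 ∈ M.tangentPlane (z s).1 := by
    have := mem_tangentPlane_of_hasDerivAt (fun τ => (hb τ).1) hw1
    rwa [hb0] at this
  rw [hd.deriv, symplecticForm, horth s _ ht, sub_zero]
  have hb2 : (b 0).2 ≠ 0 := by rw [hb0, ← norm_ne_zero_iff, hnorm]; exact one_ne_zero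
  have h3 := hw2.norm_sq
  have hpos : ‖(b 0).2‖ ^ 2 ≠ 0 := by simpa using hb2
  have h4 := h3.sqrt hpos
  simp only [Real.sqrt_sq (norm_nonneg _)] at h4
  refine h4.congr_deriv ?_
  rw [hb0, hnorm]
  simp

/-- Rotation about the axis. -/
noncomputable def rot (τ : ℝ) (p : E3) : E3 :=
  !₂[p 0 * Real.cos τ - p 1 * Real.sin τ, p 0 * Real.sin τ + p 1 * Real.cos τ, p 2]

theorem hasDerivAt_rot (p : E3) : HasDerivAt (fun τ => rot τ p) !₂[-p 1, p 0, 0] 0 := by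
  have hs := Real.hasDerivAt_sin 0
  have hc := Real.hasDerivAt_cos 0
  rw [hasDerivAt_E3]
  intro i
  fin_cases i
  · simpa [rot] using (hc.const_mul (p 0)).fun_sub (hs.const_mul (p 1))
  · simpa [rot] using (hs.const_mul (p 0)).fun_add (hc.const_mul (p 1))
  · simpa [rot] using hasDerivAt_const (0 : ℝ) (p 2)

theorem rot_mem_cotangentBundle {a : E3 × E3} (ha : a ∈ M.cotangentBundle) (τ : ℝ) :
    (rot τ a.1, rot τ a.2) ∈ M.cotangentBundle := by
  have e := Real.sin_sq_add_cos_sq τ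
  have hsq : (rot τ a.1) 0 ^ 2 + (rot τ a.1) 1 ^ 2 = M.f (M.profileTime a.1) ^ 2 := by
    rw [← sq_add_sq_eq ha.1]
    simp [rot]
    linear_combination (a.1 0 ^ 2 + a.1 1 ^ 2) * e
  have h2 : (rot τ a.1) 2 = M.g (M.profileTime a.1) := by
    rw [← two_eq ha.1]; simp [rot]
  have hmem := profileTime_mem ha.1
  have hcar : rot τ a.1 ∈ M.carrier := M.mem_carrier_iff.2 ⟨_, hmem, hsq, h2⟩
  refine ⟨hcar, (mem_tangentPlane_iff hcar).2 ?_⟩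
  obtain ⟨α, h3, h4⟩ := exists_of_mem_tangentPlane ha.2
  refine ⟨α, ?_, ?_⟩
  · rw [profileTime_eq hmem hsq h2, ← h3]
    simp [rot]
    linear_combination (a.1 0 * a.2 0 + a.1 1 * a.2 1) * e
  · rw [profileTime_eq hmem hsq h2, ← h4]
    simp [rot]

namespace IsGeodesicLift

variable {z z' : ℝ → E3 × E3} (hz : M.IsGeodesicLift z z')

include hz

/-- Testing against the rotation field; this is the derivative of Clairaut's constant. -/
theorem cross_acceleration (s : ℝ) :
    (z s).1 0 * (z' s).2 1 - (z s).1 1 * (z' s).2 0 = 0 := by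
  have h := hz.inner_eq_zero s (fun τ => (rot τ (z s).1, rot τ (z s).2))
    (!₂[-(z s).1 1, (z s).1 0, 0], !₂[-(z s).2 1, (z s).2 0, 0])
    (fun τ => rot_mem_cotangentBundle (hz.mem s) τ)
    (by
      refine Prod.ext ?_ ?_ <;> ext i <;> fin_cases i <;> simp [rot])
    ((hasDerivAt_rot _).prodMk (hasDerivAt_rot _))
  rw [inner_E3] at h
  simp at h
  linarith

theorem exists_clairaut : ∃ c, ∀ s, (z s).1 0 * (z s).2 1 - (z s).1 1 * (z s).2 0 = c := by
  refine ⟨(z 0).1 0 * (z 0).2 1 - (z 0).1 1 * (z 0).2 0, fun s => ?_⟩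
  have hder : ∀ s, HasDerivAt (fun s => (z s).1 0 * (z s).2 1 - (z s).1 1 * (z s).2 0) 0 s := by
    intro s
    have h1 := hasDerivAt_E3.1 (hz.hasDerivAt_fst s)
    have h2 := hasDerivAt_E3.1 (hz.hasDerivAt_snd s)
    refine (((h1 0).mul (h2 1)).sub ((h1 1).mul (h2 0))).congr_deriv ?_
    linear_combination hz.cross_acceleration s
  exact is_const_of_deriv_eq_zero (fun s => (hder s).differentiableAt)
    (fun s => (hder s).deriv) s 0

/-- Testing against motion along the meridian. To stay in the cotangent bundle, the covector is
carried along with fixed components `α` along the meridian and `β` along the parallel. The factor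
`f` suits the definition of `mom`. -/
theorem meridian_acceleration (s : ℝ) (hpole : M.f (M.profileTime (z s).1) ≠ 0) :
    deriv M.f (M.profileTime (z s).1) * ((z s).1 0 * (z' s).2 0 + (z s).1 1 * (z' s).2 1) +
      M.f (M.profileTime (z s).1) * deriv M.g (M.profileTime (z s).1) * (z' s).2 2 = 0 := by
  have hcar := (hz.mem s).1
  obtain ⟨α, h1, h2⟩ := exists_of_mem_tangentPlane (hz.mem s).2
  have hmem := profileTime_mem hcar
  have hIoo := mem_Ioo_of_f_ne_zero hmem hpole
  obtain ⟨φ, hφ⟩ := M.exists_eq_param hmem (sq_add_sq_eq hcar) (two_eq hcar)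
  set t := M.profileTime (z s).1 with ht
  set β := -((z s).2 0) * Real.sin φ + (z s).2 1 * Real.cos φ with hβ
  obtain ⟨ε, hε, hεI⟩ := exists_add_mul_sin_mem_Ioo hIoo
  set T : ℝ → ℝ := fun τ => t + ε * Real.sin (1 / ε * τ) with hTdef
  have hT : HasDerivAt T 1 0 := hasDerivAt_add_mul_sin hε t 1
  have hT0 : T 0 = t := by simp [hTdef]
  have hx0 : (z s).1 0 = M.f t * Real.cos φ := by rw [hφ]; simp
  have hx1 : (z s).1 1 = M.f t * Real.sin φ := by rw [hφ]; simp
  have e := Real.sin_sq_add_cos_sq φ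
  have h1' : Real.cos φ * (z s).2 0 + Real.sin φ * (z s).2 1 = deriv M.f t * α := by
    refine mul_left_cancel₀ hpole ?_
    rw [hx0, hx1] at h1
    linear_combination h1
  set b : ℝ → E3 × E3 := fun τ => (M.param (T τ) φ,
    !₂[deriv M.f (T τ) * α * Real.cos φ - β * Real.sin φ,
      deriv M.f (T τ) * α * Real.sin φ + β * Real.cos φ, deriv M.g (T τ) * α]) with hb
  have hbmem : ∀ τ, b τ ∈ M.cotangentBundle := by
    intro τ
    have hTm : T τ ∈ Icc M.tmin M.tmax := Ioo_subset_Icc_self (hεI (1 / ε * τ))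
    have hcar := param_mem_carrier hTm φ
    refine ⟨hcar, (mem_tangentPlane_iff hcar).2 ⟨α, ?_, ?_⟩⟩
    · rw [profileTime_param hTm]
      simp [hb]
      linear_combination M.f (T τ) * deriv M.f (T τ) * α * e
    · rw [profileTime_param hTm]
      simp [hb]
  have hb0 : b 0 = z s := by
    refine Prod.ext ?_ ?_
    · simp only [hb, hT0, ← hφ]
    · simp only [hb, hT0]
      ext i
      fin_cases i
      · simp
        linear_combination (z s).2 0 * e - Real.cos φ * h1' - Real.sin φ * hβ
      · simp
        linear_combination (z s).2 1 * e - Real.sin φ * h1' + Real.cos φ * hβ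
      · simpa using h2.symm
  have hderiv : HasDerivAt b (!₂[deriv M.f t * Real.cos φ, deriv M.f t * Real.sin φ, deriv M.g t],
      !₂[deriv (deriv M.f) t * α * Real.cos φ, deriv (deriv M.f) t * α * Real.sin φ,
        deriv (deriv M.g) t * α]) 0 := by
    refine HasDerivAt.prodMk ?_ ?_
    · have h := hasDerivAt_param (M := M) hT (hasDerivAt_const (0 : ℝ) φ)
      simpa [hT0] using h
    · have hf' : HasDerivAt (fun τ => deriv M.f (T τ)) (deriv (deriv M.f) t) 0 := by
        have := HasDerivAt.comp_of_eq (x := (0 : ℝ)) (y := t) (M.hasDerivAt_deriv_f t) hT hT0.symm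
        simpa [Function.comp_def] using this
      have hg' : HasDerivAt (fun τ => deriv M.g (T τ)) (deriv (deriv M.g) t) 0 := by
        have := HasDerivAt.comp_of_eq (x := (0 : ℝ)) (y := t) (M.hasDerivAt_deriv_g t) hT hT0.symm
        simpa [Function.comp_def] using this
      rw [hasDerivAt_E3]
      intro i
      fin_cases i
      · simpa using ((hf'.mul_const α).mul_const (Real.cos φ)).sub_const (β * Real.sin φ)
      · simpa using ((hf'.mul_const α).mul_const (Real.sin φ)).add_const (β * Real.cos φ)
      · simpa using hg'.mul_const α
  have h := hz.inner_eq_zero s b _ hbmem hb0 hderiv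
  rw [inner_E3] at h
  simp at h
  rw [hx0, hx1]
  linear_combination M.f t * h

end IsGeodesicLift

end SurfaceOfRevolution

/-! ### Equations of motion for latitude and its momentum -/

namespace SurfaceOfRevolution

variable {M : SurfaceOfRevolution}

theorem deriv_mul_deriv_deriv_add {t : ℝ} (ht : t ∈ Ioo M.tmin M.tmax) :
    deriv M.f t * deriv (deriv M.f) t + deriv M.g t * deriv (deriv M.g) t = 0 := by
  have h1 := ((M.hasDerivAt_deriv_f t).pow 2).add ((M.hasDerivAt_deriv_g t).pow 2)
  have h2 : HasDerivAt (deriv M.f ^ 2 + deriv M.g ^ 2) 0 t := by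
    refine (hasDerivAt_const t (1 : ℝ)).congr_of_eventuallyEq ?_
    filter_upwards [isOpen_Ioo.mem_nhds ht] with x hx
    exact M.unit_speed x (Ioo_subset_Icc_self hx)
  have h3 := h1.unique h2
  push_cast at h3
  linarith

/-- The profile parameter along a curve of covectors. -/
noncomputable def lat (M : SurfaceOfRevolution) (z : ℝ → E3 × E3) (s : ℝ) : ℝ :=
  M.profileTime (z s).1

/-- The momentum conjugate to the latitude, normalized by `f`. -/
noncomputable def mom (M : SurfaceOfRevolution) (z : ℝ → E3 × E3) (s : ℝ) : ℝ :=
  deriv M.f (M.lat z s) * ((z s).1 0 * (z s).2 0 + (z s).1 1 * (z s).2 1) +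
    M.f (M.lat z s) * deriv M.g (M.lat z s) * (z s).2 2

namespace IsGeodesicLift

variable {z z' : ℝ → E3 × E3} (hz : M.IsGeodesicLift z z')

include hz

theorem lat_mem (s : ℝ) : M.lat z s ∈ Icc M.tmin M.tmax := profileTime_mem (hz.mem s).1

theorem sq_add_sq (s : ℝ) : (z s).1 0 ^ 2 + (z s).1 1 ^ 2 = M.f (M.lat z s) ^ 2 :=
  sq_add_sq_eq (hz.mem s).1

theorem continuous_lat : Continuous (M.lat z) := continuous_iff_continuousAt.2 fun s =>
  continuousAt_profileTime (fun τ => (hz.mem τ).1) (hz.hasDerivAt_fst s).continuousAt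

theorem exists_speed (s : ℝ) : ∃ p,
    (z s).1 0 * (z s).2 0 + (z s).1 1 * (z s).2 1 = M.f (M.lat z s) * deriv M.f (M.lat z s) * p ∧
    (z s).2 2 = deriv M.g (M.lat z s) * p ∧ M.mom z s = M.f (M.lat z s) * p := by
  obtain ⟨p, h1, h2⟩ := exists_of_mem_tangentPlane (hz.mem s).2
  refine ⟨p, h1, h2, ?_⟩
  have h3 := M.unit_speed _ (hz.lat_mem s)
  change _ = M.f (M.lat z s) * deriv M.f (M.lat z s) * p at h1
  change _ = deriv M.g (M.lat z s) * p at h2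
  rw [mom, h1, h2]
  linear_combination M.f (M.lat z s) * p * h3

theorem mom_mul_deriv (s : ℝ) :
    (z s).1 0 * (z s).2 0 + (z s).1 1 * (z s).2 1 = deriv M.f (M.lat z s) * M.mom z s := by
  obtain ⟨p, h1, -, h3⟩ := hz.exists_speed s
  rw [h1, h3]; ring

/-- The unit-speed condition `t'² + c²/f² = 1` in a form that makes sense at the poles. With `u² +
f² = m²` it gives `u² + mom² = m² - c²`. -/
theorem mom_sq_add (s : ℝ) : M.mom z s ^ 2 +
    ((z s).1 0 * (z s).2 1 - (z s).1 1 * (z s).2 0) ^ 2 = M.f (M.lat z s) ^ 2 := by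
  obtain ⟨p, h1, h2, h3⟩ := hz.exists_speed s
  have h4 := M.unit_speed _ (hz.lat_mem s)
  have h5 := hz.sq_add_sq s
  have h6 : (z s).2 0 ^ 2 + (z s).2 1 ^ 2 + (z s).2 2 ^ 2 = 1 := by
    rw [← norm_sq_E3, hz.norm_eq, one_pow]
  rw [h3]
  set F := M.f (M.lat z s)
  set f' := deriv M.f (M.lat z s)
  set g' := deriv M.g (M.lat z s)
  have h7 : ((z s).1 0 * (z s).2 0 + (z s).1 1 * (z s).2 1) ^ 2 = (F * f' * p) ^ 2 := by rw [h1]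
  have h8 : (z s).2 2 ^ 2 = (g' * p) ^ 2 := by rw [h2]
  linear_combination ((z s).2 0 ^ 2 + (z s).2 1 ^ 2) * h5 - h7 + F ^ 2 * h6 - F ^ 2 * h8 -
    F ^ 2 * p ^ 2 * h4

theorem mom_eq_zero_of_pole {s : ℝ} (hs : M.f (M.lat z s) = 0) : M.mom z s = 0 := by
  obtain ⟨p, -, -, h⟩ := hz.exists_speed s
  rw [h, hs, zero_mul]

theorem fst_eq_zero_of_pole {s : ℝ} (hs : M.f (M.lat z s) = 0) :
    (z s).1 0 = 0 ∧ (z s).1 1 = 0 := by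
  have h := hz.sq_add_sq s
  rw [hs] at h
  constructor <;> nlinarith [sq_nonneg ((z s).1 0), sq_nonneg ((z s).1 1)]

theorem hasDerivAt_radial (s : ℝ) :
    HasDerivAt (fun τ => (z τ).1 0 * (z τ).2 0 + (z τ).1 1 * (z τ).2 1)
      ((z s).2 0 ^ 2 + (z s).2 1 ^ 2 + ((z s).1 0 * (z' s).2 0 + (z s).1 1 * (z' s).2 1)) s := by
  have h1 := hasDerivAt_E3.1 (hz.hasDerivAt_fst s)
  have h2 := hasDerivAt_E3.1 (hz.hasDerivAt_snd s)
  refine (((h1 0).mul (h2 0)).add ((h1 1).mul (h2 1))).congr_deriv ?_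
  ring

theorem hasDerivAt_lat {s : ℝ} (hs : M.f (M.lat z s) ≠ 0) :
    HasDerivAt (M.lat z) (M.mom z s / M.f (M.lat z s)) s := by
  obtain ⟨α, h1, h2, h3⟩ := exists_hasDerivAt_profileTime (fun τ => (hz.mem τ).1)
    (hz.hasDerivAt_fst s) (mem_Ioo_of_f_ne_zero (hz.lat_mem s) hs)
  refine h1.congr_deriv ?_
  have h4 := M.unit_speed _ (hz.lat_mem s)
  change _ = M.f (M.lat z s) * deriv M.f (M.lat z s) * α at h2
  change _ = deriv M.g (M.lat z s) * α at h3
  rw [mom, h2, h3, eq_div_iff hs]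
  linear_combination -M.f (M.lat z s) * α * h4

/-- Off the poles this is `(f t')' = f'`, from the normality of the acceleration and unit speed. At
a pole `t` need not be differentiable, but the radial quantity equals `f' * mom` and has derivative
`1`; dividing by `f' = ±1` in the difference quotient gives the claim. -/
theorem hasDerivAt_mom (s : ℝ) : HasDerivAt (M.mom z) (deriv M.f (M.lat z s)) s := by
  by_cases hs : M.f (M.lat z s) = 0
  · obtain ⟨hx0, hx1⟩ := hz.fst_eq_zero_of_pole hs
    have hW0 := hz.mom_eq_zero_of_pole hs
    have hsq := deriv_f_sq_of_pole (hz.lat_mem s) hs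
    have hne : deriv M.f (M.lat z s) ≠ 0 := by
      intro h0; rw [h0] at hsq; norm_num at hsq
    obtain ⟨p, -, h2, -⟩ := hz.exists_speed s
    rw [deriv_g_of_pole (hz.lat_mem s) hs, zero_mul] at h2
    have h6 : (z s).2 0 ^ 2 + (z s).2 1 ^ 2 + (z s).2 2 ^ 2 = 1 := by
      rw [← norm_sq_E3, hz.norm_eq, one_pow]
    have hq := hz.hasDerivAt_radial s
    rw [hx0, hx1] at hq
    have hval : (z s).2 0 ^ 2 + (z s).2 1 ^ 2 + (0 * (z' s).2 0 + 0 * (z' s).2 1) = 1 := by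
      rw [h2] at h6; linear_combination h6
    rw [hval, hasDerivAt_iff_tendsto_slope] at hq
    rw [hasDerivAt_iff_tendsto_slope]
    have hcont : ContinuousAt (fun τ => deriv M.f (M.lat z τ)) s :=
      (M.contDiff_deriv_f.continuous.comp hz.continuous_lat).continuousAt
    have hlim := hq.div (hcont.tendsto.mono_left (nhdsWithin_le_nhds (s := {s}ᶜ))) hne
    have e : 1 / deriv M.f (M.lat z s) = deriv M.f (M.lat z s) := by
      rw [div_eq_iff hne, ← sq, hsq]
    rw [e] at hlim
    refine hlim.congr' ?_
    filter_upwards [nhdsWithin_le_nhds (hcont.eventually_ne hne)] with τ hτ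
    simp only [Pi.div_apply, slope_def_field, hW0, hx0, hx1, zero_mul, add_zero, sub_zero]
    rw [hz.mom_mul_deriv τ]
    field_simp
  · have hIoo := mem_Ioo_of_f_ne_zero (hz.lat_mem s) hs
    have hlat := hz.hasDerivAt_lat hs
    obtain ⟨p, h1, h2, h3⟩ := hz.exists_speed s
    rw [h3, mul_div_cancel_left₀ _ hs] at hlat
    have hq := hz.hasDerivAt_radial s
    have hf := (M.hasDerivAt_f (M.lat z s)).comp s hlat
    have hf' := (M.hasDerivAt_deriv_f (M.lat z s)).comp s hlat
    have hg' := (M.hasDerivAt_deriv_g (M.lat z s)).comp s hlat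
    have hv2 := hasDerivAt_E3.1 (hz.hasDerivAt_snd s) 2
    have h := (hf'.mul hq).add ((hf.mul hg').mul hv2)
    refine h.congr_deriv ?_
    have h6 : (z s).2 0 ^ 2 + (z s).2 1 ^ 2 + (z s).2 2 ^ 2 = 1 := by
      rw [← norm_sq_E3, hz.norm_eq, one_pow]
    have h7 := deriv_mul_deriv_deriv_add hIoo
    have h8 : deriv M.f (M.lat z s) * ((z s).1 0 * (z' s).2 0 + (z s).1 1 * (z' s).2 1) +
        M.f (M.lat z s) * deriv M.g (M.lat z s) * (z' s).2 2 = 0 := hz.meridian_acceleration s hs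
    simp only [Function.comp_apply, Pi.mul_apply]
    rw [h1]
    rw [h2] at h6 ⊢
    linear_combination h8 + deriv M.f (M.lat z s) * h6 + M.f (M.lat z s) * p ^ 2 * h7

/-- At a pole `u²` is a polynomial in the coordinates with derivative zero along the curve, and `u ≠
0`, so a square root may be taken. With `hasDerivAt_mom` and `f' = -u k` this shows that `(u, mom)`
rotates with angular speed `k`. -/
theorem hasDerivAt_latitude (L : M.Latitude) (s : ℝ) :
    HasDerivAt (fun τ => L.u (M.lat z τ)) (M.mom z s * L.k (M.lat z s)) s := by
  by_cases hs : M.f (M.lat z s) = 0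
  · obtain ⟨hx0, hx1⟩ := hz.fst_eq_zero_of_pole hs
    rw [hz.mom_eq_zero_of_pole hs, zero_mul]
    have hsq : ∀ τ, L.u (M.lat z τ) ^ 2 = M.radius ^ 2 - ((z τ).1 0 ^ 2 + (z τ).1 1 ^ 2) := by
      intro τ
      rw [hz.sq_add_sq, ← L.sq_add_sq _ (hz.lat_mem τ)]; ring
    have hcont : ContinuousAt (fun τ => L.u (M.lat z τ)) s :=
      (L.u_an.continuousOn.comp_continuous hz.continuous_lat hz.lat_mem).continuousAt
    have hd := (hasDerivAt_sq_add_sq (hz.hasDerivAt_fst s)).const_sub (M.radius ^ 2)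
    simp only [hx0, hx1, zero_mul, add_zero, mul_zero, neg_zero, ← hsq] at hd
    have hu : L.u (M.lat z s) ≠ 0 := by
      intro h0
      have := L.sq_add_sq _ (hz.lat_mem s)
      rw [h0, hs] at this
      nlinarith [M.radius_pos]
    have hsqrt := hd.sqrt (by simpa using hu)
    simp only [Real.sqrt_sq_eq_abs, zero_div] at hsqrt
    rcases lt_or_gt_of_ne hu with h | h
    · refine (neg_zero (G := ℝ) ▸ hsqrt.neg).congr_of_eventuallyEq ?_
      filter_upwards [hcont.eventually_lt continuousAt_const h] with τ hτ
      simp [abs_of_neg hτ]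
    · refine hsqrt.congr_of_eventuallyEq ?_
      filter_upwards [continuousAt_const.eventually_lt hcont h] with τ hτ
      simp [abs_of_pos hτ]
  · refine ((L.hasDerivAt_u _ (hz.lat_mem s)).comp s (hz.hasDerivAt_lat hs)).congr_deriv ?_
    field_simp

end IsGeodesicLift

end SurfaceOfRevolution

/-! ### Phase, elapsed time and longitude -/

namespace SurfaceOfRevolution

variable {M : SurfaceOfRevolution}

namespace Latitude

variable (L : M.Latitude)

/-- The time a geodesic of latitude amplitude `a` takes to reach the phase `y`. -/
noncomputable def phaseTime (a y : ℝ) : ℝ := ∫ x in 0..y, L.F (a * Real.sin x)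

/-- The longitude per unit of angular momentum gained up to the phase `y`. -/
noncomputable def angle (a y : ℝ) : ℝ :=
  ∫ x in 0..y, L.F (a * Real.sin x) / (M.radius ^ 2 - (a * Real.sin x) ^ 2)

theorem continuous_F_mul_sin (a : ℝ) : Continuous fun x => L.F (a * Real.sin x) :=
  L.continuous_F.comp (by fun_prop)

theorem hasDerivAt_phaseTime (a y : ℝ) :
    HasDerivAt (L.phaseTime a) (L.F (a * Real.sin y)) y :=
  hasDerivAt_primitive (L.continuous_F_mul_sin a) y

theorem strictMono_phaseTime (a : ℝ) : StrictMono (L.phaseTime a) :=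
  strictMono_primitive (L.continuous_F_mul_sin a) fun _ => L.F_pos _

theorem surjective_phaseTime (a : ℝ) : Function.Surjective (L.phaseTime a) :=
  surjective_primitive (T := 2 * Real.pi) (L.continuous_F_mul_sin a) (fun x => by simp)
    Real.two_pi_pos fun _ => L.F_pos _

@[simp] theorem phaseTime_zero (a : ℝ) : L.phaseTime a 0 = 0 := by simp [phaseTime]

@[simp] theorem angle_zero (a : ℝ) : L.angle a 0 = 0 := by simp [angle]

theorem phaseTime_add (a y : ℝ) (n : ℤ) :
    L.phaseTime a (y + n * (2 * Real.pi)) = L.phaseTime a y + n * L.phaseTime a (2 * Real.pi) :=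
  primitive_add_int_mul_period (L.continuous_F_mul_sin a) (fun x => by simp) y n

theorem hasDerivAt_angle {a : ℝ} (ha : a ∈ Ioo (-M.radius) M.radius) (y : ℝ) :
    HasDerivAt (L.angle a)
      (L.F (a * Real.sin y) / (M.radius ^ 2 - (a * Real.sin y) ^ 2)) y :=
  hasDerivAt_primitive (continuous_div_sq_sub_sq L.continuous_F ha) y

theorem angle_add {a : ℝ} (ha : a ∈ Ioo (-M.radius) M.radius) (y : ℝ) (n : ℤ) :
    L.angle a (y + n * (2 * Real.pi)) =
      L.angle a y + n * rotationIntegral L.F M.radius a :=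
  primitive_add_int_mul_period (continuous_div_sq_sub_sq L.continuous_F ha) (fun x => by simp) y n

theorem F_mul_k {t : ℝ} (ht : t ∈ Icc M.tmin M.tmax) : L.F (L.u t) * L.k t = 1 := by
  rw [L.F_u ht, inv_mul_cancel₀ (L.k_pos t ht).ne']

end Latitude

theorem amplitude_mem_Ioo {a c : ℝ} (hac : a ^ 2 + c ^ 2 = M.radius ^ 2) (hc : c ≠ 0) :
    a ∈ Ioo (-M.radius) M.radius := by
  have : 0 < c ^ 2 := by positivity
  exact abs_lt.1 (abs_lt_of_sq_lt_sq (by linarith) M.radius_pos.le)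

namespace IsGeodesicLift

variable {z z' : ℝ → E3 × E3} (hz : M.IsGeodesicLift z z') (L : M.Latitude)

include hz

theorem exists_phase {a y₀ : ℝ} (h0 : L.u (M.lat z 0) = a * Real.sin y₀)
    (h1 : M.mom z 0 = a * Real.cos y₀) :
    ∃ ψ : ℝ → ℝ, ψ 0 = y₀ ∧ (∀ s, HasDerivAt ψ (L.k (M.lat z s)) s) ∧
      (∀ s, L.u (M.lat z s) = a * Real.sin (ψ s)) ∧ (∀ s, M.mom z s = a * Real.cos (ψ s)) ∧
      ∀ s, L.phaseTime a (ψ s) = s + L.phaseTime a y₀ := by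
  have hk : Continuous fun s => L.k (M.lat z s) :=
    L.k_an.continuousOn.comp_continuous hz.continuous_lat hz.lat_mem
  set ψ : ℝ → ℝ := fun s => y₀ + ∫ x in 0..s, L.k (M.lat z x) with hψ
  have hψ0 : ψ 0 = y₀ := by simp [hψ]
  have hψ' : ∀ s, HasDerivAt ψ (L.k (M.lat z s)) s := fun s =>
    (hasDerivAt_primitive hk s).const_add y₀
  -- `(u, mom)` and `(a sin ψ, a cos ψ)` solve the same rotation equation from the same initial
  -- point, and rotations preserve the squared distance `D`.
  set D : ℝ → ℝ := fun s => (L.u (M.lat z s) - a * Real.sin (ψ s)) ^ 2 +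
    (M.mom z s - a * Real.cos (ψ s)) ^ 2 with hD
  have hD' : ∀ s, HasDerivAt D 0 s := by
    intro s
    have e1 := (hz.hasDerivAt_latitude L s).sub ((hψ' s).sin.const_mul a)
    have e2 := (hz.hasDerivAt_mom s).sub ((hψ' s).cos.const_mul a)
    refine ((e1.pow 2).add (e2.pow 2)).congr_deriv ?_
    rw [L.deriv_f _ (hz.lat_mem s)]
    simp only [Pi.sub_apply]
    push_cast; ring
  have hD0 : ∀ s, D s = 0 := by
    intro s
    rw [is_const_of_deriv_eq_zero (fun s => (hD' s).differentiableAt) (fun s => (hD' s).deriv) s 0]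
    simp [hD, hψ0, h0, h1]
  have hU : ∀ s, L.u (M.lat z s) = a * Real.sin (ψ s) := by
    intro s
    have h := hD0 s
    simp only [hD] at h
    nlinarith [sq_nonneg (L.u (M.lat z s) - a * Real.sin (ψ s)),
      sq_nonneg (M.mom z s - a * Real.cos (ψ s))]
  have hW : ∀ s, M.mom z s = a * Real.cos (ψ s) := by
    intro s
    have h := hD0 s
    simp only [hD] at h
    nlinarith [sq_nonneg (L.u (M.lat z s) - a * Real.sin (ψ s)),
      sq_nonneg (M.mom z s - a * Real.cos (ψ s))]
  refine ⟨ψ, hψ0, hψ', hU, hW, fun s => ?_⟩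
  have hS : ∀ s, HasDerivAt (fun s => L.phaseTime a (ψ s) - s) 0 s := by
    intro s
    refine (((L.hasDerivAt_phaseTime a (ψ s)).comp s (hψ' s)).sub (hasDerivAt_id s)).congr_deriv ?_
    rw [← hU, L.F_mul_k (hz.lat_mem s), sub_self]
  have h := is_const_of_deriv_eq_zero (fun s => (hS s).differentiableAt) (fun s => (hS s).deriv) s 0
  simp only [hψ0, sub_zero] at h
  linarith

theorem f_ne_zero {c : ℝ} (hc : ∀ s, (z s).1 0 * (z s).2 1 - (z s).1 1 * (z s).2 0 = c)
    (hc0 : c ≠ 0) (s : ℝ) : M.f (M.lat z s) ≠ 0 := by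
  intro h
  have h1 := hz.mom_sq_add s
  rw [hc, h] at h1
  have : 0 < c ^ 2 := by positivity
  nlinarith [sq_nonneg (M.mom z s)]

/-- The horizontal unit vector `(x, y)/f`, rotated back by the accumulated longitude, has zero
derivative. This avoids choosing a continuous longitude along the geodesic. -/
theorem fst_eq_rotation {a : ℝ} {ψ : ℝ → ℝ} (hψ : ∀ s, HasDerivAt ψ (L.k (M.lat z s)) s)
    (hU : ∀ s, L.u (M.lat z s) = a * Real.sin (ψ s)) {c : ℝ}
    (hc : ∀ s, (z s).1 0 * (z s).2 1 - (z s).1 1 * (z s).2 0 = c) (hc0 : c ≠ 0)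
    (ha : a ∈ Ioo (-M.radius) M.radius) (s : ℝ) :
    (z s).1 0 / M.f (M.lat z s) =
      ((z 0).1 0 * Real.cos (c * (L.angle a (ψ s) - L.angle a (ψ 0))) -
        (z 0).1 1 * Real.sin (c * (L.angle a (ψ s) - L.angle a (ψ 0)))) / M.f (M.lat z 0) ∧
    (z s).1 1 / M.f (M.lat z s) =
      ((z 0).1 0 * Real.sin (c * (L.angle a (ψ s) - L.angle a (ψ 0))) +
        (z 0).1 1 * Real.cos (c * (L.angle a (ψ s) - L.angle a (ψ 0)))) / M.f (M.lat z 0) := by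
  set φ : ℝ → ℝ := fun s => c * (L.angle a (ψ s) - L.angle a (ψ 0)) with hφ
  have hf0 := hz.f_ne_zero hc hc0
  have hφ0 : φ 0 = 0 := by simp [hφ]
  have hφ' : ∀ s, HasDerivAt φ (c / M.f (M.lat z s) ^ 2) s := by
    intro s
    refine ((((L.hasDerivAt_angle ha (ψ s)).comp s (hψ s)).sub_const _).const_mul c).congr_deriv ?_
    have h1 := L.sq_add_sq _ (hz.lat_mem s)
    have h2 := L.F_mul_k (hz.lat_mem s)
    rw [← hU]
    have h3 : M.radius ^ 2 - L.u (M.lat z s) ^ 2 = M.f (M.lat z s) ^ 2 := by linarith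
    rw [h3, div_mul_eq_mul_div, h2, mul_one_div]
  have hv : ∀ s, (z s).2 0 * M.f (M.lat z s) ^ 2 =
      (z s).1 0 * (deriv M.f (M.lat z s) * M.mom z s) - (z s).1 1 * c ∧
      (z s).2 1 * M.f (M.lat z s) ^ 2 =
      (z s).1 1 * (deriv M.f (M.lat z s) * M.mom z s) + (z s).1 0 * c := by
    intro s
    rw [← hz.mom_mul_deriv s, ← hz.sq_add_sq s, ← hc s]
    constructor <;> ring
  have hfl : ∀ s, HasDerivAt (fun τ => M.f (M.lat z τ))
      (deriv M.f (M.lat z s) * (M.mom z s / M.f (M.lat z s))) s := fun s =>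
    (M.hasDerivAt_f _).comp s (hz.hasDerivAt_lat (hf0 s))
  have hA : ∀ s, HasDerivAt (fun s => ((z s).1 0 * Real.cos (φ s) + (z s).1 1 * Real.sin (φ s)) /
      M.f (M.lat z s)) 0 s := by
    intro s
    have h1 := hasDerivAt_E3.1 (hz.hasDerivAt_fst s)
    refine ((((h1 0).mul (hφ' s).cos).add ((h1 1).mul (hφ' s).sin)).div (hfl s)
      (hf0 s)).congr_deriv ?_
    obtain ⟨e1, e2⟩ := hv s
    have hne := hf0 s
    have e1' := (eq_div_iff (pow_ne_zero 2 hne)).2 e1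
    have e2' := (eq_div_iff (pow_ne_zero 2 hne)).2 e2
    rw [e1', e2']
    simp only [Pi.add_apply, Pi.mul_apply]
    field_simp
    ring
  have hB : ∀ s, HasDerivAt (fun s => (-((z s).1 0) * Real.sin (φ s) + (z s).1 1 * Real.cos (φ s)) /
      M.f (M.lat z s)) 0 s := by
    intro s
    have h1 := hasDerivAt_E3.1 (hz.hasDerivAt_fst s)
    refine ((((h1 0).neg.mul (hφ' s).sin).add ((h1 1).mul (hφ' s).cos)).div (hfl s)
      (hf0 s)).congr_deriv ?_
    obtain ⟨e1, e2⟩ := hv s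
    have hne := hf0 s
    have e1' := (eq_div_iff (pow_ne_zero 2 hne)).2 e1
    have e2' := (eq_div_iff (pow_ne_zero 2 hne)).2 e2
    rw [e1', e2']
    simp only [Pi.add_apply, Pi.mul_apply, Pi.neg_apply]
    field_simp
    ring
  have hA0 := is_const_of_deriv_eq_zero (fun s => (hA s).differentiableAt)
    (fun s => (hA s).deriv) s 0
  have hB0 := is_const_of_deriv_eq_zero (fun s => (hB s).differentiableAt)
    (fun s => (hB s).deriv) s 0
  simp only [hφ0, Real.cos_zero, Real.sin_zero, mul_one, mul_zero, add_zero, zero_add] at hA0 hB0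
  have e := Real.sin_sq_add_cos_sq (φ s)
  constructor
  · linear_combination Real.cos (φ s) * hA0 - Real.sin (φ s) * hB0 -
      (z s).1 0 / M.f (M.lat z s) * e
  · linear_combination Real.sin (φ s) * hA0 + Real.cos (φ s) * hB0 -
      (z s).1 1 / M.f (M.lat z s) * e

theorem exists_int_of_fst_eq {a : ℝ} {ψ : ℝ → ℝ} (hψ : ∀ s, HasDerivAt ψ (L.k (M.lat z s)) s)
    (hU : ∀ s, L.u (M.lat z s) = a * Real.sin (ψ s)) {c : ℝ}
    (hc : ∀ s, (z s).1 0 * (z s).2 1 - (z s).1 1 * (z s).2 0 = c) (hc0 : c ≠ 0)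
    (ha : a ∈ Ioo (-M.radius) M.radius) {s : ℝ} (hs : (z s).1 = (z 0).1) :
    ∃ n : ℤ, c * (L.angle a (ψ s) - L.angle a (ψ 0)) = n * (2 * Real.pi) := by
  obtain ⟨h1, h2⟩ := hz.fst_eq_rotation L hψ hU hc hc0 ha s
  have hlat : M.lat z s = M.lat z 0 := by rw [lat, lat, hs]
  have hf0 := hz.f_ne_zero hc hc0 0
  rw [hs, hlat, div_left_inj' hf0] at h1 h2
  have h3 := hz.sq_add_sq 0
  set φ := c * (L.angle a (ψ s) - L.angle a (ψ 0))
  have h4 : M.f (M.lat z 0) ^ 2 * Real.cos φ = M.f (M.lat z 0) ^ 2 * 1 := by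
    rw [← h3]
    linear_combination -(z 0).1 0 * h1 - (z 0).1 1 * h2
  have h5 := mul_left_cancel₀ (pow_ne_zero 2 hf0) h4
  obtain ⟨n, hn⟩ := (Real.cos_eq_one_iff _).1 h5
  exact ⟨n, hn.symm⟩

/-- Meridians lie in a fixed plane through the axis. -/
theorem exists_fst_eq_mul_mom {a : ℝ} {ψ : ℝ → ℝ}
    (hψ : ∀ s, HasDerivAt ψ (L.k (M.lat z s)) s) (hW : ∀ s, M.mom z s = a * Real.cos (ψ s))
    (ha : a ≠ 0) (hc : ∀ s, (z s).1 0 * (z s).2 1 - (z s).1 1 * (z s).2 0 = 0) (i : Fin 3)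
    (hi : i = 0 ∨ i = 1) : ∃ κ, ∀ s, (z s).1 i = κ * M.mom z s := by
  have hWsq : ∀ s, M.mom z s ^ 2 = M.f (M.lat z s) ^ 2 := by
    intro s
    have := hz.mom_sq_add s
    rw [hc] at this
    linarith
  have hrel : ∀ s, (z s).2 i * M.mom z s = (z s).1 i * deriv M.f (M.lat z s) := by
    intro s
    by_cases h : M.mom z s = 0
    · have h0 : M.f (M.lat z s) = 0 := by
        have := hWsq s
        rw [h] at this
        exact pow_eq_zero_iff two_ne_zero |>.1 (by linarith)
      obtain ⟨hx0, hx1⟩ := hz.fst_eq_zero_of_pole h0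
      rcases hi with rfl | rfl
      · rw [h, hx0, mul_zero, zero_mul]
      · rw [h, hx1, mul_zero, zero_mul]
    · refine mul_right_cancel₀ h ?_
      have e1 := hz.mom_mul_deriv s
      have e2 := hz.sq_add_sq s
      have e3 := hc s
      have e4 := hWsq s
      rcases hi with rfl | rfl
      · linear_combination (z s).2 0 * e4 - (z s).2 0 * e2 + (z s).1 0 * e1 - (z s).1 1 * e3
      · linear_combination (z s).2 1 * e4 - (z s).2 1 * e2 + (z s).1 1 * e1 + (z s).1 0 * e3
  have hden : ∀ s, M.mom z s ^ 2 + deriv M.f (M.lat z s) ^ 2 ≠ 0 := by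
    intro s h
    have h1 : M.mom z s ^ 2 = 0 := by
      nlinarith [sq_nonneg (M.mom z s), sq_nonneg (deriv M.f (M.lat z s))]
    have h2 : deriv M.f (M.lat z s) ^ 2 = 0 := by linarith
    rw [hWsq] at h1
    rw [deriv_f_sq_of_pole (hz.lat_mem s) (pow_eq_zero_iff two_ne_zero |>.1 h1)] at h2
    exact one_ne_zero h2
  -- The ratio `x_i / mom` is undefined at the poles. Since `v_i * mom = x_i * f'`, this expression
  -- agrees with it elsewhere and is continuous throughout: `f' = ±1` wherever `mom = 0`. Its
  -- derivative is zero off the countable set of pole passages, so it is constant.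
  set κ : ℝ → ℝ := fun s => ((z s).1 i * M.mom z s + deriv M.f (M.lat z s) * (z s).2 i) /
    (M.mom z s ^ 2 + deriv M.f (M.lat z s) ^ 2) with hκ
  have hκW : ∀ s, (z s).1 i = κ s * M.mom z s := by
    intro s
    simp only [hκ]
    rw [div_mul_eq_mul_div, eq_div_iff (hden s)]
    linear_combination -deriv M.f (M.lat z s) * hrel s
  have hcont : Continuous κ := by
    have c1 : Continuous fun s => (z s).1 i := continuous_iff_continuousAt.2 fun s =>
      (hasDerivAt_E3.1 (hz.hasDerivAt_fst s) i).continuousAt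
    have c2 : Continuous fun s => (z s).2 i := continuous_iff_continuousAt.2 fun s =>
      (hasDerivAt_E3.1 (hz.hasDerivAt_snd s) i).continuousAt
    have c3 : Continuous (M.mom z) := continuous_iff_continuousAt.2 fun s =>
      (hz.hasDerivAt_mom s).continuousAt
    have c4 : Continuous fun s => deriv M.f (M.lat z s) :=
      M.contDiff_deriv_f.continuous.comp hz.continuous_lat
    exact ((c1.mul c3).add (c4.mul c2)).div ((c3.pow 2).add (c4.pow 2)) hden
  have hmono : StrictMono ψ := by
    refine strictMono_of_deriv_pos fun s => ?_
    rw [(hψ s).deriv]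
    exact L.k_pos _ (hz.lat_mem s)
  have hcount : {s | M.mom z s = 0}.Countable := by
    have h1 : (range fun k : ℤ => (2 * (k : ℝ) + 1) * Real.pi / 2).Countable := countable_range _
    refine (h1.preimage_of_injOn (f := ψ) hmono.injective.injOn).mono fun s hs => ?_
    have hs' : M.mom z s = 0 := hs
    rw [hW] at hs'
    obtain ⟨k, hk⟩ := Real.cos_eq_zero_iff.1 ((mul_eq_zero.1 hs').resolve_left ha)
    exact ⟨k, hk.symm⟩
  have hder : ∀ s, M.mom z s ≠ 0 → HasDerivAt κ 0 s := by
    intro s hs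
    have h1 := (hasDerivAt_E3.1 (hz.hasDerivAt_fst s) i).div (hz.hasDerivAt_mom s) hs
    have h2 := h1.congr_deriv (g' := 0) (by rw [hrel, sub_self, zero_div])
    refine h2.congr_of_eventuallyEq ?_
    filter_upwards [(hz.hasDerivAt_mom s).continuousAt.eventually_ne hs] with τ hτ
    simp only [Pi.div_apply]
    rw [hκW τ, mul_div_cancel_right₀ _ hτ]
  refine ⟨κ 0, fun s => ?_⟩
  have h := MeasureTheory.integral_eq_of_hasDerivAt_off_countable κ (fun _ => (0 : ℝ)) (a := 0)
    (b := s) hcount hcont.continuousOn (fun x hx => hder x hx.2) (by simp)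
  rw [intervalIntegral.integral_zero] at h
  rw [hκW s]
  congr 1
  linarith

end IsGeodesicLift

end SurfaceOfRevolution

/-! ### Constant rotation implies Zoll -/

namespace SurfaceOfRevolution

variable {M : SurfaceOfRevolution}

namespace IsGeodesicLift

variable {z z' : ℝ → E3 × E3} (hz : M.IsGeodesicLift z z') (L : M.Latitude)

include hz

theorem exists_amplitude_phase {c : ℝ}
    (hc : ∀ s, (z s).1 0 * (z s).2 1 - (z s).1 1 * (z s).2 0 = c) :
    ∃ a y₀, a ^ 2 + c ^ 2 = M.radius ^ 2 ∧ L.u (M.lat z 0) = a * Real.sin y₀ ∧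
      M.mom z 0 = a * Real.cos y₀ := by
  have h1 := hz.mom_sq_add 0
  have h2 := L.sq_add_sq _ (hz.lat_mem 0)
  rw [hc] at h1
  have h3 : M.mom z 0 ^ 2 + L.u (M.lat z 0) ^ 2 = √(M.radius ^ 2 - c ^ 2) ^ 2 := by
    rw [Real.sq_sqrt (by nlinarith [sq_nonneg (M.mom z 0), sq_nonneg (L.u (M.lat z 0))])]
    linarith
  obtain ⟨y₀, h4, h5⟩ := exists_eq_mul_cos_sin (Real.sqrt_nonneg _) h3
  exact ⟨_, y₀, by rw [← h3]; linarith, h5, h4⟩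

theorem periodic_of_fst_periodic {T : ℝ} (h : ∀ s, (z (s + T)).1 = (z s).1) :
    Function.Periodic z T := by
  intro s
  refine Prod.ext (h s) ?_
  have h1 : HasDerivAt (fun τ => (z (τ + T)).1) (z (s + T)).2 s :=
    HasDerivAt.comp_add_const (f := fun τ => (z τ).1) s T (hz.hasDerivAt_fst (s + T))
  have h2 : (fun τ => (z (τ + T)).1) = fun τ => (z τ).1 := funext h
  rw [h2] at h1
  exact h1.unique (hz.hasDerivAt_fst s)

theorem lat_eq_inv (s : ℝ) : M.lat z s = L.inv (L.u (M.lat z s)) := (L.inv_u (hz.lat_mem s)).symm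

theorem fst_two (s : ℝ) : (z s).1 2 = M.g (M.lat z s) := two_eq (hz.mem s).1

end IsGeodesicLift

theorem exists_int_of_sin_eq_of_cos_eq {x y : ℝ} (hs : Real.sin x = Real.sin y)
    (hc : Real.cos x = Real.cos y) : ∃ n : ℤ, x = y + n * (2 * Real.pi) := by
  have h : Real.cos (x - y) = 1 := by
    rw [Real.cos_sub, hs, hc]
    linear_combination Real.sin_sq_add_cos_sq y
  obtain ⟨n, hn⟩ := (Real.cos_eq_one_iff _).1 h
  exact ⟨n, by linarith⟩

/-- If the rotation function is constant then all geodesics are closed with the same length. -/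
theorem isZoll_of_forall_rotationIntegral_eq (L : M.Latitude) {C : ℝ}
    (hC : ∀ a ∈ Ioo (-M.radius) M.radius,
      √(M.radius ^ 2 - a ^ 2) * rotationIntegral L.F M.radius a = C) : M.IsZoll := by
  have hm := M.radius_pos
  have hpi := Real.pi_pos
  have hsymm := add_comp_neg_eq_of_forall_rotationIntegral_eq L.continuous_F hm L.analyticOnNhd_F
    L.F_radius L.F_neg_radius hC
  obtain rfl := eq_two_pi_of_forall_rotationIntegral_eq L.continuous_F hm
    L.F_radius L.F_neg_radius hC
  refine ⟨2 * Real.pi * M.radius, by positivity, fun z hH hz0 => ?_⟩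
  have hz := hH.isGeodesicLift hz0
  obtain ⟨c, hc⟩ := hz.exists_clairaut
  obtain ⟨a, y₀, hac, hU0, hW0⟩ := hz.exists_amplitude_phase L hc
  obtain ⟨ψ, hψ0, hψ, hU, hW, hS⟩ := hz.exists_phase L hU0 hW0
  have ham : |a| ≤ M.radius := abs_le_of_sq_le_sq (by nlinarith [sq_nonneg c]) hm.le
  have hT : L.phaseTime a (2 * Real.pi) = 2 * Real.pi * M.radius :=
    integral_comp_mul_sin_of_add_comp_neg_eq L.continuous_F hsymm ham
  have hrot : c ≠ 0 → |c| * rotationIntegral L.F M.radius a = 2 * Real.pi := by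
    intro hc0
    have := hC a (amplitude_mem_Ioo hac hc0)
    rwa [← hac, add_sub_cancel_left, Real.sqrt_sq_eq_abs] at this
  constructor
  · have hψT : ∀ s, ψ (s + 2 * Real.pi * M.radius) = ψ s + 2 * Real.pi := by
      intro s
      refine (L.strictMono_phaseTime a).injective ?_
      have := L.phaseTime_add a (ψ s) 1
      rw [Int.cast_one, one_mul, one_mul] at this
      rw [this, hS, hS, hT]; ring
    have hlatT : ∀ s, M.lat z (s + 2 * Real.pi * M.radius) = M.lat z s := by
      intro s
      rw [hz.lat_eq_inv L, hz.lat_eq_inv L s, hU, hU, hψT, Real.sin_add_two_pi]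
    refine hz.periodic_of_fst_periodic fun s => ?_
    have h2 : (z (s + 2 * Real.pi * M.radius)).1 2 = (z s).1 2 := by
      rw [hz.fst_two, hz.fst_two, hlatT]
    have h01 : (z (s + 2 * Real.pi * M.radius)).1 0 = (z s).1 0 ∧
        (z (s + 2 * Real.pi * M.radius)).1 1 = (z s).1 1 := by
      -- Meridians pass through the poles, where longitude is undefined; their horizontal position
      -- is a fixed multiple of `mom`, which repeats with the phase. Otherwise the longitude
      -- advances by `±2π`.
      by_cases hc0 : c = 0
      · subst hc0
        have ha0 : a ≠ 0 := by rintro rfl; nlinarith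
        have hWT : M.mom z (s + 2 * Real.pi * M.radius) = M.mom z s := by
          rw [hW, hW, hψT, Real.cos_add_two_pi]
        constructor
        · obtain ⟨κ, hκ⟩ := hz.exists_fst_eq_mul_mom L hψ hW ha0 hc 0 (Or.inl rfl)
          rw [hκ, hκ, hWT]
        · obtain ⟨κ, hκ⟩ := hz.exists_fst_eq_mul_mom L hψ hW ha0 hc 1 (Or.inr rfl)
          rw [hκ, hκ, hWT]
      · have ha := amplitude_mem_Ioo hac hc0
        obtain ⟨e1, e2⟩ := hz.fst_eq_rotation L hψ hU hc hc0 ha s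
        obtain ⟨e3, e4⟩ := hz.fst_eq_rotation L hψ hU hc hc0 ha (s + 2 * Real.pi * M.radius)
        have hang := L.angle_add ha (ψ s) 1
        rw [Int.cast_one, one_mul, one_mul] at hang
        have hr := hrot hc0
        have hsc : Real.sin (c * (L.angle a (ψ (s + 2 * Real.pi * M.radius)) - L.angle a (ψ 0))) =
              Real.sin (c * (L.angle a (ψ s) - L.angle a (ψ 0))) ∧
            Real.cos (c * (L.angle a (ψ (s + 2 * Real.pi * M.radius)) - L.angle a (ψ 0))) =
              Real.cos (c * (L.angle a (ψ s) - L.angle a (ψ 0))) := by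
          rw [hψT, hang]
          rcases abs_cases c with ⟨h, -⟩ | ⟨h, -⟩ <;> rw [h] at hr
          · have : c * (L.angle a (ψ s) + rotationIntegral L.F M.radius a - L.angle a (ψ 0)) =
                c * (L.angle a (ψ s) - L.angle a (ψ 0)) + 2 * Real.pi := by
              rw [← hr]; ring
            rw [this, Real.sin_add_two_pi, Real.cos_add_two_pi]
            exact ⟨rfl, rfl⟩
          · have : c * (L.angle a (ψ s) + rotationIntegral L.F M.radius a - L.angle a (ψ 0)) =
                c * (L.angle a (ψ s) - L.angle a (ψ 0)) - 2 * Real.pi := by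
              rw [← hr]; ring
            rw [this, Real.sin_sub_two_pi, Real.cos_sub_two_pi]
            exact ⟨rfl, rfl⟩
        rw [hsc.1, hsc.2, ← e1, hlatT, div_left_inj' (hz.f_ne_zero hc hc0 s)] at e3
        rw [hsc.1, hsc.2, ← e2, hlatT, div_left_inj' (hz.f_ne_zero hc hc0 s)] at e4
        exact ⟨e3, e4⟩
    ext i
    fin_cases i
    · exact h01.1
    · exact h01.2
    · exact h2
  · intro ℓ hℓ hlt hper
    have hz1 : z ℓ = z 0 := by simpa using hper 0
    have hint : ∀ n : ℤ, ℓ = n * (2 * Real.pi * M.radius) → False := by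
      intro n hn
      have hTpos : 0 < 2 * Real.pi * M.radius := by positivity
      rw [hn] at hℓ hlt
      have h1 : (0 : ℝ) < n := pos_of_mul_pos_left hℓ hTpos.le
      have h2 : (n : ℝ) < 1 := by
        by_contra! h
        nlinarith
      have h3 : 0 < n := by exact_mod_cast h1
      have h4 : n < 1 := by exact_mod_cast h2
      omega
    -- Minimality. On the equator the latitude carries no information, so the period is read off the
    -- longitude, using `F 0 = m` and `c = ±m`. Elsewhere a return of `(u, mom)` forces a whole
    -- number of turns of the phase.
    by_cases ha0 : a = 0
    · subst ha0
      have hc0 : c ≠ 0 := by rintro rfl; nlinarith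
      have h0mem : (0 : ℝ) ∈ Ioo (-M.radius) M.radius := ⟨by linarith, hm⟩
      obtain ⟨n, hn⟩ := hz.exists_int_of_fst_eq L hψ hU hc hc0 h0mem
        (s := ℓ) (by rw [hz1])
      have hF0 : L.F 0 = M.radius := by
        have := hsymm 0 (Ioo_subset_Icc_self h0mem)
        rw [neg_zero] at this; linarith
      have hS' := hS ℓ
      simp only [Latitude.phaseTime, zero_mul, hF0, intervalIntegral.integral_const,
        smul_eq_mul, sub_zero] at hS'
      simp only [Latitude.angle, zero_mul, hF0, intervalIntegral.integral_const,
        smul_eq_mul, sub_zero, zero_pow two_ne_zero, hψ0] at hn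
      have h1 : c * ℓ = n * (2 * Real.pi) * M.radius ^ 2 := by
        rw [← hn]
        field_simp
        linear_combination -hS'
      have h2 : c ^ 2 = M.radius ^ 2 := by linarith
      rcases sq_eq_sq_iff_eq_or_eq_neg.1 h2 with h | h
      · refine hint n ?_
        rw [h] at h1
        refine mul_left_cancel₀ hm.ne' ?_
        linear_combination h1
      · refine hint (-n) ?_
        rw [h] at h1
        refine mul_left_cancel₀ hm.ne' ?_
        push_cast
        linear_combination -h1
    · have hl : M.lat z ℓ = M.lat z 0 := by rw [lat, lat, hz1]
      have hmo : M.mom z ℓ = M.mom z 0 := by rw [mom, mom, hl, hz1]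
      have hs : Real.sin (ψ ℓ) = Real.sin (ψ 0) := by
        refine mul_left_cancel₀ ha0 ?_
        rw [← hU, ← hU, hl]
      have hcs : Real.cos (ψ ℓ) = Real.cos (ψ 0) := by
        refine mul_left_cancel₀ ha0 ?_
        rw [← hW, ← hW, hmo]
      obtain ⟨n, hn⟩ := exists_int_of_sin_eq_of_cos_eq hs hcs
      refine hint n ?_
      have h1 := hS ℓ
      rw [hn, L.phaseTime_add, hT, hψ0] at h1
      linarith

end SurfaceOfRevolution

/-! ### Explicit geodesics leaving the equator -/

namespace SurfaceOfRevolution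

variable {M : SurfaceOfRevolution}

theorem Latitude.exists_phase_inverse (L : M.Latitude) (a : ℝ) :
    ∃ ψ : ℝ → ℝ, (∀ y, ψ (L.phaseTime a y) = y) ∧
      ∀ s, HasDerivAt ψ (L.F (a * Real.sin (ψ s)))⁻¹ s := by
  set e := (L.strictMono_phaseTime a).orderIsoOfSurjective _ (L.surjective_phaseTime a) with he
  have h1 : ∀ y, e.symm (L.phaseTime a y) = y := fun y => e.symm_apply_apply y
  have h2 : ∀ s, L.phaseTime a (e.symm s) = s := fun s => e.apply_symm_apply s
  refine ⟨e.symm, h1, fun s => ?_⟩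
  exact (L.hasDerivAt_phaseTime a _).of_local_left_inverse e.symm.continuous.continuousAt
    (L.F_pos _).ne' (Eventually.of_forall h2)

/-- The unit covector at the point of longitude `φ` of the equator that makes the angle `θ` with
the meridian. -/
noncomputable def equatorCovector (M : SurfaceOfRevolution) (φ θ : ℝ) : E3 :=
  !₂[-(Real.sin θ * Real.sin φ), Real.sin θ * Real.cos φ, deriv M.g M.t₀ * Real.cos θ]

/-- Inverting the time integral and inserting the phase into the latitude and longitude formulas
gives the geodesic for all times. Since `sin θ ≠ 0`, Clairaut's constant is nonzero and the poles
are never met. -/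
theorem Latitude.exists_isHamiltonianCurve (L : M.Latitude) {θ : ℝ} (hθ : Real.sin θ ≠ 0)
    (φ₀ : ℝ) : ∃ z, M.IsHamiltonianCurve z ∧
      z 0 = (M.param M.t₀ φ₀, M.equatorCovector φ₀ θ) ∧
      ∀ n j : ℤ, M.radius * Real.sin θ *
          (n * rotationIntegral L.F M.radius (M.radius * Real.cos θ)) = j * (2 * Real.pi) →
        z (n * L.phaseTime (M.radius * Real.cos θ) (2 * Real.pi)) = z 0 := by
  have hm := M.radius_pos
  set a := M.radius * Real.cos θ with ha
  set c := M.radius * Real.sin θ with hc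
  have hc0 : c ≠ 0 := mul_ne_zero hm.ne' hθ
  have hac : a ^ 2 + c ^ 2 = M.radius ^ 2 := by
    rw [ha, hc]; linear_combination M.radius ^ 2 * Real.sin_sq_add_cos_sq θ
  have ham := amplitude_mem_Ioo hac hc0
  obtain ⟨ψ, hψS, hψ⟩ := L.exists_phase_inverse a
  have hψ0 : ψ 0 = 0 := by simpa using hψS 0
  have hψn : ∀ n : ℤ, ψ (n * L.phaseTime a (2 * Real.pi)) = n * (2 * Real.pi) := by
    intro n
    have := L.phaseTime_add a 0 n
    rw [zero_add, L.phaseTime_zero, zero_add] at this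
    rw [← this, hψS]
  set t : ℝ → ℝ := fun s => L.inv (a * Real.sin (ψ s)) with ht
  have hw : ∀ s, a * Real.sin (ψ s) ∈ Ioo (-M.radius) M.radius := fun s => mul_sin_mem_Ioo ham _
  have htI : ∀ s, t s ∈ Ioo M.tmin M.tmax := fun s => L.inv_mem_Ioo (hw s)
  have htI' : ∀ s, t s ∈ Icc M.tmin M.tmax := fun s => Ioo_subset_Icc_self (htI s)
  have hf0 : ∀ s, M.f (t s) ≠ 0 := fun s => (M.f_pos _ (htI s)).ne'
  have hk0 : ∀ s, L.k (t s) ≠ 0 := fun s => (L.k_pos _ (htI' s)).ne'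
  have hu : ∀ s, L.u (t s) = a * Real.sin (ψ s) := fun s => L.u_inv (Ioo_subset_Icc_self (hw s))
  have hFk : ∀ s, (L.F (a * Real.sin (ψ s)))⁻¹ = L.k (t s) := by
    intro s; rw [Latitude.F, inv_inv]
  have hψ' : ∀ s, HasDerivAt ψ (L.k (t s)) s := fun s => hFk s ▸ hψ s
  have hfsq : ∀ s, M.f (t s) ^ 2 = M.radius ^ 2 - (a * Real.sin (ψ s)) ^ 2 := by
    intro s
    rw [← hu, ← L.sq_add_sq _ (htI' s)]; ring
  set p : ℝ → ℝ := fun s => a * Real.cos (ψ s) / M.f (t s) with hp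
  have ht' : ∀ s, HasDerivAt t (p s) s := by
    intro s
    refine ((L.hasDerivAt_inv (hw s)).comp s ((hψ' s).sin.const_mul a)).congr_deriv ?_
    change (M.f (t s) * L.k (t s))⁻¹ * _ = a * Real.cos (ψ s) / M.f (t s)
    have := hf0 s
    have := hk0 s
    field_simp
  have hp2 : ∀ s, p s ^ 2 * M.f (t s) ^ 2 + c ^ 2 = M.f (t s) ^ 2 := by
    intro s
    have h1 : p s * M.f (t s) = a * Real.cos (ψ s) := div_mul_cancel₀ _ (hf0 s)
    rw [← mul_pow, h1, hfsq]
    linear_combination hac + a ^ 2 * Real.sin_sq_add_cos_sq (ψ s)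
  have hfd : ∀ s, HasDerivAt (fun s => M.f (t s)) (deriv M.f (t s) * p s) s := fun s =>
    (M.hasDerivAt_f _).comp s (ht' s)
  have hp' : ∀ s, HasDerivAt p (c ^ 2 * deriv M.f (t s) / M.f (t s) ^ 3) s := by
    intro s
    refine (((hψ' s).cos.const_mul a).div (hfd s) (hf0 s)).congr_deriv ?_
    have h1 := L.deriv_f _ (htI' s)
    rw [hu] at h1
    have h2 : a * (-Real.sin (ψ s) * L.k (t s)) = deriv M.f (t s) := by rw [h1]; ring
    have h3 : a * Real.cos (ψ s) = p s * M.f (t s) := (div_mul_cancel₀ _ (hf0 s)).symm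
    have h4 := hp2 s
    have := hf0 s
    rw [h2, h3]
    field_simp
    linear_combination -deriv M.f (t s) * h4
  set φ : ℝ → ℝ := fun s => φ₀ + c * L.angle a (ψ s) with hφ
  have hφ' : ∀ s, HasDerivAt φ (c / M.f (t s) ^ 2) s := by
    intro s
    refine ((((L.hasDerivAt_angle ham (ψ s)).comp s (hψ s)).const_mul c).const_add φ₀).congr_deriv ?_
    have := (L.F_pos (a * Real.sin (ψ s))).ne'
    have := hf0 s
    rw [← hfsq]
    field_simp
  set z : ℝ → E3 × E3 := fun s => (M.param (t s) (φ s),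
    !₂[deriv M.f (t s) * p s * Real.cos (φ s) - M.f (t s) * Real.sin (φ s) * (c / M.f (t s) ^ 2),
      deriv M.f (t s) * p s * Real.sin (φ s) + M.f (t s) * Real.cos (φ s) * (c / M.f (t s) ^ 2),
      deriv M.g (t s) * p s]) with hz
  have hz1 : ∀ s, HasDerivAt (fun τ => (z τ).1) (z s).2 s := fun s =>
    hasDerivAt_param (ht' s) (hφ' s)
  -- The initial state recurs when the phase is a multiple of `2π` and the longitude gained is a
  -- multiple of `2π`.
  have hzper : ∀ s, Real.sin (ψ s) = 0 → Real.cos (ψ s) = 1 → ∀ j : ℤ,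
      c * L.angle a (ψ s) = j * (2 * Real.pi) →
      z s = (M.param M.t₀ φ₀, M.equatorCovector φ₀ θ) := by
    intro s hs0 hc1 j hj
    have e1 : t s = M.t₀ := by simp only [ht]; rw [hs0, mul_zero, L.inv_zero]
    have e2 : p s = Real.cos θ := by
      simp only [hp]
      rw [e1, hc1, mul_one, ha]
      exact mul_div_cancel_left₀ _ hm.ne'
    have e3 : Real.sin (φ s) = Real.sin φ₀ := by
      simp only [hφ]; rw [hj, Real.sin_add_int_mul_two_pi]
    have e4 : Real.cos (φ s) = Real.cos φ₀ := by
      simp only [hφ]; rw [hj, Real.cos_add_int_mul_two_pi]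
    have e5 : M.f M.t₀ * (c / M.f M.t₀ ^ 2) = Real.sin θ := by
      change M.radius * (c / M.radius ^ 2) = _
      rw [hc]; field_simp
    refine Prod.ext ?_ ?_
    · ext i
      fin_cases i <;> simp [hz, e1, e3, e4]
    · simp only [hz]
      rw [e1, e2, e3, e4, M.deriv_f_t₀]
      ext i
      fin_cases i
      · simp [equatorCovector]
        linear_combination Real.sin φ₀ * e5
      · simp [equatorCovector]
        linear_combination Real.cos φ₀ * e5
      · simp [equatorCovector]
  have hz0 : z 0 = (M.param M.t₀ φ₀, M.equatorCovector φ₀ θ) :=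
    hzper 0 (by rw [hψ0, Real.sin_zero]) (by rw [hψ0, Real.cos_zero]) 0
      (by rw [hψ0, L.angle_zero]; simp)
  refine ⟨z, ?_, hz0, ?_⟩
  · refine isHamiltonianCurve_of_geodesic (z' := fun s => (0,
      !₂[(deriv (deriv M.f) (t s) * p s ^ 2 + deriv M.f (t s) *
          (c ^ 2 * deriv M.f (t s) / M.f (t s) ^ 3) - c ^ 2 / M.f (t s) ^ 3) * Real.cos (φ s),
        (deriv (deriv M.f) (t s) * p s ^ 2 + deriv M.f (t s) *
          (c ^ 2 * deriv M.f (t s) / M.f (t s) ^ 3) - c ^ 2 / M.f (t s) ^ 3) * Real.sin (φ s),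
        deriv (deriv M.g) (t s) * p s ^ 2 + deriv M.g (t s) *
          (c ^ 2 * deriv M.f (t s) / M.f (t s) ^ 3)])) ?_ ?_ hz1 ?_ ?_
    · intro s
      exact ⟨param_mem_carrier (htI' s) _,
        mem_tangentPlane_of_hasDerivAt (fun τ => param_mem_carrier (htI' τ) _) (hz1 s)⟩
    · intro s
      rw [← sq_eq_sq₀ (norm_nonneg _) zero_le_one, one_pow, norm_sq_E3]
      have h1 := M.unit_speed _ (htI' s)
      have h2 := hp2 s
      have h3 := Real.sin_sq_add_cos_sq (φ s)
      have h4 := hf0 s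
      have h5 : M.f (t s) * (c / M.f (t s) ^ 2) = c / M.f (t s) := by field_simp
      have h6 : p s ^ 2 + (c / M.f (t s)) ^ 2 = 1 := by
        field_simp
        linear_combination h2
      simp [hz]
      linear_combination ((deriv M.f (t s) * p s) ^ 2 + (M.f (t s) * (c / M.f (t s) ^ 2)) ^ 2) * h3
        + (M.f (t s) * (c / M.f (t s) ^ 2) + c / M.f (t s)) * h5 + p s ^ 2 * h1 + h6
    · intro s
      have hf' : HasDerivAt (fun s => deriv M.f (t s)) (deriv (deriv M.f) (t s) * p s) s :=
        (M.hasDerivAt_deriv_f _).comp s (ht' s)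
      have hg' : HasDerivAt (fun s => deriv M.g (t s)) (deriv (deriv M.g) (t s) * p s) s :=
        (M.hasDerivAt_deriv_g _).comp s (ht' s)
      have hq : HasDerivAt (fun s => c / M.f (t s) ^ 2)
          (-(2 * c * deriv M.f (t s) * p s / M.f (t s) ^ 3)) s := by
        refine ((hasDerivAt_const s c).div ((hfd s).pow 2) (pow_ne_zero 2 (hf0 s))).congr_deriv ?_
        have := hf0 s
        simp only [Pi.pow_apply]
        field_simp
        push_cast; ring
      have h4 := hf0 s
      rw [hasDerivAt_E3]
      intro i
      fin_cases i
      · refine (((hf'.mul (hp' s)).mul (hφ' s).cos).sub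
          (((hfd s).mul (hφ' s).sin).mul hq)).congr_deriv ?_
        simp
        field_simp
        ring
      · refine (((hf'.mul (hp' s)).mul (hφ' s).sin).add
          (((hfd s).mul (hφ' s).cos).mul hq)).congr_deriv ?_
        simp
        field_simp
        ring
      · refine (hg'.mul (hp' s)).congr_deriv ?_
        simp
        ring
    -- Normality of the acceleration: the radial part, the derivative of `f'² + g'² = 1`, and that
    -- equation itself combine with the geodesic equation `p' = c² f'/f³`.
    · intro s w hw
      obtain ⟨α, h1, h2⟩ := exists_of_mem_tangentPlane hw
      have h3 : M.profileTime (z s).1 = t s := profileTime_param (htI' s) _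
      rw [h3] at h1 h2
      have h4 := hf0 s
      have h5 : Real.cos (φ s) * w 0 + Real.sin (φ s) * w 1 = deriv M.f (t s) * α := by
        refine mul_left_cancel₀ h4 ?_
        simp [hz] at h1
        linear_combination h1
      have h6 := M.unit_speed _ (htI' s)
      have h7 := deriv_mul_deriv_deriv_add (htI s)
      rw [inner_E3]
      simp
      rw [h2]
      linear_combination (deriv (deriv M.f) (t s) * p s ^ 2 + deriv M.f (t s) *
          (c ^ 2 * deriv M.f (t s) / M.f (t s) ^ 3) - c ^ 2 / M.f (t s) ^ 3) * h5 +
        α * p s ^ 2 * h7 + α * (c ^ 2 * deriv M.f (t s) / M.f (t s) ^ 3) * h6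
  · intro n j hnj
    rw [hz0]
    have hang := L.angle_add ham 0 n
    rw [zero_add, L.angle_zero, zero_add] at hang
    refine hzper _ ?_ ?_ j ?_
    · rw [hψn]
      have := Real.sin_add_int_mul_two_pi 0 n
      simpa using this
    · rw [hψn]
      simp
    · rw [hψn, hang, hnj]

end SurfaceOfRevolution

/-! ### The recurrent set over a point of the equator -/

namespace SurfaceOfRevolution

variable {M : SurfaceOfRevolution}

theorem deriv_g_t₀_sq (M : SurfaceOfRevolution) : deriv M.g M.t₀ ^ 2 = 1 := by
  have := M.unit_speed _ M.t₀_mem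
  rwa [M.deriv_f_t₀, zero_pow two_ne_zero, zero_add] at this

theorem equatorCovector_mem_cosphere (φ θ : ℝ) :
    M.equatorCovector φ θ ∈ M.cosphere (M.param M.t₀ φ) := by
  have hcar := param_mem_carrier M.t₀_mem φ
  refine ⟨⟨hcar, (mem_tangentPlane_iff hcar).2 ⟨Real.cos θ, ?_, ?_⟩⟩, ?_⟩
  · rw [profileTime_param M.t₀_mem, M.deriv_f_t₀]
    simp [equatorCovector]; ring
  · rw [profileTime_param M.t₀_mem]
    simp [equatorCovector]
  · change ‖M.equatorCovector φ θ‖ = 1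
    rw [← sq_eq_sq₀ (norm_nonneg _) zero_le_one, one_pow, norm_sq_E3]
    simp [equatorCovector]
    linear_combination Real.sin θ ^ 2 * Real.sin_sq_add_cos_sq φ +
      Real.cos θ ^ 2 * M.deriv_g_t₀_sq + Real.sin_sq_add_cos_sq θ

theorem exists_eq_equatorCovector {φ : ℝ} {ξ : E3} (hξ : ξ ∈ M.cosphere (M.param M.t₀ φ)) :
    ∃ θ, ξ = M.equatorCovector φ θ := by
  obtain ⟨⟨-, ht⟩, hn⟩ := hξ
  obtain ⟨α, h1, h2⟩ := exists_of_mem_tangentPlane ht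
  rw [profileTime_param M.t₀_mem, M.deriv_f_t₀] at h1
  rw [profileTime_param M.t₀_mem] at h2
  change ξ 2 = _ at h2
  simp at h1
  change M.f M.t₀ * Real.cos φ * ξ 0 + M.f M.t₀ * Real.sin φ * ξ 1 = 0 at h1
  have h3 : Real.cos φ * ξ 0 + Real.sin φ * ξ 1 = 0 := by
    refine mul_left_cancel₀ M.radius_pos.ne' ?_
    rw [radius]
    linear_combination h1
  have hn' : ξ 0 ^ 2 + ξ 1 ^ 2 + ξ 2 ^ 2 = 1 := by
    rw [← norm_sq_E3]
    change ‖ξ‖ = 1 at hn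
    rw [hn, one_pow]
  have e := Real.sin_sq_add_cos_sq φ
  have h4 : α ^ 2 + (-(ξ 0) * Real.sin φ + ξ 1 * Real.cos φ) ^ 2 = 1 ^ 2 := by
    rw [h2] at hn'
    linear_combination hn' - α ^ 2 * M.deriv_g_t₀_sq + (ξ 0 ^ 2 + ξ 1 ^ 2) * e -
      (Real.cos φ * ξ 0 + Real.sin φ * ξ 1) * h3
  obtain ⟨θ, h5, h6⟩ := exists_eq_mul_cos_sin zero_le_one h4
  rw [one_mul] at h5 h6
  refine ⟨θ, ?_⟩
  ext i
  fin_cases i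
  · simp [equatorCovector]
    rw [← h6]
    linear_combination (-(ξ 0)) * e + Real.cos φ * h3
  · simp [equatorCovector]
    rw [← h6]
    linear_combination (-(ξ 1)) * e + Real.sin φ * h3
  · simp [equatorCovector]
    rw [h2, h5]

theorem continuous_equatorCovector (φ : ℝ) : Continuous (M.equatorCovector φ) := by
  refine (EuclideanSpace.equiv (Fin 3) ℝ).symm.continuous.comp (continuous_pi fun i => ?_)
  fin_cases i
  · simp; fun_prop
  · simp; fun_prop
  · simp; fun_prop

/-- The advance in longitude over a full period of the oscillation in latitude, as a function of
the amplitude of the oscillation. -/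
noncomputable def Latitude.rotation (L : M.Latitude) (a : ℝ) : ℝ :=
  √(M.radius ^ 2 - a ^ 2) * rotationIntegral L.F M.radius a

theorem Latitude.analyticOnNhd_rotation (L : M.Latitude) :
    AnalyticOnNhd ℝ L.rotation (Ioo (-M.radius) M.radius) := by
  intro a ha
  refine AnalyticAt.mul ?_ (analyticOnNhd_rotationIntegral L.analyticOnNhd_F a ha)
  exact (Real.analyticAt_sqrt (sq_sub_sq_pos_of_mem_Ioo ha).ne').comp
    (f := fun a => M.radius ^ 2 - a ^ 2) (by fun_prop)

theorem Latitude.rotation_mul_cos (L : M.Latitude) (θ : ℝ) :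
    L.rotation (M.radius * Real.cos θ) =
      |M.radius * Real.sin θ| * rotationIntegral L.F M.radius (M.radius * Real.cos θ) := by
  rw [Latitude.rotation, ← Real.sqrt_sq_eq_abs]
  congr 2
  linear_combination -M.radius ^ 2 * Real.sin_sq_add_cos_sq θ

theorem Latitude.mul_rotationIntegral_eq (L : M.Latitude) (θ : ℝ) :
    (∃ q : ℚ, L.rotation (M.radius * Real.cos θ) = 2 * Real.pi * q) ↔
      ∃ q : ℚ, M.radius * Real.sin θ *
        rotationIntegral L.F M.radius (M.radius * Real.cos θ) = 2 * Real.pi * q := by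
  rw [L.rotation_mul_cos]
  rcases abs_cases (M.radius * Real.sin θ) with ⟨h, -⟩ | ⟨h, -⟩ <;> rw [h]
  constructor <;> rintro ⟨q, hq⟩ <;> refine ⟨-q, ?_⟩ <;> push_cast <;> linarith

/-- After as many oscillations as the denominator of `q`, the longitude has advanced by a multiple
of `2π`, so the orbit is periodic and returns to `ξ` itself at arbitrarily large positive and
negative times. -/
theorem mem_recurrentSet_of_rational (L : M.Latitude) (φ : ℝ) {θ : ℝ} (hθ : Real.sin θ ≠ 0)
    (hq : ∃ q : ℚ, L.rotation (M.radius * Real.cos θ) = 2 * Real.pi * q) :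
    (⟨M.equatorCovector φ θ, equatorCovector_mem_cosphere φ θ⟩ :
      M.cosphere (M.param M.t₀ φ)) ∈ M.recurrentSet (M.param M.t₀ φ) := by
  obtain ⟨q, hq⟩ := (L.mul_rotationIntegral_eq θ).1 hq
  obtain ⟨z, hH, hz0, hper⟩ := L.exists_isHamiltonianCurve hθ φ
  set T := L.phaseTime (M.radius * Real.cos θ) (2 * Real.pi) with hT
  have hTpos : 0 < T := by
    rw [← L.phaseTime_zero (M.radius * Real.cos θ)]
    exact L.strictMono_phaseTime _ Real.two_pi_pos
  have hd : (q.den : ℝ) ≠ 0 := by exact_mod_cast q.den_ne_zero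
  have hdT : 0 < q.den * T := by positivity
  have hret : ∀ k : ℤ, z (k * (q.den * T)) = z 0 := by
    intro k
    have h := hper (k * q.den) (k * q.num) ?_
    · rw [← h]; congr 1; push_cast; ring
    · have h1 : (q : ℝ) * q.den = q.num := by exact_mod_cast Rat.mul_den_eq_num q
      push_cast
      linear_combination (k * q.den : ℝ) * hq + 2 * Real.pi * k * h1
  constructor
  · rw [mem_iInter₂]
    intro t _
    obtain ⟨n, hn⟩ := exists_nat_gt (t / (q.den * T))
    rw [div_lt_iff₀ hdT] at hn
    refine subset_closure ⟨n * (q.den * T), hn, z, hH, hz0, ?_⟩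
    have := hret n
    rw [Int.cast_natCast] at this
    rw [this, hz0]
  · rw [mem_iInter₂]
    intro t _
    obtain ⟨n, hn⟩ := exists_nat_gt (t / (q.den * T))
    rw [div_lt_iff₀ hdT] at hn
    refine subset_closure ⟨n * (q.den * T), hn, z, hH, hz0, ?_⟩
    have := hret (-n)
    rw [Int.cast_neg, Int.cast_natCast, neg_mul] at this
    rw [this, hz0]

/-- Returns over `x` occur only at phases `k π` whose longitude is a multiple of `2π`. Two such `k`
of the same parity differ by whole oscillations, which would make the rotation rational. Hence at
most two values of `k` occur, and after the last return the forward limit set is empty. -/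
theorem rational_of_mem_recurrentSet (L : M.Latitude) {φ θ : ℝ} (hθ : Real.sin θ ≠ 0)
    (hθ' : Real.cos θ ≠ 0)
    (hR : (⟨M.equatorCovector φ θ, equatorCovector_mem_cosphere φ θ⟩ :
      M.cosphere (M.param M.t₀ φ)) ∈ M.recurrentSet (M.param M.t₀ φ)) :
    ∃ q : ℚ, L.rotation (M.radius * Real.cos θ) = 2 * Real.pi * q := by
  have hm := M.radius_pos
  rw [L.mul_rotationIntegral_eq]
  set a := M.radius * Real.cos θ with ha
  set c := M.radius * Real.sin θ with hc
  have hc0 : c ≠ 0 := mul_ne_zero hm.ne' hθ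
  have ha0 : a ≠ 0 := mul_ne_zero hm.ne' hθ'
  have hac : a ^ 2 + c ^ 2 = M.radius ^ 2 := by
    rw [ha, hc]; linear_combination M.radius ^ 2 * Real.sin_sq_add_cos_sq θ
  have ham := amplitude_mem_Ioo hac hc0
  by_contra! hirr
  set K : Set ℤ := {k | ∃ n : ℤ, c * L.angle a (k * Real.pi) = n * (2 * Real.pi)} with hK
  have hinj : ∀ k ∈ K, ∀ d : ℤ, k + d * 2 ∈ K → d = 0 := by
    rintro k ⟨n, hn⟩ d ⟨n', hn'⟩
    by_contra hd
    have hd' : (d : ℝ) ≠ 0 := by exact_mod_cast hd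
    have h1 := L.angle_add ham (k * Real.pi) d
    have h2 : (k * Real.pi + d * (2 * Real.pi) : ℝ) = ((k + d * 2 : ℤ) : ℝ) * Real.pi := by
      push_cast; ring
    rw [h2] at h1
    rw [h1] at hn'
    refine hirr ((n' - n) / d) ?_
    push_cast
    field_simp
    linear_combination hn' - hn
  have hfin : K.Finite := by
    have hsub : ∀ r : ℤ, ({k ∈ K | k % 2 = r}).Subsingleton := by
      rintro r k ⟨hk, hkr⟩ k' ⟨hk', hkr'⟩
      have h1 : k' = k + ((k' - k) / 2) * 2 := by omega
      have := hinj k hk ((k' - k) / 2) (h1 ▸ hk')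
      omega
    refine ((hsub 0).finite.union (hsub 1).finite).subset fun k hk => ?_
    rcases Int.emod_two_eq_zero_or_one k with h | h
    · exact Or.inl ⟨hk, h⟩
    · exact Or.inr ⟨hk, h⟩
  obtain ⟨B, hB⟩ := (hfin.image fun k : ℤ => L.phaseTime a (k * Real.pi)).bddAbove
  -- `B` bounds all return times; the maximum with `1` supplies the positivity required of `T`.
  have hmem := mem_iInter₂.1 hR.1 (max B 1) (mem_Ioi.2 (lt_max_of_lt_right one_pos))
  suffices hempty : {ζ : M.cosphere (M.param M.t₀ φ) | ∃ t > max B 1,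
      M.FlowsTo t (M.param M.t₀ φ, M.equatorCovector φ θ) (M.param M.t₀ φ, ζ)} = ∅ by
    rw [hempty, closure_empty] at hmem
    exact hmem
  refine eq_empty_of_forall_notMem fun ζ => ?_
  rintro ⟨t, ht, z, hH, hz0, hzt⟩
  have hz := hH.isGeodesicLift (by
    rw [hz0]; exact (equatorCovector_mem_cosphere (M := M) φ θ).2)
  have hx0 : (z 0).1 = M.param M.t₀ φ := by rw [hz0]
  have hv0 : (z 0).2 = M.equatorCovector φ θ := by rw [hz0]
  have hxt : (z t).1 = M.param M.t₀ φ := by rw [hzt]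
  have hlat0 : M.lat z 0 = M.t₀ := by rw [lat, hx0, profileTime_param M.t₀_mem]
  have hlatt : M.lat z t = M.t₀ := by rw [lat, hxt, profileTime_param M.t₀_mem]
  obtain ⟨c', hc'⟩ := hz.exists_clairaut
  have hcc : c' = c := by
    rw [← hc' 0, hx0, hv0, hc]
    simp [equatorCovector]
    change M.radius * _ * _ + M.radius * _ * _ = _
    linear_combination M.radius * Real.sin θ * Real.sin_sq_add_cos_sq φ
  rw [hcc] at hc'
  have hU0 : L.u (M.lat z 0) = a * Real.sin 0 := by rw [hlat0, L.u_t₀, Real.sin_zero, mul_zero]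
  have hW0 : M.mom z 0 = a * Real.cos 0 := by
    rw [mom, hlat0, M.deriv_f_t₀, hv0, Real.cos_zero, mul_one, ha]
    simp [equatorCovector]
    change M.radius * _ * _ = _
    linear_combination M.radius * Real.cos θ * M.deriv_g_t₀_sq
  obtain ⟨ψ, hψ0, hψ, hU, hW, hS⟩ := hz.exists_phase L hU0 hW0
  -- Here `a ≠ 0` matters: the equator itself has latitude zero at every phase.
  have hsin : Real.sin (ψ t) = 0 := by
    have := hU t
    rw [hlatt, L.u_t₀] at this
    exact (mul_eq_zero.1 this.symm).resolve_left ha0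
  obtain ⟨k, hk⟩ := Real.sin_eq_zero_iff.1 hsin
  obtain ⟨n, hn⟩ := hz.exists_int_of_fst_eq L hψ hU hc' hc0 ham (s := t) (by rw [hxt, hx0])
  rw [hψ0, L.angle_zero, sub_zero, ← hk] at hn
  have ht' := hS t
  rw [L.phaseTime_zero, add_zero, ← hk] at ht'
  have hle : t ≤ B := hB ⟨k, ⟨n, hn⟩, ht'⟩
  exact absurd (lt_of_le_of_lt (le_max_left B 1) ht) (not_lt.2 hle)

theorem dense_recurrentSet (L : M.Latitude)
    (hne : ¬ ∃ C, ∀ a ∈ Ioo (-M.radius) M.radius, L.rotation a = C) (φ : ℝ) :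
    Dense (M.recurrentSet (M.param M.t₀ φ)) := by
  set e : ℝ → M.cosphere (M.param M.t₀ φ) := fun θ =>
    ⟨M.equatorCovector φ θ, equatorCovector_mem_cosphere φ θ⟩ with he
  have hcont : Continuous e := (continuous_equatorCovector φ).subtype_mk _
  have hsurj : Function.Surjective e := by
    rintro ⟨ξ, hξ⟩
    obtain ⟨θ, rfl⟩ := exists_eq_equatorCovector hξ
    exact ⟨θ, rfl⟩
  rw [dense_iff_inter_open]
  intro V hV hVne
  obtain ⟨θ, hθV, -, hs, hq⟩ := exists_rat_two_pi_mul_eq_of_not_const M.radius_pos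
    L.analyticOnNhd_rotation hne (hV.preimage hcont) (hVne.preimage hsurj)
  exact ⟨e θ, hθV, mem_recurrentSet_of_rational L φ hs hq⟩

theorem countable_recurrentSet (L : M.Latitude)
    (hne : ¬ ∃ C, ∀ a ∈ Ioo (-M.radius) M.radius, L.rotation a = C) (φ : ℝ) :
    (M.recurrentSet (M.param M.t₀ φ)).Countable := by
  have hm := M.radius_pos
  -- Possible values of `cos θ`: rational rotation, or one of the exceptional directions, along the
  -- equator (`0`) or a meridian (`±1`). The value of `cos θ` and the sign of `sin θ` determine the
  -- covector.
  set Y : Set ℝ := {y | M.radius * y ∈ Ioo (-M.radius) M.radius ∧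
    ∃ q : ℚ, L.rotation (M.radius * y) = 2 * Real.pi * q} ∪ {0, 1, -1} with hY
  have hYc : Y.Countable := by
    refine Countable.union ?_ (by simp)
    exact (countable_setOf_exists_rat_two_pi_mul_eq isPreconnected_Ioo L.analyticOnNhd_rotation
      hne).preimage_of_injOn (f := fun y => M.radius * y)
      (mul_right_injective₀ hm.ne').injOn
  have hc : ((fun p : ℝ × ℝ => (!₂[-(p.2 * √(1 - p.1 ^ 2) * Real.sin φ),
      p.2 * √(1 - p.1 ^ 2) * Real.cos φ, deriv M.g M.t₀ * p.1] : E3)) ''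
      (Y ×ˢ ({1, -1} : Set ℝ))).Countable :=
    (hYc.prod (by simp)).image _
  refine countable_of_injective_of_countable_image Subtype.val_injective.injOn (hc.mono ?_)
  rintro _ ⟨⟨ξ, hξ⟩, hR, rfl⟩
  obtain ⟨θ, rfl⟩ := exists_eq_equatorCovector hξ
  have e := Real.sin_sq_add_cos_sq θ
  have hsqrt : √(1 - Real.cos θ ^ 2) = |Real.sin θ| := by
    rw [← Real.sqrt_sq_eq_abs]; congr 1; linarith
  have hYθ : Real.cos θ ∈ Y := by
    by_cases hs : Real.sin θ = 0
    · rw [hs] at e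
      have : Real.cos θ ^ 2 = 1 := by linarith
      rcases sq_eq_one_iff.1 this with h | h <;> simp [hY, h]
    by_cases hcs : Real.cos θ = 0
    · simp [hY, hcs]
    refine Or.inl ⟨amplitude_mem_Ioo (c := M.radius * Real.sin θ) ?_ (mul_ne_zero hm.ne' hs),
      rational_of_mem_recurrentSet L hs hcs hR⟩
    linear_combination M.radius ^ 2 * e
  rcases abs_cases (Real.sin θ) with ⟨h, -⟩ | ⟨h, -⟩
  · exact ⟨(Real.cos θ, 1), ⟨hYθ, by simp⟩, by simp [hsqrt, h, equatorCovector]⟩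
  · exact ⟨(Real.cos θ, -1), ⟨hYθ, by simp⟩, by simp [hsqrt, h, equatorCovector]⟩

end SurfaceOfRevolution

theorem mainTheorem3 (M : SurfaceOfRevolution)
    (hf : AnalyticOnNhd ℝ M.f (Set.Icc M.tmin M.tmax))
    (hZoll : ¬ M.IsZoll)
    (x : E3) (hx : x ∈ M.equator) :
    Dense (M.recurrentSet x) ∧ M.liouville x (M.recurrentSet x) = 0 := by
  obtain ⟨L⟩ := M.nonempty_latitude hf
  obtain ⟨φ, rfl⟩ := hx
  have hne : ¬ ∃ C, ∀ a ∈ Ioo (-M.radius) M.radius, L.rotation a = C := by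
    rintro ⟨C, hC⟩
    exact hZoll (SurfaceOfRevolution.isZoll_of_forall_rotationIntegral_eq L hC)
  refine ⟨SurfaceOfRevolution.dense_recurrentSet L hne φ, ?_⟩
  -- One-dimensional Hausdorff measure has no atoms, so the countable recurrent set is null.
  have : NullSingletonClass (M.liouville (M.param M.t₀ φ)) :=
    Measure.nullSingletonClass_hausdorff _ one_pos
  exact (SurfaceOfRevolution.countable_recurrentSet L hne φ).measure_zero _
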